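/- Let $X$ be a connected smooth $7$-manifold (without boundary) and let $\varphi$ be a smooth $3$-form on $X$ which is a $G_2$-structure: for every $x\in X$ there is a linear isomorphism $T_xX\cong\mathbb R^7$ identifying $\varphi_x$ with $e^{123}+e^{145}+e^{167}+e^{246}-e^{257}-e^{347}-e^{356}$. Let $g_\varphi$ be the Riemannian metric induced by $\varphi$ (the one which such isomorphisms identify with the Euclidean metric). Assume that $(X,\varphi)$ is a complete $G_2$-manifold, i.e. $\nabla\varphi=0$ for the Levi-Civita connection $\nabla$ of $g_\varphi$, and $g_\varphi$ is complete. Assume moreover that $\varphi$ is $d$(linear): there are a smooth $2$-form $\beta$ on $X$, a point $x_0\in X$ and a number $c>0$ such that $$\varphi=d\beta,\qquad |\varphi(x)|\le c,\qquad |\beta(x)|\le c\,(1+\rho(x_0,x))\qquad\text{for all }x\in X,$$ where $\rho$ is the Riemannian distance. For each $p\ge 0$ let $\mathcal H^p_{(2)}(X)$ be the space of smooth real $p$-forms $\alpha$ on $X$ with $\int_X|\alpha|^2\,d\mathrm{vol}<\infty$ and $\Delta\alpha=(dd^*+d^*d)\alpha=0$. Then $\mathcal H^p_{(2)}(X)=\{0\}$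 for every $p\ne 3,4$; in particular $\mathcal H^2_{(2)}(X)=\{0\}$. -/

import Mathlib

open MeasureTheory
open scoped Manifold ContDiff Topology ENNReal

noncomputable section

namespace RiemForm

/-- The model space `ℝⁿ` with its Euclidean inner product. -/
abbrev EucSp (n : ℕ) := EuclideanSpace ℝ (Fin n)

/-- The Christoffel symbols at `y` of a metric `g` on (a part of) `ℝⁿ`, where `b` is a basis that is
orthonormal for `g` at `y`: `Γ(u, v) = ∑ uⁱ vʲ Γᵏᵢⱼ ∂ₖ` is the vector such that
`g(Γ(u, v), w) = (∂ᵤ g(v, w) + ∂ᵥ g(u, w) - ∂_w g(u, v)) / 2` for all `w`. -/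
def christoffelOf {n : ℕ} {ι : Type*} [Fintype ι]
    (g : EucSp n → EucSp n →L[ℝ] EucSp n →L[ℝ] ℝ) (y : EucSp n) (b : ι → EucSp n) (u : EucSp n) :
    EucSp n →L[ℝ] EucSp n :=
  let dg : EucSp n →L[ℝ] EucSp n →L[ℝ] EucSp n →L[ℝ] ℝ := fderiv ℝ g y
  LinearMap.toContinuousLinearMap
    { toFun := fun v ↦ ∑ i, ((dg u v (b i) + dg v u (b i) - dg (b i) u v) / 2) • b i
      map_add' := fun v w ↦ by
        rw [← Finset.sum_add_distrib]
        refine Finset.sum_congr rfl fun i _ ↦ ?_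
        rw [← add_smul]
        congr 1
        simp only [map_add, add_apply]
        ring
      map_smul' := fun c v ↦ by
        rw [Finset.smul_sum]
        refine Finset.sum_congr rfl fun i _ ↦ ?_
        rw [smul_smul]
        congr 1
        simp only [map_smul, smul_apply, smul_eq_mul, RingHom.id_apply]
        ring }

section Forms

variable (n : ℕ) (X : Type*) [TopologicalSpace X] [ChartedSpace (EucSp n) X]

/-- Real differential forms of degree `p` on the `n`-manifold `X`, with no regularity imposed:
an alternating `p`-linear form on every tangent space. -/
abbrev DForm (p : ℕ) := (x : X) → (TangentSpace (𝓡 n) x) [⋀^Fin p]→L[ℝ] ℝ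

variable {n X}

/-- The derivative at `y` of the inverse of the preferred chart at `x`, a linear map from `ℝⁿ` to
the tangent space of `X` at the point with coordinates `y`. -/
def chartInvD (x : X) (y : EucSp n) :
    EucSp n →L[ℝ] TangentSpace (𝓡 n) ((extChartAt (𝓡 n) x).symm y) :=
  mfderiv (𝓡 n) (𝓡 n) (extChartAt (𝓡 n) x).symm y

/-- The derivative at `x` of the preferred chart at `x`. -/
def chartD (x : X) : TangentSpace (𝓡 n) x →L[ℝ] EucSp n :=
  mfderiv (𝓡 n) (𝓡 n) (extChartAt (𝓡 n) x) x

variable {p : ℕ}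

/-- The expression of a differential form in the coordinates given by the preferred chart at `x`. -/
def DForm.inChart (α : DForm n X p) (x : X) (y : EucSp n) : (EucSp n) [⋀^Fin p]→L[ℝ] ℝ :=
  (α ((extChartAt (𝓡 n) x).symm y)).compContinuousLinearMap (chartInvD x y)

/-- A differential form is smooth if all its coordinate expressions are. -/
def DForm.IsSmooth (α : DForm n X p) : Prop :=
  ∀ x : X, ContDiffOn ℝ ∞ (α.inChart x) (extChartAt (𝓡 n) x).target

/-- The exterior derivative, computed at `x` in the preferred chart at `x`. -/
def DForm.extd (α : DForm n X p) : DForm n X (p + 1) := fun x ↦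
  (extDeriv (α.inChart x) (extChartAt (𝓡 n) x x)).compContinuousLinearMap (chartD x)

end Forms

section Riemannian

open Bundle

variable {n : ℕ} {X : Type*} [TopologicalSpace X] [ChartedSpace (EucSp n) X]
  [RiemannianBundle (fun x : X ↦ TangentSpace (𝓡 n) x)]

/-- Tangent spaces are finite dimensional. -/
instance instFiniteDimensionalTangent (x : X) : FiniteDimensional ℝ (TangentSpace (𝓡 n) x) :=
  inferInstanceAs (FiniteDimensional ℝ (EucSp n))

/-- An orthonormal basis of the tangent space at `x`. -/
def tangentONB (x : X) :
    OrthonormalBasis (Fin (Module.finrank ℝ (TangentSpace (𝓡 n) x))) ℝ (TangentSpace (𝓡 n) x) :=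
  stdOrthonormalBasis ℝ (TangentSpace (𝓡 n) x)

/-- The metric tensor in the coordinates given by the preferred chart at `x`. -/
def chartMetric (x : X) (y : EucSp n) : EucSp n →L[ℝ] EucSp n →L[ℝ] ℝ :=
  (innerSL ℝ (E := TangentSpace (𝓡 n) ((extChartAt (𝓡 n) x).symm y))).bilinearComp
    (chartInvD x y) (chartInvD x y)

/-- The Christoffel symbols of the Levi-Civita connection at `x`, in the coordinates given by the
preferred chart at `x`. -/
def christoffel (x : X) (u : EucSp n) : EucSp n →L[ℝ] EucSp n :=
  christoffelOf (chartMetric x) (extChartAt (𝓡 n) x x) (fun i ↦ chartD x (tangentONB x i)) u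

variable {p : ℕ}

/-- The covariant derivative `∇_u α` of a form at `x` for the Levi-Civita connection: in the chart
at `x`, `(∇_u α)(v₁, …, v_p) = ∂ᵤ (α(v₁, …, v_p)) - ∑ᵢ α(v₁, …, Γ(u, vᵢ), …, v_p)`. -/
def DForm.covDeriv (α : DForm n X p) (x : X) (u : TangentSpace (𝓡 n) x) :
    (TangentSpace (𝓡 n) x) [⋀^Fin p]→L[ℝ] ℝ :=
  (fderiv ℝ (α.inChart x) (extChartAt (𝓡 n) x x) (chartD x u)
    - (α.inChart x (extChartAt (𝓡 n) x x)).fderivCompContinuousLinearMap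
        (ContinuousLinearMap.id ℝ (EucSp n)) (christoffel x (chartD x u))).compContinuousLinearMap
    (chartD x)

/-- A form is parallel if `∇α = 0` for the Levi-Civita connection. -/
def DForm.IsParallel (α : DForm n X p) : Prop :=
  ∀ (x : X) (u : TangentSpace (𝓡 n) x), α.covDeriv x u = 0

/-- The codifferential `d* α = - ∑ᵢ ι(eᵢ) ∇_{eᵢ} α`, the formal adjoint of the exterior
derivative. -/
def DForm.codiff (α : DForm n X (p + 1)) : DForm n X p := fun x ↦
  - ∑ i, (α.covDeriv x (tangentONB x i)).curryLeft (tangentONB x i)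

/-- The Hodge Laplacian `Δ = d d* + d* d` (on functions, `Δ = d* d`). -/
def DForm.laplacian : {p : ℕ} → DForm n X p → DForm n X p
  | 0, α => α.extd.codiff
  | _ + 1, α => α.codiff.extd + α.extd.codiff

/-- The pointwise inner product of two forms, for which the `e^{i₁} ∧ ⋯ ∧ e^{i_p}`,
`i₁ < ⋯ < i_p`, are orthonormal if the `eᵢ` are. The sum is over all multi-indices, hence the
factor `1 / p!`. -/
def DForm.pointInner (α β : DForm n X p) (x : X) : ℝ :=
  (∑ s : Fin p → Fin (Module.finrank ℝ (TangentSpace (𝓡 n) x)),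
    α x (fun j ↦ tangentONB x (s j)) * β x (fun j ↦ tangentONB x (s j))) / (p.factorial : ℝ)

/-- The pointwise norm of a form. -/
def DForm.pointNorm (α : DForm n X p) (x : X) : ℝ := √(α.pointInner α x)

/-- The Riemannian measure of the domain of the preferred chart at `x`: `√(det g_{ij}) dy`. -/
def chartVolume [MeasurableSpace X] (x : X) : Measure X :=
  (((volume : Measure (EucSp n)).restrict (extChartAt (𝓡 n) x).target).withDensity
    (fun y ↦ ENNReal.ofReal √(Matrix.det (Matrix.of fun i j : Fin n ↦
      chartMetric x y (EuclideanSpace.single i 1) (EuclideanSpace.single j 1))))).map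
    (extChartAt (𝓡 n) x).symm

variable (n X) in
/-- The Riemannian measure of `X`: the measures `√(det g_{ij}) dy` on the chart domains are the
restrictions to these domains of one measure on `X`, which is their supremum. -/
def riemVolume [MeasurableSpace X] : Measure X := ⨆ x : X, chartVolume (n := n) x

variable (n X p) in
/-- The space of `L²` harmonic `p`-forms: the smooth square-integrable `p`-forms `α` with
`Δ α = 0`. -/
def l2Harmonic [MeasurableSpace X] : Set (DForm n X p) :=
  {α | α.IsSmooth ∧ ∫⁻ x, ENNReal.ofReal (α.pointNorm x ^ 2) ∂(riemVolume n X) < ⊤ ∧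
    α.laplacian = 0}

/-- A form `η` is `d`(linear) if `η = dβ` for a smooth form `β` of at most linear growth, and
`η` is bounded. -/
def DForm.IsDLinear {n : ℕ} {X : Type*} [MetricSpace X] [ChartedSpace (EucSp n) X]
    [RiemannianBundle (fun x : X ↦ TangentSpace (𝓡 n) x)] {p : ℕ} (η : DForm n X (p + 1)) : Prop :=
  ∃ (β : DForm n X p) (x₀ : X) (c : ℝ), β.IsSmooth ∧ 0 < c ∧ η = β.extd ∧
    ∀ x, η.pointNorm x ≤ c ∧ β.pointNorm x ≤ c * (1 + dist x₀ x)

/-- The form `e^{ijk} = e^i ∧ e^j ∧ e^k` on `ℝ⁷`. -/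
def triple (i j k : Fin 7) (v : Fin 3 → EucSp 7) : ℝ :=
  Matrix.det (Matrix.of fun a b : Fin 3 ↦ v a (![i, j, k] b))

/-- The standard `G₂`-form on `ℝ⁷` (indices run from `0` to `6`):
`e¹²³ + e¹⁴⁵ + e¹⁶⁷ + e²⁴⁶ - e²⁵⁷ - e³⁴⁷ - e³⁵⁶`. -/
def standardG2 (v : Fin 3 → EucSp 7) : ℝ :=
  triple 0 1 2 v + triple 0 3 4 v + triple 0 5 6 v + triple 1 3 5 v
    - triple 1 4 6 v - triple 2 3 6 v - triple 2 4 5 v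

/-- `φ` is a `G₂`-structure on `X` and the Riemannian metric of `X` is the metric `g_φ` that it
induces: `φ` is a smooth 3-form, and for every `x` there is a linear isomorphism from `T_x X` to
`ℝ⁷` that takes `φ` to the standard `G₂`-form and the metric of `X` to the Euclidean one. -/
def IsG2Structure {X : Type*} [TopologicalSpace X] [ChartedSpace (EucSp 7) X]
    [RiemannianBundle (fun x : X ↦ TangentSpace (𝓡 7) x)] (φ : DForm 7 X 3) : Prop :=
  φ.IsSmooth ∧ ∀ x : X, ∃ L : TangentSpace (𝓡 7) x ≃ₗᵢ[ℝ] EucSp 7,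
    ∀ v : Fin 3 → TangentSpace (𝓡 7) x, φ x v = standardG2 (fun a ↦ L (v a))

/-- `(X, φ)`, with the metric of `X`, is a `G₂`-manifold: `φ` is a torsion-free `G₂`-structure,
that is `∇φ = 0` for the Levi-Civita connection of the metric `g_φ`. -/
def IsG2Manifold {X : Type*} [TopologicalSpace X] [ChartedSpace (EucSp 7) X]
    [RiemannianBundle (fun x : X ↦ TangentSpace (𝓡 7) x)] (φ : DForm 7 X 3) : Prop :=
  IsG2Structure φ ∧ φ.IsParallel

end Riemannian

end RiemForm

end

open scoped Bundle

/-!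
Square-integrable harmonic forms on a complete `G₂`-manifold `(X, φ)` whose form `φ` is `d`(linear)
vanish outside of the degrees `3` and `4`. The argument is Gromov's: a form with a primitive of
linear growth annihilates the square-integrable harmonic forms. For a `G₂`-form there are two such
operators, the wedge product `φ ∧ ·` and its pointwise adjoint, the contraction `C_φ`, and between
them they are injective in all degrees other than `3` and `4`.

*Harmonic forms are closed and coclosed* (`extd_eq_zero_and_isCoclosed`). A complete Riemannian
manifold is proper (`properSpace_of_complete`), so the distance to a point gives Lipschitz cutoff
functions with compact support. For a harmonic form `α` the function `|dα|² + |d*α|²` is minus the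
codifferential of the `1`-form `⟨α, ι dα⟩ - ⟨d*α, ι α⟩`; testing this with cutoff functions, by means
of the divergence theorem `abs_integral_mul_codiff_le`, shows that the function vanishes.

*Products with `φ` are harmonic.* If `φ` is parallel and `α` is closed and coclosed, then `φ ∧ α` is
closed and `d d* (φ ∧ α) = 0` (`extd_codiff_wedgeForm`), and `C_φ α` is coclosed and
`d* d (C_φ α) = 0` (`codiff_extd_contrForm`). These are computed at the centre of normal
coordinates. The Ricci identity turns the second derivatives of `α` into curvature terms
(`CurvatureOf.sum_mul_eq_zero_of`), and these vanish by the Bianchi identity and the fact that the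
curvature annihilates the parallel form `φ` (`CurvatureOf.sum_ext_eq_zero`,
`CurvatureOf.sum_ins_ext_eq_zero`). Since `φ` is bounded, the products of `φ` with a square-integrable
harmonic form are square-integrable and harmonic, hence closed and coclosed as well.

*They vanish* (`wedgeForm_eq_zero`, `contrForm_eq_zero`). Let `φ = dβ` with `β` of linear growth. For
a closed form `a` and a coclosed form `b` the `1`-form `⟨a, ι C_β b⟩` has codifferential
`- ⟨a, C_φ b⟩` (`codiff_pairForm`, `codiff_contrForm_two`), and its norm is at most `|a| |b|` times a
function of linear growth. If `|a| |b|` is dominated by an integrable function and `⟨a, C_φ b⟩ ≥ 0`,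
then testing with a cutoff function whose slope is `1 / R` on the shell `R ≤ ρ ≤ 2 R` shows that
`⟨a, C_φ b⟩ = 0` (`pointInner_contrForm_eq_zero`). For `(a, b) = (α, φ ∧ α)` and `(C_φ α, α)` this
function is `|φ ∧ α|²` and `|C_φ α|²`, respectively.

*Injectivity.* On `ℝ⁷` with the standard `G₂`-form the contraction `C_φ` is injective on `5`-forms
(`eq_zero_of_contr_standardG2`): the seven terms of `φ` are the lines of the Fano plane, and the
equations decouple into seven systems of three equations, one for each point. Injectivity of `C_φ` in
degrees at least `5` follows with interior multiplications, injectivity of `φ ∧ ·` on `2`-forms by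
duality, and that on `0`- and `1`-forms with exterior multiplications.

The manifold is studied in parametrizations `ψ` from open sets of `ℝⁿ` (`IsParam`): forms and the
metric are pulled back, and the exterior derivative, the covariant derivative and the codifferential
become operators `extDeriv`, `cov` and `codiffOn` on vector-valued functions.
-/

noncomputable section

set_option maxSynthPendingDepth 3
set_option synthInstance.maxHeartbeats 200000

namespace FormAlg

open ContinuousAlternatingMap (alternatizeUncurryFin alternatizeUncurryFinCLM curryLeftLI
  alternatizeUncurryFin_apply alternatizeUncurryFin_alternatizeUncurryFinCLM_comp_of_symmetric)

/-! ### Exterior algebra of a normed space: interior and exterior products, wedge, contraction -/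

section

variable {V : Type*} [NormedAddCommGroup V] [NormedSpace ℝ V]

/-- Real alternating `p`-forms on `V`. -/
abbrev Alt (V : Type*) [NormedAddCommGroup V] [NormedSpace ℝ V] (p : ℕ) := V [⋀^Fin p]→L[ℝ] ℝ

/-- Interior multiplication `ι_v a` (insertion of `v` in the first slot), as a continuous bilinear
map. -/
def ins (p : ℕ) : V →L[ℝ] Alt V (p + 1) →L[ℝ] Alt V p :=
  (curryLeftLI (𝕜 := ℝ) (E := V) (F := ℝ) (n := p)).toContinuousLinearMap.flip

@[simp] lemma ins_apply {p : ℕ} (v : V) (a : Alt V (p + 1)) (w : Fin p → V) :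
    ins p v a w = a (Matrix.vecCons v w) := rfl

lemma ins_ins_swap {p : ℕ} (u v : V) (a : Alt V (p + 2)) :
    ins p u (ins (p + 1) v a) = - ins p v (ins (p + 1) u a) := by
  have h : ∀ w : V, ins p w (ins (p + 1) w a) = 0 := fun w ↦ ContinuousAlternatingMap.curryLeft_same a w
  have := h (u + v)
  simp only [map_add, add_apply, h, zero_add, add_zero] at this
  exact eq_neg_of_add_eq_zero_right this

/-- Exterior multiplication `θ ∧ a` by a covector, as a continuous bilinear map. It is normalized so
that `ι_v (θ ∧ a) = θ(v) a - θ ∧ ι_v a`. -/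
def ext (p : ℕ) : (V →L[ℝ] ℝ) →L[ℝ] Alt V p →L[ℝ] Alt V (p + 1) :=
  (ContinuousLinearMap.compL ℝ (Alt V p) (V →L[ℝ] Alt V p) (Alt V (p + 1))
    (alternatizeUncurryFinCLM ℝ V ℝ)) ∘L
    (ContinuousLinearMap.smulRightL ℝ V (Alt V p))

lemma ext_eq {p : ℕ} (θ : V →L[ℝ] ℝ) (a : Alt V p) :
    ext p θ a = alternatizeUncurryFin (θ.smulRight a) := rfl

lemma ext_apply {p : ℕ} (θ : V →L[ℝ] ℝ) (a : Alt V p) (v : Fin (p + 1) → V) :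
    ext p θ a v = ∑ i : Fin (p + 1), (-1) ^ (i : ℕ) * (θ (v i) * a (i.removeNth v)) := by
  simp [ext_eq, alternatizeUncurryFin_apply]

lemma ext_ext_self {p : ℕ} (θ : V →L[ℝ] ℝ) (a : Alt V p) :
    ext (p + 1) θ (ext p θ a) = 0 := by
  have h := alternatizeUncurryFin_alternatizeUncurryFinCLM_comp_of_symmetric
    (f := θ.smulRight (θ.smulRight a)) (fun x y ↦ by
      simp [smul_smul, mul_comm])
  rw [← h, ext_eq]
  congr 1
  ext1 u
  simp [ext_eq]

lemma ext_ext_swap {p : ℕ} (θ η : V →L[ℝ] ℝ) (a : Alt V p) :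
    ext (p + 1) θ (ext p η a) = - ext (p + 1) η (ext p θ a) := by
  have := ext_ext_self (θ + η) a
  simp only [map_add, add_apply, ext_ext_self, zero_add, add_zero] at this
  exact eq_neg_of_add_eq_zero_right this

/-- The alternatization `∑ᵢ eⁱ ∧ f(eᵢ)` anticommutes with interior multiplication, up to the term
`f(v)`. -/
lemma ins_alternatize {p : ℕ} (f : V →L[ℝ] Alt V (p + 1)) (v : V) :
    ins (p + 1) v (alternatizeUncurryFin f)
      = f v - alternatizeUncurryFin ((ins p v) ∘L f) := by
  ext w
  rw [ContinuousAlternatingMap.sub_apply, ins_apply, alternatizeUncurryFin_apply,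
    Fin.sum_univ_succ, alternatizeUncurryFin_apply]
  simp only [Fin.val_zero, pow_zero, Matrix.cons_val_zero, one_smul, Fin.val_succ,
    Matrix.cons_val_succ, sub_eq_add_neg]
  congr 1
  rw [← Finset.sum_neg_distrib]
  refine Finset.sum_congr rfl fun i _ ↦ ?_
  rw [pow_succ]
  have : Fin.removeNth i.succ (Matrix.vecCons v w) = Matrix.vecCons v (Fin.removeNth i w) := by
    funext j
    refine Fin.cases ?_ (fun k ↦ ?_) j
    · simp [Fin.removeNth]
    · simp [Fin.removeNth]
  rw [this]
  simp

lemma ins_alternatize_zero (f : V →L[ℝ] Alt V 0) (v : V) :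
    ins 0 v (alternatizeUncurryFin f) = f v := by
  ext w
  rw [ins_apply, alternatizeUncurryFin_apply, Fin.sum_univ_one]
  simp only [Fin.val_zero, pow_zero, one_smul, Matrix.cons_val_zero]
  congr 1

lemma ins_ext {p : ℕ} (θ : V →L[ℝ] ℝ) (v : V) (a : Alt V (p + 1)) :
    ins (p + 1) v (ext (p + 1) θ a) = θ v • a - ext p θ (ins p v a) := by
  rw [ext_eq, ins_alternatize]
  congr 2

lemma ins_ext_zero (θ : V →L[ℝ] ℝ) (v : V) (a : Alt V 0) :
    ins 0 v (ext 0 θ a) = θ v • a := by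
  rw [ext_eq, ins_alternatize_zero]; rfl

/-- The wedge product `b ∧ a` of a `q`-form and a `p`-form. The recursion is
`b ∧ a = (1 / q) ∑ᵢ eⁱ ∧ (ι(eᵢ) b ∧ a)`. -/
def wedge (p : ℕ) : (q : ℕ) → Alt V q →L[ℝ] Alt V p →L[ℝ] Alt V (p + q)
  | 0 => (ContinuousAlternatingMap.apply ℝ V ℝ ![]).smulRight (ContinuousLinearMap.id ℝ (Alt V p))
  | q + 1 => ((q + 1 : ℝ)⁻¹) •
      ((ContinuousLinearMap.compL ℝ (Alt V p) (V →L[ℝ] Alt V (p + q)) (Alt V (p + q + 1))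
          (alternatizeUncurryFinCLM ℝ V ℝ))
        ∘L (ContinuousLinearMap.flipₗᵢ ℝ V (Alt V p) (Alt V (p + q))).toContinuousLinearEquiv.toContinuousLinearMap
        ∘L (ContinuousLinearMap.compL ℝ V (Alt V q) (Alt V p →L[ℝ] Alt V (p + q)) (wedge p q))
        ∘L (curryLeftLI (𝕜 := ℝ) (E := V) (F := ℝ) (n := q)).toContinuousLinearMap)

lemma wedge_zero {p : ℕ} (b : Alt V 0) (a : Alt V p) : wedge p 0 b a = b ![] • a := by
  simp [wedge]

lemma wedge_succ {p q : ℕ} (b : Alt V (q + 1)) (a : Alt V p) :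
    wedge p (q + 1) b a = (q + 1 : ℝ)⁻¹ •
      alternatizeUncurryFin (((wedge p q).flip a) ∘L b.curryLeft) := by
  rw [wedge]
  simp
  congr 2

variable {ι : Type*} [Fintype ι]

/-- The contraction of a `(p + q)`-form `a` with a `q`-form `b`, by means of the tensor `∑ᵢ eᵢ ⊗
fᵢ`: it is `(1 / q!) ∑_I b(e_I) a(f_I, ·)`. For an orthonormal family `e = f` it is adjoint to the
wedge product with `b`, see `inn_wedge`. -/
def contr (e f : ι → V) (p : ℕ) : (q : ℕ) → Alt V q →L[ℝ] Alt V (p + q) →L[ℝ] Alt V p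
  | 0 => (ContinuousAlternatingMap.apply ℝ V ℝ ![]).smulRight (ContinuousLinearMap.id ℝ (Alt V p))
  | q + 1 => ((q + 1 : ℝ)⁻¹) •
      ∑ i, (contr e f p q).bilinearComp (ins q (e i)) (ins (p + q) (f i))

lemma contr_zero {p : ℕ} (e f : ι → V) (b : Alt V 0) (a : Alt V p) :
    contr e f p 0 b a = b ![] • a := by
  simp [contr]

lemma contr_succ {p q : ℕ} (e f : ι → V) (b : Alt V (q + 1)) (a : Alt V (p + q + 1)) :
    contr e f p (q + 1) b a = (q + 1 : ℝ)⁻¹ •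
      ∑ i, contr e f p q (ins q (e i) b) (ins (p + q) (f i) a) := by
  rw [contr]
  simp [sum_apply]

/-- The inner product of two `p`-forms for the tensor `∑ᵢ eᵢ ⊗ fᵢ`:
it is `(1 / p!) ∑_I a(e_I) b(f_I)`. -/
def inn (e f : ι → V) : (p : ℕ) → Alt V p →L[ℝ] Alt V p →L[ℝ] ℝ
  | 0 => (ContinuousLinearMap.mul ℝ ℝ).bilinearComp (ContinuousAlternatingMap.apply ℝ V ℝ ![])
      (ContinuousAlternatingMap.apply ℝ V ℝ ![])
  | p + 1 => ((p + 1 : ℝ)⁻¹) • ∑ i, (inn e f p).bilinearComp (ins p (e i)) (ins p (f i))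

lemma inn_zero (e f : ι → V) (a b : Alt V 0) : inn e f 0 a b = a ![] * b ![] := by
  simp [inn]

lemma inn_succ {p : ℕ} (e f : ι → V) (a b : Alt V (p + 1)) :
    inn e f (p + 1) a b = (p + 1 : ℝ)⁻¹ * ∑ i, inn e f p (ins p (e i) a) (ins p (f i) b) := by
  rw [inn]
  simp [sum_apply]

lemma inn_eq_sum {p : ℕ} (e f : ι → V) (a b : Alt V p) :
    inn e f p a b
      = (∑ s : Fin p → ι, a (fun j ↦ e (s j)) * b (fun j ↦ f (s j))) / (p.factorial : ℝ) := by
  induction p with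
  | zero =>
    rw [inn_zero]
    simp
    congr <;> exact Subsingleton.elim _ _
  | succ p ih =>
    rw [inn_succ, ← (Fin.consEquiv (fun _ : Fin (p + 1) ↦ ι)).sum_comp, Fintype.sum_prod_type]
    simp only [ih, ins_apply]
    rw [← Finset.sum_div, Nat.factorial_succ]
    push_cast
    rw [inv_mul_eq_div, div_div]
    rw [mul_comm]
    congr 1
    refine Finset.sum_congr rfl fun i _ ↦ Finset.sum_congr rfl fun s _ ↦ ?_
    congr 2 <;>
    · funext j
      refine Fin.cases ?_ (fun k ↦ ?_) j <;> simp [Fin.consEquiv]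

end

/-! ### Naturality, adjointness and norms of alternating forms -/

section

variable {V V' : Type*} [NormedAddCommGroup V] [NormedSpace ℝ V]
  [NormedAddCommGroup V'] [NormedSpace ℝ V']

/-- The pullback of a form by a linear map. -/
abbrev pb {p : ℕ} (a : Alt V p) (M : V' →L[ℝ] V) : Alt V' p := a.compContinuousLinearMap M

lemma pb_apply {p : ℕ} (a : Alt V p) (M : V' →L[ℝ] V) (v : Fin p → V') :
    pb a M v = a (fun i ↦ M (v i)) := rfl

lemma pb_add {p : ℕ} (a b : Alt V p) (M : V' →L[ℝ] V) : pb (a + b) M = pb a M + pb b M := rfl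

lemma pb_smul {p : ℕ} (c : ℝ) (a : Alt V p) (M : V' →L[ℝ] V) : pb (c • a) M = c • pb a M := rfl

lemma pb_sum {κ : Type*} {p : ℕ} (s : Finset κ) (a : κ → Alt V p) (M : V' →L[ℝ] V) :
    pb (∑ i ∈ s, a i) M = ∑ i ∈ s, pb (a i) M := by
  ext v
  simp [pb_apply, ContinuousAlternatingMap.sum_apply]

lemma ins_pb {p : ℕ} (a : Alt V (p + 1)) (M : V' →L[ℝ] V) (v : V') :
    ins p v (pb a M) = pb (ins p (M v) a) M :=
  ContinuousAlternatingMap.curryLeft_compContinuousLinearMap a M v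

lemma alternatize_pb {p : ℕ} (f : V →L[ℝ] Alt V p) (f' : V' →L[ℝ] Alt V' p) (M : V' →L[ℝ] V)
    (h : ∀ u, f' u = pb (f (M u)) M) :
    pb (alternatizeUncurryFin f) M = alternatizeUncurryFin f' := by
  ext w
  rw [pb_apply, alternatizeUncurryFin_apply, alternatizeUncurryFin_apply]
  refine Finset.sum_congr rfl fun i _ ↦ ?_
  rw [h]
  rfl

lemma wedge_pb {p q : ℕ} (b : Alt V q) (a : Alt V p) (M : V' →L[ℝ] V) :
    pb (wedge p q b a) M = wedge p q (pb b M) (pb a M) := by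
  induction q with
  | zero =>
    rw [wedge_zero, wedge_zero, pb_smul, pb_apply, Subsingleton.elim (fun i ↦ M (![] i)) ![]]
  | succ q ih =>
    rw [wedge_succ, wedge_succ, pb_smul]
    congr 1
    refine alternatize_pb _ _ M fun u ↦ ?_
    change wedge p q (ins q u (pb b M)) (pb a M) = pb (wedge p q (ins q (M u) b) a) M
    rw [ih, ins_pb]

variable {ι : Type*} [Fintype ι] {κ : Type*} [Fintype κ]

lemma contr_pb {p q : ℕ} (e f : ι → V') (b : Alt V q) (a : Alt V (p + q)) (M : V' →L[ℝ] V) :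
    contr e f p q (pb b M) (pb a M)
      = pb (contr (fun i ↦ M (e i)) (fun i ↦ M (f i)) p q b a) M := by
  induction q with
  | zero =>
    rw [contr_zero, contr_zero, pb_smul, pb_apply, Subsingleton.elim (fun i ↦ M (![] i)) ![]]
  | succ q ih =>
    rw [contr_succ, contr_succ, pb_smul, pb_sum]
    congr 1
    refine Finset.sum_congr rfl fun i _ ↦ ?_
    rw [← ih, ins_pb]
    exact congrArg _ (ins_pb (p := p + q) a M (f i))

lemma inn_pb {p : ℕ} (e f : ι → V') (a b : Alt V p) (M : V' →L[ℝ] V) :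
    inn e f p (pb a M) (pb b M) = inn (fun i ↦ M (e i)) (fun i ↦ M (f i)) p a b := by
  rw [inn_eq_sum, inn_eq_sum]
  rfl

/-- The tensors `∑ᵢ eᵢ ⊗ fᵢ` and `∑ⱼ e'ⱼ ⊗ f'ⱼ` are equal, tested on all bilinear forms.
Contractions and inner products only depend on this tensor. It is used to compare an orthonormal
basis `(e, e)` with a coordinate basis and its metric dual. -/
def SameTensor (e f : ι → V) (e' f' : κ → V) : Prop :=
  ∀ B : V →ₗ[ℝ] V →ₗ[ℝ] ℝ, ∑ i, B (e i) (f i) = ∑ j, B (e' j) (f' j)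

lemma SameTensor.alt {p : ℕ} {e f : ι → V} {e' f' : κ → V} (h : SameTensor e f e' f')
    (B : V →L[ℝ] V →L[ℝ] Alt V p) : ∑ i, B (e i) (f i) = ∑ j, B (e' j) (f' j) := by
  ext w
  have := h (LinearMap.mk₂ ℝ (fun u v ↦ B u v w) (by simp) (by simp) (by simp) (by simp))
  simpa [ContinuousAlternatingMap.sum_apply] using this

lemma SameTensor.contr_eq {p q : ℕ} {e f : ι → V} {e' f' : κ → V} (h : SameTensor e f e' f')
    (b : Alt V q) (a : Alt V (p + q)) : contr e f p q b a = contr e' f' p q b a := by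
  induction q with
  | zero => rw [contr_zero, contr_zero]
  | succ q ih =>
    rw [contr_succ, contr_succ]
    congr 1
    simp only [ih]
    exact h.alt ((contr e' f' p q).bilinearComp ((ins q).flip b) ((ins (p + q)).flip a))

lemma SameTensor.inn_eq {p : ℕ} {e f : ι → V} {e' f' : κ → V} (h : SameTensor e f e' f')
    (a b : Alt V p) : inn e f p a b = inn e' f' p a b := by
  induction p with
  | zero => rw [inn_zero, inn_zero]
  | succ p ih =>
    rw [inn_succ, inn_succ]
    congr 1
    simp only [ih]
    exact h (LinearMap.mk₂ ℝ (fun u v ↦ inn e' f' p (ins p u a) (ins p v b))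
      (by simp) (by simp) (by simp) (by simp))

/-- The alternatization of `N` is adjoint to `c ↦ (v ↦ ι_v c)`: the combinatorial core of the
adjointness of `b ∧ ·` and the contraction with `b`. -/
lemma inn_alternatize {p : ℕ} (e f : ι → V) (N : V →L[ℝ] Alt V p) (c : Alt V (p + 1)) :
    inn e f (p + 1) (alternatizeUncurryFin N) c = ∑ i, inn e f p (N (e i)) (ins p (f i) c) := by
  induction p with
  | zero => rw [inn_succ]; simp [ins_alternatize_zero]
  | succ p ih =>
    rw [inn_succ]
    simp only [ins_alternatize, map_sub, sub_apply, ih]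
    rw [Finset.sum_sub_distrib]
    have h1 : ∑ j, ∑ i, inn e f p ((ins p (e j) ∘L N) (e i))
          (ins p (f i) (ins (p + 1) (f j) c))
        = - ((p + 1 : ℝ) * ∑ i, inn e f (p + 1) (N (e i)) (ins (p + 1) (f i) c)) := by
      rw [Finset.sum_comm, Finset.mul_sum, ← Finset.sum_neg_distrib]
      refine Finset.sum_congr rfl fun i _ ↦ ?_
      rw [inn_succ, ← mul_assoc, mul_inv_cancel₀ (by positivity), one_mul,
        ← Finset.sum_neg_distrib]
      refine Finset.sum_congr rfl fun j _ ↦ ?_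
      rw [ins_ins_swap, map_neg]
      rfl
    rw [h1]
    push_cast
    field_simp
    ring

/-- The contraction with `b` is the adjoint of the exterior multiplication by `b`. -/
lemma inn_wedge {p q : ℕ} (e f : ι → V) (b : Alt V q) (a : Alt V p) (c : Alt V (p + q)) :
    inn e f (p + q) (wedge p q b a) c = inn e f p a (contr e f p q b c) := by
  induction q with
  | zero => rw [wedge_zero, contr_zero]; simp
  | succ q ih =>
    rw [wedge_succ, contr_succ]
    simp only [map_smul, smul_apply]
    change _ • inn e f (p + q + 1) _ c = _
    rw [inn_alternatize, map_sum]
    congr 1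
    exact Finset.sum_congr rfl fun i _ ↦ ih _ _

lemma inn_comm {p : ℕ} (e : ι → V) (a b : Alt V p) : inn e e p a b = inn e e p b a := by
  rw [inn_eq_sum, inn_eq_sum]
  simp only [mul_comm]

/-- The norm of forms for which the family `e` is orthonormal. It is only a seminorm if `e` does not
span. -/
def nrm (e : ι → V) {p : ℕ} (a : Alt V p) : ℝ := √(inn e e p a a)

/-- The components of a form with respect to the family `e`, with the Euclidean norm: the
Cauchy–Schwarz and triangle inequalities for `nrm` are inherited from this space. -/
def comps (e : ι → V) (p : ℕ) : Alt V p →ₗ[ℝ] EuclideanSpace ℝ (Fin p → ι) where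
  toFun a := WithLp.toLp 2 fun s ↦ a fun j ↦ e (s j)
  map_add' _ _ := rfl
  map_smul' _ _ := rfl

@[simp] lemma comps_apply (e : ι → V) {p : ℕ} (a : Alt V p) (s : Fin p → ι) :
    comps e p a s = a fun j ↦ e (s j) := rfl

lemma inn_eq_inner {p : ℕ} (e : ι → V) (a b : Alt V p) :
    inn e e p a b = inner ℝ (comps e p a) (comps e p b) / (p.factorial : ℝ) := by
  rw [inn_eq_sum, real_inner_comm]
  simp [PiLp.inner_apply]

lemma nrm_eq {p : ℕ} (e : ι → V) (a : Alt V p) :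
    nrm e a = ‖comps e p a‖ / √(p.factorial : ℝ) := by
  rw [nrm, inn_eq_inner, Real.sqrt_div' _ (by positivity), real_inner_self_eq_norm_sq,
    Real.sqrt_sq (norm_nonneg _)]

lemma nrm_nonneg {p : ℕ} (e : ι → V) (a : Alt V p) : 0 ≤ nrm e a := Real.sqrt_nonneg _

lemma inn_self_nonneg {p : ℕ} (e : ι → V) (a : Alt V p) : 0 ≤ inn e e p a a := by
  rw [inn_eq_inner, real_inner_self_eq_norm_sq]; positivity

lemma nrm_sq {p : ℕ} (e : ι → V) (a : Alt V p) : nrm e a ^ 2 = inn e e p a a :=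
  Real.sq_sqrt (inn_self_nonneg e a)

lemma abs_inn_le {p : ℕ} (e : ι → V) (a b : Alt V p) :
    |inn e e p a b| ≤ nrm e a * nrm e b := by
  rw [inn_eq_inner, nrm_eq, nrm_eq, div_mul_div_comm, Real.mul_self_sqrt (by positivity), abs_div,
    abs_of_nonneg (by positivity : (0 : ℝ) ≤ (p.factorial : ℝ))]
  gcongr
  exact abs_real_inner_le_norm _ _

lemma nrm_add_le {p : ℕ} (e : ι → V) (a b : Alt V p) : nrm e (a + b) ≤ nrm e a + nrm e b := by
  rw [nrm_eq, nrm_eq, nrm_eq, ← add_div, map_add]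
  gcongr
  exact norm_add_le _ _

lemma nrm_smul {p : ℕ} (e : ι → V) (c : ℝ) (a : Alt V p) : nrm e (c • a) = |c| * nrm e a := by
  rw [nrm_eq, nrm_eq, map_smul, norm_smul, mul_div_assoc, Real.norm_eq_abs]

lemma nrm_sum_le {σ : Type*} {p : ℕ} (e : ι → V) (s : Finset σ) (a : σ → Alt V p) :
    nrm e (∑ i ∈ s, a i) ≤ ∑ i ∈ s, nrm e (a i) := by
  simp only [nrm_eq, map_sum]
  rw [← Finset.sum_div]
  gcongr
  exact norm_sum_le _ _

lemma eq_zero_of_inn_self {p : ℕ} {e : ι → V} (he : Submodule.span ℝ (Set.range e) = ⊤)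
    {a : Alt V p} (h : inn e e p a a = 0) : a = 0 := by
  have hc : comps e p a = 0 := by
    have : nrm e a = 0 := by rw [nrm, h, Real.sqrt_zero]
    rw [nrm_eq, div_eq_zero_iff] at this
    rcases this with h | h
    · exact norm_eq_zero.1 h
    · exact absurd h (by positivity)
  have hc' : ∀ s : Fin p → ι, a (fun j ↦ e (s j)) = 0 := fun s ↦ by
    have := congrArg (fun z ↦ z s) hc
    simpa using this
  ext v
  have key := fun j ↦ (Submodule.mem_span_range_iff_exists_fun ℝ).1
    (by rw [he]; exact Submodule.mem_top : v j ∈ Submodule.span ℝ (Set.range e))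
  choose c hcv using key
  have : v = fun j ↦ ∑ i, c j i • e i := funext fun j ↦ (hcv j).symm
  rw [this]
  change a.toMultilinearMap _ = 0
  rw [MultilinearMap.map_sum]
  refine Finset.sum_eq_zero fun s _ ↦ ?_
  rw [MultilinearMap.map_smul_univ]
  exact smul_eq_zero_of_right _ (hc' s)

lemma sum_nrm_ins_sq {p : ℕ} (e : ι → V) (a : Alt V (p + 1)) :
    ∑ i, nrm e (ins p (e i) a) ^ 2 = (p + 1) * nrm e a ^ 2 := by
  simp only [nrm_sq]
  rw [inn_succ, ← mul_assoc, mul_inv_cancel₀ (by positivity), one_mul]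

lemma nrm_ins_le {p : ℕ} (e : ι → V) (a : Alt V (p + 1)) (i : ι) :
    nrm e (ins p (e i) a) ≤ √(p + 1) * nrm e a := by
  have h : nrm e (ins p (e i) a) ^ 2 ≤ (p + 1) * nrm e a ^ 2 := by
    rw [← sum_nrm_ins_sq]
    exact Finset.single_le_sum (f := fun i ↦ nrm e (ins p (e i) a) ^ 2)
      (fun i _ ↦ sq_nonneg _) (Finset.mem_univ i)
  refine le_of_sq_le_sq ?_ (mul_nonneg (Real.sqrt_nonneg _) (nrm_nonneg e a))
  rw [mul_pow, Real.sq_sqrt (by positivity)]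
  exact h

variable (ι) in
/-- The bound `|C_b a| ≤ K |b| |a|`. The constant depends on the number of vectors in the family but
not on the family, so that on a manifold it is the same at all points. -/
lemma exists_nrm_contr_le (p q : ℕ) : ∃ K : ℝ, 0 ≤ K ∧ ∀ (e : ι → V) (b : Alt V q)
    (a : Alt V (p + q)), nrm e (contr e e p q b a) ≤ K * nrm e b * nrm e a := by
  induction q with
  | zero =>
    refine ⟨1, zero_le_one, fun e b a ↦ ?_⟩
    rw [contr_zero, nrm_smul, one_mul]
    have : nrm e b = |b ![]| := by
      rw [nrm, inn_zero, Real.sqrt_mul_self_eq_abs]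
    rw [this]
  | succ q ih =>
    obtain ⟨K, hK, h⟩ := ih
    refine ⟨(q + 1 : ℝ)⁻¹ * ∑ _i : ι, K * √(q + 1) * √((p + q : ℕ) + 1),
      by positivity, fun e b a ↦ ?_⟩
    rw [contr_succ, nrm_smul, abs_of_nonneg (by positivity), mul_assoc, mul_assoc]
    gcongr
    refine (nrm_sum_le _ _ _).trans ?_
    rw [Finset.sum_mul]
    refine Finset.sum_le_sum fun i _ ↦ (h e _ _).trans ?_
    have h1 := nrm_ins_le e b i
    have h2 := nrm_ins_le (p := p + q) e a i
    calc K * nrm e (ins q (e i) b) * nrm e (ins (p + q) (e i) a)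
        ≤ K * (√(q + 1) * nrm e b) * (√((p + q : ℕ) + 1) * nrm e a) := by
          gcongr
          · exact nrm_nonneg _ _
          · exact mul_nonneg hK (mul_nonneg (Real.sqrt_nonneg _) (nrm_nonneg _ _))
      _ = _ := by ring

variable (ι) in
/-- The bound `|b ∧ a| ≤ K |b| |a|`, by duality from the one for contractions. -/
lemma exists_nrm_wedge_le (p q : ℕ) : ∃ K : ℝ, 0 ≤ K ∧ ∀ (e : ι → V) (b : Alt V q)
    (a : Alt V p), nrm e (wedge p q b a) ≤ K * nrm e b * nrm e a := by
  obtain ⟨K, hK, h⟩ := exists_nrm_contr_le (V := V) ι p q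
  refine ⟨K, hK, fun e b a ↦ ?_⟩
  rcases (nrm_nonneg e (wedge p q b a)).eq_or_lt with h0 | h0
  · rw [← h0]
    exact mul_nonneg (mul_nonneg hK (nrm_nonneg _ _)) (nrm_nonneg _ _)
  refine le_of_mul_le_mul_right ?_ h0
  rw [← sq, nrm_sq, inn_wedge]
  refine (le_abs_self _).trans ((abs_inn_le _ _ _).trans ?_)
  calc nrm e a * nrm e (contr e e p q b (wedge p q b a))
      ≤ nrm e a * (K * nrm e b * nrm e (wedge p q b a)) := by
        gcongr
        · exact nrm_nonneg _ _
        · exact h _ _ _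
    _ = _ := by ring

end

/-! ### Index algebra of the curvature terms -/

section

section Words

variable {n : Type*} [Fintype n] {R : Type*} [AddCommGroup R] [Module ℝ R]

/-- A sum with alternating words of length four vanishes if the coefficients, antisymmetrized in the
last two indices, come from a coefficient `P` with vanishing cyclic sums. The hypothesis `hX`
reduces the sum to a multiple of `∑ P w`, and three times the latter is the sum of the cyclic
permutations. -/
lemma sum_word_four_eq_zero {w : n → n → n → n → R} (h12 : ∀ a b c d, w b a c d = - w a b c d)
    (h23 : ∀ a b c d, w a c b d = - w a b c d) (h34 : ∀ a b c d, w a b d c = - w a b c d)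
    {X P : n → n → n → n → ℝ} (s : ℝ)
    (hX : ∀ b c j k, X b c j k - X b c k j = s * (P k j b c - P k j c b))
    (hP : ∀ k j b c, P k j b c + P j b k c + P b k j c = 0) :
    ∑ b, ∑ c, ∑ j, ∑ k, X b c j k • w b c j k = 0 := by
  have e34 : ∀ f : n → n → n → n → R, ∑ b, ∑ c, ∑ j, ∑ k, f b c j k
      = ∑ b, ∑ c, ∑ j, ∑ k, f b c k j := fun f ↦
    Finset.sum_congr rfl fun b _ ↦ Finset.sum_congr rfl fun c _ ↦ Finset.sum_comm
  have e12 : ∀ f : n → n → n → n → R, ∑ b, ∑ c, ∑ j, ∑ k, f b c j k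
      = ∑ b, ∑ c, ∑ j, ∑ k, f c b j k := fun f ↦ Finset.sum_comm
  have e23 : ∀ f : n → n → n → n → R, ∑ b, ∑ c, ∑ j, ∑ k, f b c j k
      = ∑ b, ∑ c, ∑ j, ∑ k, f b j c k := fun f ↦
    Finset.sum_congr rfl fun b _ ↦ Finset.sum_comm
  set Z := ∑ b, ∑ c, ∑ j, ∑ k, X b c j k • w b c j k with hZ
  set Y := ∑ b, ∑ c, ∑ j, ∑ k, P k j b c • w b c j k with hY
  -- antisymmetrize in the last two indices
  have hZ2 : Z = - ∑ b, ∑ c, ∑ j, ∑ k, X b c k j • w b c j k := by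
    rw [hZ, e34]
    simp only [← Finset.sum_neg_distrib]
    refine Finset.sum_congr rfl fun b _ ↦ Finset.sum_congr rfl fun c _ ↦
      Finset.sum_congr rfl fun j _ ↦ Finset.sum_congr rfl fun k _ ↦ ?_
    rw [h34, smul_neg]
  have hY2 : ∑ b, ∑ c, ∑ j, ∑ k, P k j c b • w b c j k = - Y := by
    rw [e12, hY]
    simp only [← Finset.sum_neg_distrib]
    refine Finset.sum_congr rfl fun b _ ↦ Finset.sum_congr rfl fun c _ ↦
      Finset.sum_congr rfl fun j _ ↦ Finset.sum_congr rfl fun k _ ↦ ?_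
    rw [h12, smul_neg]
  have hZY : (2 : ℝ) • Z = (2 * s) • Y := by
    have : (2 : ℝ) • Z = ∑ b, ∑ c, ∑ j, ∑ k, (s * (P k j b c - P k j c b)) • w b c j k := by
      rw [two_smul]
      nth_rewrite 2 [hZ2]
      rw [hZ, ← sub_eq_add_neg]
      simp only [← Finset.sum_sub_distrib, ← sub_smul, hX]
    rw [this]
    simp only [mul_smul, sub_smul, Finset.sum_sub_distrib, smul_sub, ← Finset.smul_sum, hY2, ← hY]
    module
  have h13 : ∀ a b c d, w c b a d = - w a b c d := fun a b c d ↦ by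
    rw [h23, h12, h23, neg_neg]
  -- cyclic permutations of three letters are even
  have hY3 : ∑ b, ∑ c, ∑ j, ∑ k, P j b k c • w b c j k = Y := by
    refine (e34 _).trans ((e12 _).trans ((e23 _).trans ((e12 _).trans ?_)))
    refine Finset.sum_congr rfl fun b _ ↦ Finset.sum_congr rfl fun c _ ↦
      Finset.sum_congr rfl fun j _ ↦ Finset.sum_congr rfl fun k _ ↦ ?_
    rw [h34, h13, neg_neg]
  have hY4 : ∑ b, ∑ c, ∑ j, ∑ k, P b k j c • w b c j k = Y := by
    refine (e12 _).trans ((e23 _).trans ((e12 _).trans ((e34 _).trans ?_)))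
    refine Finset.sum_congr rfl fun b _ ↦ Finset.sum_congr rfl fun c _ ↦
      Finset.sum_congr rfl fun j _ ↦ Finset.sum_congr rfl fun k _ ↦ ?_
    rw [h13, h34, neg_neg]
  have h3 : (3 : ℝ) • Y = 0 := by
    have : Y + Y + Y = 0 := by
      nth_rewrite 2 [← hY3]
      nth_rewrite 2 [← hY4]
      rw [hY]
      simp only [← Finset.sum_add_distrib, ← add_smul, hP, zero_smul, Finset.sum_const_zero]
    rw [← this]; module
  have hY0 : Y = 0 := (smul_eq_zero.1 h3).resolve_left (by norm_num)
  rw [hY0, smul_zero] at hZY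
  exact (smul_eq_zero.1 hZY).resolve_left (by norm_num)

/-- A sum with words of length three which are alternating in the last two letters vanishes if the
coefficients are symmetric in the last two indices. -/
lemma sum_word_three_eq_zero {v : n → n → n → R}
    (h23 : ∀ a b c, v a c b = - v a b c) {X : n → n → n → ℝ}
    (hX : ∀ c b l, X c b l - X c l b = 0) :
    ∑ c, ∑ b, ∑ l, X c b l • v c b l = 0 := by
  set Z := ∑ c, ∑ b, ∑ l, X c b l • v c b l with hZ
  have hZ2 : Z = - Z := by
    nth_rewrite 1 [hZ]
    have : ∀ f : n → n → n → R, ∑ b, ∑ c, ∑ j, f b c j = ∑ b, ∑ c, ∑ j, f b j c := fun f ↦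
      Finset.sum_congr rfl fun b _ ↦ Finset.sum_comm
    rw [this, hZ]
    simp only [← Finset.sum_neg_distrib]
    refine Finset.sum_congr rfl fun b _ ↦ Finset.sum_congr rfl fun c _ ↦
      Finset.sum_congr rfl fun j _ ↦ ?_
    rw [h23, smul_neg, sub_eq_zero.1 (hX b c j)]
  have h2 : (2 : ℝ) • Z = 0 := by
    rw [two_smul]; nth_rewrite 2 [hZ2]; exact add_neg_cancel _
  exact (smul_eq_zero.1 h2).resolve_left (by norm_num)

end Words

/-- A permutation of the order of summation. -/
lemma sum_six_rotate {n R : Type*} [Fintype n] [AddCommMonoid R] (f : n → n → n → n → n → n → R) :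
    ∑ i, ∑ b, ∑ c, ∑ j, ∑ k, ∑ l, f i b c j k l = ∑ b, ∑ c, ∑ j, ∑ k, ∑ l, ∑ i, f i b c j k l := by
  refine Eq.trans Finset.sum_comm (Finset.sum_congr rfl fun b _ ↦ ?_)
  refine Eq.trans Finset.sum_comm (Finset.sum_congr rfl fun c _ ↦ ?_)
  refine Eq.trans Finset.sum_comm (Finset.sum_congr rfl fun j _ ↦ ?_)
  refine Eq.trans Finset.sum_comm (Finset.sum_congr rfl fun k _ ↦ ?_)
  exact Finset.sum_comm

/-- A permutation of the order of summation. -/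
lemma sum_five_rotate {n R : Type*} [Fintype n] [AddCommMonoid R] (f : n → n → n → n → n → R) :
    ∑ j, ∑ k, ∑ l, ∑ b, ∑ c, f b c j k l = ∑ b, ∑ c, ∑ j, ∑ k, ∑ l, f b c j k l := by
  have h : ∀ g : n → n → n → n → R, ∑ j, ∑ k, ∑ l, ∑ b, g b j k l = ∑ b, ∑ j, ∑ k, ∑ l, g b j k l :=
    fun g ↦ by
      refine Eq.trans (Finset.sum_congr rfl fun j _ ↦ ?_) Finset.sum_comm
      refine Eq.trans (Finset.sum_congr rfl fun k _ ↦ ?_) Finset.sum_comm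
      exact Finset.sum_comm
  rw [h]
  exact Finset.sum_congr rfl fun b _ ↦ h _

section Curvature

variable {n : Type*} [Fintype n]

/-- The algebraic properties of the components `F j i k l = ⟨R(eⱼ, eᵢ) eₖ, e_l⟩` of a curvature
tensor which annihilates a `3`-form with components `φ i j k`. For a parallel form `φ` the last
property `annih` is the Ricci identity applied to `φ`. -/
structure CurvatureOf (φ : n → n → n → ℝ) (F : n → n → n → n → ℝ) : Prop where
  φ12 : ∀ a b c, φ b a c = - φ a b c
  φ23 : ∀ a b c, φ a c b = - φ a b c
  anti₁ : ∀ j i k l, F i j k l = - F j i k l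
  anti₂ : ∀ j i k l, F j i l k = - F j i k l
  bianchi : ∀ j i k l, F j i k l + F i k j l + F k j i l = 0
  annih : ∀ j i a b c, ∑ m, (F j i a m * φ m b c + F j i b m * φ a m c + F j i c m * φ a b m) = 0

variable {φ : n → n → n → ℝ} {F : n → n → n → n → ℝ}

/-- The pair symmetry of the curvature, from the first Bianchi identity in four positions. -/
lemma CurvatureOf.pair (h : CurvatureOf φ F) (j i k l : n) : F j i k l = F k l j i := by
  have b1 := h.bianchi j i k l
  have b2 := h.bianchi i k l j
  have b3 := h.bianchi k l j i
  have b4 := h.bianchi l j i k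
  have := h.anti₁; have := h.anti₂
  linarith [h.anti₁ j i k l, h.anti₂ j i k l, h.anti₁ i k j l, h.anti₂ i k j l, h.anti₁ k j i l,
    h.anti₂ k j i l, h.anti₁ i k l j, h.anti₁ k l i j, h.anti₂ k l i j, h.anti₁ l i k j,
    h.anti₂ l i k j, h.anti₁ k l j i, h.anti₁ l j k i, h.anti₂ l j k i, h.anti₁ j k l i,
    h.anti₂ j k l i, h.anti₁ l j i k, h.anti₁ j i l k, h.anti₂ j i l k, h.anti₁ i l j k,
    h.anti₂ i l j k, h.anti₂ l i j k, h.anti₂ k l i j]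

/-- The tensor `∑ᵢ F k j b i φ l i c`, which is used to express invariance of `φ`: the invariance
lets one trade the contraction of `F` with one index of `φ` for contractions with the two others. -/
def twist (φ : n → n → n → ℝ) (F : n → n → n → n → ℝ) (l k j b c : n) : ℝ :=
  ∑ i, F k j b i * φ l i c

/-- The Bianchi identity for the tensor `twist`. -/
lemma CurvatureOf.twist_cyclic (h : CurvatureOf φ F) (l k j b c : n) :
    twist φ F l k j b c + twist φ F l j b k c + twist φ F l b k j c = 0 := by
  simp only [twist, ← Finset.sum_add_distrib, ← add_mul]
  refine Finset.sum_eq_zero fun i _ ↦ ?_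
  rw [h.bianchi, zero_mul]

/-- The curvature annihilates `φ`, with the action on the first index of `φ` isolated. -/
lemma CurvatureOf.sum_annih (h : CurvatureOf φ F) (k j l b c : n) :
    ∑ i, F k j l i * φ i b c = - twist φ F l k j b c + twist φ F l k j c b := by
  have := h.annih k j l b c
  simp only [twist, Finset.sum_add_distrib] at this ⊢
  have e : ∑ i, F k j c i * φ l i b = - ∑ i, F k j c i * φ l b i := by
    rw [← Finset.sum_neg_distrib]
    exact Finset.sum_congr rfl fun i _ ↦ by rw [h.φ23]; ring
  rw [e]
  linarith

lemma CurvatureOf.antisymm_last (h : CurvatureOf φ F) (j i k l : n) :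
    F j i k l - F k i j l = F k j l i := by
  have := h.bianchi j i k l
  have h1 := h.anti₁ i k j l
  have h2 := h.anti₂ k j i l
  have h3 := h.anti₁ k i j l
  linarith

lemma CurvatureOf.antisymm_outer (h : CurvatureOf φ F) (j i k l : n) :
    F j i k l - F l i k j = - F l j k i := by
  have := h.bianchi k l j i
  have h1 := h.pair j i k l
  have h2 := h.pair l i k j
  have h3 := h.anti₁ j k l i
  have h4 := h.anti₁ k j l i
  linarith

section Operators

variable {R : Type*} [Ring R] [Algebra ℝ R]

/-- `∑ ι(eᵢ) φ ∧ eⱼ ∧ R(eⱼ, eᵢ) = 0`, where `R(eⱼ, eᵢ)` stands for its `l`-th column and `e` is a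
family of anticommuting elements. -/
lemma CurvatureOf.sum_ext_eq_zero (h : CurvatureOf φ F) {e : n → R}
    (he : ∀ a b, e a * e b = - (e b * e a)) (l : n) :
    ∑ b, ∑ c, ∑ j, ∑ k, (∑ i, φ i b c * F j i k l) • (e b * e c * e j * e k) = 0 := by
  refine sum_word_four_eq_zero ?_ ?_ ?_ (P := twist φ F l) (-1) (fun b c j k ↦ ?_)
    (h.twist_cyclic l)
  · intro a b c d; rw [he b a]; noncomm_ring
  · intro a b c d; rw [mul_assoc (e a), he c b]; noncomm_ring
  · intro a b c d; rw [mul_assoc _ (e d), he d c]; noncomm_ring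
  · rw [← Finset.sum_sub_distrib]
    have := h.sum_annih k j l b c
    simp only [← mul_sub, h.antisymm_last]
    rw [mul_sub, neg_one_mul, neg_one_mul, sub_neg_eq_add, ← this]
    exact Finset.sum_congr rfl fun i _ ↦ mul_comm _ _

/-- The analogue of `sum_ext_eq_zero` for the other index of the curvature, by pair symmetry. -/
lemma CurvatureOf.sum_ins_eq_zero (h : CurvatureOf φ F) {ι : n → R}
    (hι : ∀ a b, ι a * ι b = - (ι b * ι a)) (k : n) :
    ∑ b, ∑ c, ∑ j, ∑ l, (∑ i, φ i b c * F j i k l) • (ι b * ι c * ι j * ι l) = 0 := by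
  refine sum_word_four_eq_zero ?_ ?_ ?_ (P := twist φ F k) 1 (fun b c j l ↦ ?_)
    (h.twist_cyclic k)
  · intro a b c d; rw [hι b a]; noncomm_ring
  · intro a b c d; rw [mul_assoc (ι a), hι c b]; noncomm_ring
  · intro a b c d; rw [mul_assoc _ (ι d), hι d c]; noncomm_ring
  · rw [← Finset.sum_sub_distrib]
    have := h.sum_annih l j k b c
    simp only [← mul_sub, h.antisymm_outer]
    rw [one_mul, ← neg_inj, neg_sub, sub_eq_neg_add, ← this, ← Finset.sum_neg_distrib]
    exact Finset.sum_congr rfl fun i _ ↦ by ring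

/-- A double contraction of the curvature with `φ`. -/
def mix (φ : n → n → n → ℝ) (F : n → n → n → n → ℝ) (c b l : n) : ℝ :=
  ∑ y, ∑ m, F l y b m * φ y m c

/-- The contraction of `φ` with the Ricci tensor, expressed by the tensor `mix`. -/
lemma CurvatureOf.ricci_eq (h : CurvatureOf φ F) (c b l : n) :
    ∑ j, ∑ i, φ i c b * F j i j l = - mix φ F c b l + mix φ F b c l := by
  have key : ∑ y, ∑ m, (F l y y m * φ m b c + F l y b m * φ y m c + F l y c m * φ y b m) = 0 :=
    Finset.sum_eq_zero fun y _ ↦ h.annih l y y b c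
  simp only [Finset.sum_add_distrib] at key
  have e1 : ∑ y, ∑ m, F l y y m * φ m b c = ∑ j, ∑ i, φ i c b * F j i j l := by
    refine Finset.sum_congr rfl fun j _ ↦ Finset.sum_congr rfl fun i _ ↦ ?_
    rw [h.φ23 i b c, h.pair j i j l, h.anti₁ l j j i]
    ring
  have e2 : ∑ y, ∑ m, F l y c m * φ y b m = - mix φ F b c l := by
    simp only [mix, ← Finset.sum_neg_distrib]
    refine Finset.sum_congr rfl fun j _ ↦ Finset.sum_congr rfl fun i _ ↦ ?_
    rw [h.φ23 j i b]; ring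
  rw [e1, e2] at key
  simp only [mix] at key ⊢
  linarith

/-- The two double contractions of the curvature with `φ` agree after antisymmetrization in `b` and
`l`. -/
lemma CurvatureOf.mix_antisymm (h : CurvatureOf φ F) (c b l : n) :
    (∑ k, ∑ i, φ i k c * F b i k l) - (∑ k, ∑ i, φ i k c * F l i k b)
      = mix φ F c b l - mix φ F c l b := by
  have e : ∀ x y : n, mix φ F c x y = ∑ k, ∑ i, F y i x k * φ i k c := fun x y ↦ Finset.sum_comm
  rw [e, e]
  simp only [← Finset.sum_sub_distrib]
  refine Finset.sum_congr rfl fun k _ ↦ Finset.sum_congr rfl fun i _ ↦ ?_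
  have h1 := h.antisymm_outer b i k l
  have h2 := h.antisymm_last i l b k
  have h3 := h.anti₁ i l b k
  have h4 := h.bianchi l i b k
  have h5 := h.pair l b k i
  have h6 := h.anti₁ i b l k
  have h7 := h.pair b l i k
  have h8 := h.anti₁ b l i k
  have h9 := h.anti₂ l b i k
  have : F b i k l - F l i k b = F l i b k - F b i l k := by linarith
  linear_combination φ i k c * this

/-- The curvature term of the contraction with `φ`: `∑ ι(ι(eᵢ) φ) ι(eⱼ) R(eⱼ, eᵢ) = 0`, where the
curvature acts on forms as `∑ F j i k l eₖ ∧ ι(e_l)`. Moving `eₖ` to the left leaves three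
contracted terms, which cancel by `ricci_eq` and `mix_antisymm`, and a term that vanishes by
`sum_ins_eq_zero`. -/
lemma CurvatureOf.sum_ins_ext_eq_zero (h : CurvatureOf φ F) [DecidableEq n] {ι e : n → R}
    (hι : ∀ a b, ι a * ι b = - (ι b * ι a))
    (hιe : ∀ a b, ι a * e b = (if a = b then 1 else 0) - e b * ι a) :
    ∑ b, ∑ c, ∑ j, ∑ k, ∑ l, (∑ i, φ i b c * F j i k l) • (ι b * ι c * ι j * (e k * ι l)) = 0 := by
  have hw : ∀ b c j k l, ι b * ι c * ι j * (e k * ι l)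
      = (if j = k then ι b * ι c * ι l else 0) - (if c = k then ι b * ι j * ι l else 0)
        + (if b = k then ι c * ι j * ι l else 0) - e k * (ι b * ι c * ι j * ι l) := by
    intro b c j k l
    have : ι b * ι c * ι j * (e k * ι l) = ι b * (ι c * (ι j * e k)) * ι l := by noncomm_ring
    rw [this, hιe, mul_sub, ← mul_assoc (ι c), hιe c, mul_sub, sub_mul (ite _ _ _),
      mul_sub (ι b), ← mul_assoc (ι b) (_ * _), ← mul_assoc (ι b) (e k), hιe b]
    split_ifs <;> noncomm_ring
  have ite_sum : ∀ (a : n) (f : n → n → R),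
      ∑ k, ∑ l, (if a = k then f k l else 0) = ∑ l, f a l := fun a f ↦ by
    rw [Finset.sum_comm]; simp
  simp only [hw, smul_add, smul_sub, Finset.sum_add_distrib, Finset.sum_sub_distrib, smul_ite,
    smul_zero, ite_sum]
  have z4 : ∑ b, ∑ c, ∑ j, ∑ k, ∑ l, (∑ i, φ i b c * F j i k l) •
      (e k * (ι b * ι c * ι j * ι l)) = 0 := by
    have : ∀ f : n → n → n → n → R, ∑ b, ∑ c, ∑ j, ∑ k, f b c j k
        = ∑ k, ∑ b, ∑ c, ∑ j, f b c j k := fun f ↦ by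
      refine Eq.trans (Finset.sum_congr rfl fun b _ ↦ ?_) Finset.sum_comm
      refine Eq.trans (Finset.sum_congr rfl fun c _ ↦ ?_) Finset.sum_comm
      exact Finset.sum_comm
    rw [this]
    refine Finset.sum_eq_zero fun k _ ↦ ?_
    have := congrArg (fun r ↦ e k * r) (h.sum_ins_eq_zero hι k)
    simpa only [Finset.mul_sum, mul_smul_comm, mul_zero] using this
  rw [z4, sub_zero]
  set v : n → n → n → R := fun c b l ↦ ι c * ι b * ι l with hv
  have v12 : ∀ a b c, v b a c = - v a b c := fun a b c ↦ by
    simp only [hv]; rw [hι b a]; noncomm_ring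
  have v23 : ∀ a b c, v a c b = - v a b c := fun a b c ↦ by
    simp only [hv]; rw [mul_assoc, hι c b]; noncomm_ring
  have R1 : ∑ b, ∑ c, ∑ j, ∑ l, (∑ i, φ i b c * F j i j l) • (ι b * ι c * ι l)
      = ∑ c, ∑ b, ∑ l, (- mix φ F c b l + mix φ F b c l) • v c b l := by
    refine Finset.sum_congr rfl fun c _ ↦ Finset.sum_congr rfl fun b _ ↦ ?_
    rw [Finset.sum_comm]
    refine Finset.sum_congr rfl fun l _ ↦ ?_
    rw [← Finset.sum_smul, h.ricci_eq]
  have R2 : ∑ b, ∑ c, ∑ j, ∑ l, (∑ i, φ i b c * F j i c l) • (ι b * ι j * ι l)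
      = - ∑ c, ∑ b, ∑ l, (∑ k, ∑ i, φ i k c * F b i k l) • v c b l := by
    rw [← Finset.sum_neg_distrib]
    refine Finset.sum_congr rfl fun c _ ↦ ?_
    rw [Finset.sum_comm, ← Finset.sum_neg_distrib]
    refine Finset.sum_congr rfl fun b _ ↦ ?_
    rw [Finset.sum_comm, ← Finset.sum_neg_distrib]
    refine Finset.sum_congr rfl fun l _ ↦ ?_
    rw [← Finset.sum_smul, ← neg_smul, ← Finset.sum_neg_distrib]
    congr 1
    refine Finset.sum_congr rfl fun k _ ↦ ?_
    rw [← Finset.sum_neg_distrib]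
    exact Finset.sum_congr rfl fun i _ ↦ by rw [h.φ23 i k c]; ring
  have R3 : ∑ b, ∑ c, ∑ j, ∑ l, (∑ i, φ i b c * F j i b l) • (ι c * ι j * ι l)
      = ∑ c, ∑ b, ∑ l, (∑ k, ∑ i, φ i k c * F b i k l) • v c b l := by
    rw [Finset.sum_comm]
    refine Finset.sum_congr rfl fun c _ ↦ ?_
    rw [Finset.sum_comm]
    refine Finset.sum_congr rfl fun b _ ↦ ?_
    rw [Finset.sum_comm]
    refine Finset.sum_congr rfl fun l _ ↦ ?_
    rw [← Finset.sum_smul]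
  have z1 : ∑ c, ∑ b, ∑ l, (mix φ F c b l + mix φ F b c l) • v c b l = 0 := by
    have := sum_word_three_eq_zero (v := fun l c b ↦ v c b l)
      (X := fun l c b ↦ mix φ F c b l + mix φ F b c l) (fun l c b ↦ v12 c b l)
      (fun l c b ↦ by ring)
    rw [← this]
    symm
    rw [Finset.sum_comm]
    exact Finset.sum_congr rfl fun b _ ↦ Finset.sum_comm
  have z2 : ∑ c, ∑ b, ∑ l, ((∑ k, ∑ i, φ i k c * F b i k l) - mix φ F c b l) • v c b l = 0 :=
    sum_word_three_eq_zero v23 fun c b l ↦ by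
      have := h.mix_antisymm c b l
      linarith
  rw [R1, R2, R3]
  simp only [add_smul, sub_smul, neg_smul, Finset.sum_add_distrib, Finset.sum_sub_distrib,
    Finset.sum_neg_distrib] at z1 z2 ⊢
  rw [eq_neg_of_add_eq_zero_right z1, ← sub_eq_zero.1 z2]
  abel

/-- The commutation of `y d` with the multiplication by the `3`-form `φ`, for generators `x` and `y`
of a Clifford-type algebra `y a x b + x b y a = δ`: if `x` is exterior and `y` interior
multiplication, this is the Leibniz rule for `ι (φ ∧ ·)`. -/
lemma mul_sum_three [DecidableEq n] {x y : n → R} (hφ12 : ∀ a b c, φ b a c = - φ a b c)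
    (hφ23 : ∀ a b c, φ a c b = - φ a b c)
    (hx : ∀ a b, x a * x b = - (x b * x a))
    (hyx : ∀ a b, y a * x b = (if a = b then 1 else 0) - x b * y a) (d : n) :
    y d * (∑ a, ∑ b, ∑ c, φ a b c • (x a * x b * x c))
      = (3 : ℝ) • (∑ b, ∑ c, φ d b c • (x b * x c))
        - (∑ a, ∑ b, ∑ c, φ a b c • (x a * x b * x c)) * y d := by
  have hw : ∀ a b c, y d * (x a * x b * x c)
      = (if d = a then x b * x c else 0) - (if d = b then x a * x c else 0)
        + (if d = c then x a * x b else 0) - x a * x b * x c * y d := by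
    intro a b c
    have : y d * (x a * x b * x c) = (y d * x a) * (x b * x c) := by noncomm_ring
    rw [this, hyx, sub_mul, ← mul_assoc (x a * y d), mul_assoc (x a) (y d), hyx, mul_sub, sub_mul,
      mul_assoc (x a) (_ * _), mul_assoc (x b), hyx]
    split_ifs <;> noncomm_ring
  simp only [Finset.mul_sum, Finset.sum_mul, mul_smul_comm, smul_mul_assoc, hw, smul_add, smul_sub,
    Finset.sum_add_distrib, Finset.sum_sub_distrib, smul_ite, smul_zero]
  have e1 : ∑ a, ∑ b, ∑ c, (if d = a then φ a b c • (x b * x c) else 0)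
      = ∑ b, ∑ c, φ d b c • (x b * x c) := by
    rw [Finset.sum_comm]
    refine Finset.sum_congr rfl fun b _ ↦ ?_
    rw [Finset.sum_comm]
    simp
  have e2 : ∑ a, ∑ b, ∑ c, (if d = b then φ a b c • (x a * x c) else 0)
      = - ∑ b, ∑ c, φ d b c • (x b * x c) := by
    rw [← Finset.sum_neg_distrib]
    refine Finset.sum_congr rfl fun b _ ↦ ?_
    rw [Finset.sum_comm, ← Finset.sum_neg_distrib]
    refine Finset.sum_congr rfl fun c _ ↦ ?_
    simp [hφ12 d b c]
  have e3 : ∑ a, ∑ b, ∑ c, (if d = c then φ a b c • (x a * x b) else 0)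
      = ∑ b, ∑ c, φ d b c • (x b * x c) := by
    refine Finset.sum_congr rfl fun b _ ↦ Finset.sum_congr rfl fun c _ ↦ ?_
    simp [hφ12 d b c, hφ23 b d c]
  rw [e1, e2, e3]
  module

variable {M : Type*} [AddCommGroup M] [Module ℝ M] [Module R M] [IsScalarTower ℝ R M]

/-- The common part of the cases of the wedge product and of the contraction. Here `x a` and `y a`
are exterior and interior multiplications or the other way round, `A j i` stands for `∇ⱼ ∇ᵢ α`, the
hypothesis `hA` is the Ricci identity with the action `D j i` of the curvature, and `hxA` and `hyA`
are the derivatives of `dα = 0` and `d* α = 0`. Commuting `y i` past `φ` and then using the Ricci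
identity leaves only the curvature term of `hD`. -/
lemma CurvatureOf.sum_mul_eq_zero_of (h : CurvatureOf φ F) [DecidableEq n] {x y : n → R}
    (hx : ∀ a b, x a * x b = - (x b * x a))
    (hyx : ∀ a b, y a * x b = (if a = b then 1 else 0) - x b * y a)
    (D : n → n → R)
    (hD : ∑ i, (∑ b, ∑ c, φ i b c • (x b * x c)) * ∑ j, x j * D j i = 0)
    {A : n → n → M} {α : M} (hA : ∀ j i, A j i = A i j - D j i • α)
    (hxA : ∀ j, ∑ i, x i • A j i = 0) (hyA : ∀ j, ∑ i, y i • A j i = 0) :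
    ∑ j, ∑ i, (x j * y i * (∑ a, ∑ b, ∑ c, φ a b c • (x a * x b * x c))) • A j i = 0 := by
  set T := ∑ a, ∑ b, ∑ c, φ a b c • (x a * x b * x c) with hT
  set S : n → R := fun i ↦ ∑ b, ∑ c, φ i b c • (x b * x c) with hS
  have hxS : ∀ j i, x j * S i = S i * x j := by
    intro j i
    simp only [hS, Finset.mul_sum, Finset.sum_mul, mul_smul_comm, smul_mul_assoc]
    refine Finset.sum_congr rfl fun b _ ↦ Finset.sum_congr rfl fun c _ ↦ ?_
    rw [← mul_assoc, hx j b, mul_assoc (x b), hx c j, neg_mul, mul_assoc (x b)]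
    simp [mul_assoc]
  have h1 : ∀ j i, (x j * y i * T) • A j i
      = (3 : ℝ) • (S i * x j) • A j i - (x j * T) • (y i • A j i) := by
    intro j i
    rw [mul_assoc, hT, mul_sum_three h.φ12 h.φ23 hx hyx, ← hT, mul_sub, mul_smul_comm, sub_smul,
      smul_assoc]
    change (3 : ℝ) • (x j * S i) • A j i - _ = _
    rw [hxS, smul_smul, mul_assoc]
  simp only [h1, Finset.sum_sub_distrib]
  have h2 : ∑ j, ∑ i, (x j * T) • (y i • A j i) = 0 :=
    Finset.sum_eq_zero fun j _ ↦ by rw [← Finset.smul_sum, hyA, smul_zero]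
  rw [h2, sub_zero, Finset.sum_comm]
  simp only [← Finset.smul_sum]
  have h3 : ∀ i, ∑ j, (S i * x j) • A j i = - (S i * ∑ j, x j * D j i) • α := by
    intro i
    have : ∀ j, (S i * x j) • A j i = S i • (x j • A i j) - (S i * (x j * D j i)) • α := by
      intro j
      rw [hA, smul_sub, smul_smul, smul_smul, mul_assoc]
    simp only [this, Finset.sum_sub_distrib, ← Finset.smul_sum, hxA, smul_zero, zero_sub]
    rw [← Finset.sum_smul, Finset.mul_sum, neg_smul]
  simp only [h3, neg_smul, Finset.sum_neg_distrib, ← Finset.sum_smul]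
  rw [hD, zero_smul, neg_zero, smul_zero]

/-- For `A j i = ∇ⱼ ∇ᵢ α`, with `α` closed and coclosed, `∑ eⱼ ∧ ι(eᵢ) (φ ∧ ∇ⱼ ∇ᵢ α) = 0`. This is
`- d d* (φ ∧ α)` for parallel `φ`, up to a constant factor. -/
lemma CurvatureOf.sum_ext_ins_eq_zero (h : CurvatureOf φ F) [DecidableEq n] {ι e : n → R}
    (he : ∀ a b, e a * e b = - (e b * e a))
    (hιe : ∀ a b, ι a * e b = (if a = b then 1 else 0) - e b * ι a)
    {A : n → n → M} {α : M}
    (hA : ∀ j i, A j i = A i j - (∑ k, ∑ l, F j i k l • (e k * ι l)) • α)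
    (heA : ∀ j, ∑ i, e i • A j i = 0) (hιA : ∀ j, ∑ i, ι i • A j i = 0) :
    ∑ j, ∑ i, (e j * ι i * (∑ a, ∑ b, ∑ c, φ a b c • (e a * e b * e c))) • A j i = 0 := by
  refine h.sum_mul_eq_zero_of he hιe _ ?_ hA heA hιA
  have h1 : ∑ b, ∑ c, ∑ j, ∑ k, ∑ l, (∑ i, φ i b c * F j i k l) •
      (e b * e c * e j * e k * ι l) = 0 := by
    have : ∀ f : n → n → n → n → n → R, ∑ b, ∑ c, ∑ j, ∑ k, ∑ l, f b c j k l
        = ∑ l, ∑ b, ∑ c, ∑ j, ∑ k, f b c j k l := fun f ↦ by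
      refine Eq.trans (Finset.sum_congr rfl fun b _ ↦ ?_) Finset.sum_comm
      refine Eq.trans (Finset.sum_congr rfl fun c _ ↦ ?_) Finset.sum_comm
      refine Eq.trans (Finset.sum_congr rfl fun c _ ↦ ?_) Finset.sum_comm
      exact Finset.sum_comm
    rw [this]
    refine Finset.sum_eq_zero fun l _ ↦ ?_
    have := congrArg (fun r ↦ r * ι l) (h.sum_ext_eq_zero he l)
    simpa only [Finset.sum_mul, smul_mul_assoc, zero_mul] using this
  rw [← h1]
  simp only [Finset.sum_mul, Finset.mul_sum, smul_mul_assoc, mul_smul_comm, smul_smul,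
    Finset.sum_smul]
  rw [← sum_six_rotate]
  refine Finset.sum_congr rfl fun i _ ↦ ?_
  simp only [Finset.smul_sum, smul_smul]
  rw [← sum_five_rotate fun b c j k l ↦ (φ i b c * F j i k l) • (e b * e c * e j * e k * ι l)]
  simp only [mul_assoc, mul_comm (F _ _ _ _)]

/-- For `A j i = ∇ⱼ ∇ᵢ α`, with `α` closed and coclosed, `∑ ι(eⱼ) (eᵢ ∧ C_φ ∇ⱼ ∇ᵢ α) = 0`, where
`C_φ` is the contraction with `φ` up to a factor. This is `- d* d (C_φ α)` for parallel `φ`, up to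
this factor. -/
lemma CurvatureOf.sum_ins_contr_eq_zero (h : CurvatureOf φ F) [DecidableEq n] {ι e : n → R}
    (hι : ∀ a b, ι a * ι b = - (ι b * ι a))
    (hιe : ∀ a b, ι a * e b = (if a = b then 1 else 0) - e b * ι a)
    {A : n → n → M} {α : M}
    (hA : ∀ j i, A j i = A i j - (∑ k, ∑ l, F j i k l • (e k * ι l)) • α)
    (heA : ∀ j, ∑ i, e i • A j i = 0) (hιA : ∀ j, ∑ i, ι i • A j i = 0) :
    ∑ j, ∑ i, (ι j * e i * (∑ a, ∑ b, ∑ c, φ a b c • (ι a * ι b * ι c))) • A j i = 0 := by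
  refine h.sum_mul_eq_zero_of hι (fun a b ↦ ?_) _ ?_ hA hιA heA
  · simp only [hιe b a, eq_comm (a := b), sub_sub_cancel]
  rw [← h.sum_ins_ext_eq_zero hι hιe]
  simp only [Finset.sum_mul, Finset.mul_sum, smul_mul_assoc, mul_smul_comm, smul_smul,
    Finset.sum_smul]
  rw [← sum_six_rotate]
  refine Finset.sum_congr rfl fun i _ ↦ ?_
  simp only [Finset.smul_sum, smul_smul]
  rw [← sum_five_rotate fun b c j k l ↦
    (φ i b c * F j i k l) • (ι b * ι c * ι j * (e k * ι l))]
  simp only [mul_assoc, mul_comm (F _ _ _ _)]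

end Operators

end Curvature

end

/-! ### Operators on the total space of forms; the action of the curvature -/

section

variable {V : Type*} [NormedAddCommGroup V] [NormedSpace ℝ V]

/-- All forms, with one component in each degree. Interior and exterior multiplications act on this
space as elements of one ring, so that computations with words in them need no casts between
degrees. -/
abbrev Tot (V : Type*) [NormedAddCommGroup V] [NormedSpace ℝ V] := (p : ℕ) → Alt V p

/-- Interior multiplication as an operator on all forms. -/
def insOp (v : V) : Module.End ℝ (Tot V) where
  toFun a p := ins p v (a (p + 1))
  map_add' a b := by ext1 p; simp
  map_smul' c a := by ext1 p; simp

/-- Exterior multiplication as an operator on all forms. -/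
def extOp (θ : V →L[ℝ] ℝ) : Module.End ℝ (Tot V) where
  toFun a p := match p with
    | 0 => 0
    | p + 1 => ext p θ (a p)
  map_add' a b := by ext1 p; cases p <;> simp
  map_smul' c a := by ext1 p; cases p <;> simp

lemma insOp_apply (v : V) (a : Tot V) (p : ℕ) : insOp v a p = ins p v (a (p + 1)) := rfl
lemma extOp_apply_zero (θ : V →L[ℝ] ℝ) (a : Tot V) : extOp θ a 0 = 0 := rfl
lemma extOp_apply_succ (θ : V →L[ℝ] ℝ) (a : Tot V) (p : ℕ) :
    extOp θ a (p + 1) = ext p θ (a p) := rfl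

lemma insOp_mul_insOp (u v : V) : insOp u * insOp v = - (insOp v * insOp u) := by
  refine LinearMap.ext fun a ↦ funext fun p ↦ ?_
  exact ins_ins_swap u v _

lemma extOp_mul_extOp (θ η : V →L[ℝ] ℝ) : extOp θ * extOp η = - (extOp η * extOp θ) := by
  refine LinearMap.ext fun a ↦ funext fun p ↦ ?_
  match p with
  | 0 => simp [extOp_apply_zero]
  | 1 =>
    change ext 0 θ (extOp η a 0) = - ext 0 η (extOp θ a 0)
    simp [extOp_apply_zero]
  | p + 2 => exact ext_ext_swap θ η _

lemma insOp_mul_extOp (v : V) (θ : V →L[ℝ] ℝ) :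
    insOp v * extOp θ = θ v • 1 - extOp θ * insOp v := by
  refine LinearMap.ext fun a ↦ funext fun p ↦ ?_
  match p with
  | 0 =>
    change ins 0 v (ext 0 θ (a 0)) = θ v • a 0 - 0
    rw [ins_ext_zero, sub_zero]
  | p + 1 => exact ins_ext θ v _

lemma insOp_single {p : ℕ} (v : V) (a : Alt V (p + 1)) :
    insOp v (Pi.single (p + 1) a) = Pi.single p (ins p v a) := by
  funext q
  rw [insOp_apply]
  by_cases h : q = p
  · subst h; simp
  · rw [Pi.single_eq_of_ne h, Pi.single_eq_of_ne (by omega), map_zero]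

lemma insOp_single_zero (v : V) (a : Alt V 0) :
    insOp v (Pi.single 0 a) = 0 := by
  funext q
  rw [insOp_apply, Pi.single_eq_of_ne (by omega), map_zero]; rfl

lemma extOp_single {p : ℕ} (θ : V →L[ℝ] ℝ) (a : Alt V p) :
    extOp θ (Pi.single p a) = Pi.single (p + 1) (ext p θ a) := by
  funext q
  match q with
  | 0 => rw [extOp_apply_zero, Pi.single_eq_of_ne (by omega)]
  | q + 1 =>
    rw [extOp_apply_succ]
    by_cases h : q = p
    · subst h; simp
    · rw [Pi.single_eq_of_ne h, Pi.single_eq_of_ne (by omega), map_zero]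

lemma single_sum {κ : Type*} {p : ℕ} (s : Finset κ) (a : κ → Alt V p) :
    (Pi.single p (∑ i ∈ s, a i) : Tot V) = ∑ i ∈ s, Pi.single p (a i) :=
  map_sum (LinearMap.single ℝ (fun p ↦ Alt V p) p) a s

lemma single_smul' {p : ℕ} (c : ℝ) (a : Alt V p) :
    (Pi.single p (c • a) : Tot V) = c • Pi.single p a :=
  map_smul (LinearMap.single ℝ (fun p ↦ Alt V p) p) c a

variable {ι : Type*} [Fintype ι]

/-- `s` is a basis of `V`, with dual basis `σ`. -/
structure DualBases [DecidableEq ι] (s : ι → V) (σ : ι → V →L[ℝ] ℝ) : Prop where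
  dual : ∀ i j, σ i (s j) = if i = j then 1 else 0
  sum_eq : ∀ v, ∑ i, σ i v • s i = v

variable [DecidableEq ι] {s : ι → V} {σ : ι → V →L[ℝ] ℝ}

/-- The alternatization of a linear map to forms, in a basis. -/
lemma DualBases.alternatize (h : DualBases s σ) {p : ℕ} (N : V →L[ℝ] Alt V p) :
    alternatizeUncurryFin N = ∑ i, ext p (σ i) (N (s i)) := by
  have : N = ∑ i, (σ i).smulRight (N (s i)) := by
    ext1 v
    conv_lhs => rw [← h.sum_eq v]
    simp
  conv_lhs => rw [this]
  simp only [ext_eq]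
  exact map_sum (alternatizeUncurryFinCLM ℝ V ℝ) _ _

/-- The wedge product with a `3`-form as a polynomial in exterior multiplications. -/
lemma DualBases.wedge_three (h : DualBases s σ) {p : ℕ} (b : Alt V 3) (a : Alt V p) :
    (Pi.single (p + 3) (wedge p 3 b a) : Tot V)
      = (6 : ℝ)⁻¹ • (∑ i, ∑ j, ∑ k, b ![s i, s j, s k] •
        (extOp (σ i) * extOp (σ j) * extOp (σ k))) (Pi.single p a) := by
  simp only [LinearMap.sum_apply, LinearMap.smul_apply, Module.End.mul_apply, extOp_single,
    ← single_smul', ← single_sum]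
  congr 1
  simp only [wedge_succ, wedge_zero, h.alternatize, ContinuousLinearMap.comp_apply,
    ContinuousLinearMap.flip_apply, map_sum, map_smul, Finset.smul_sum, smul_smul]
  refine Finset.sum_congr rfl fun i _ ↦ Finset.sum_congr rfl fun j _ ↦
    Finset.sum_congr rfl fun k _ ↦ ?_
  have e : (ins 0 (s k) (ins 1 (s j) (ins 2 (s i) b))) ![] = b ![s i, s j, s k] := rfl
  rw [← e]
  push_cast
  ring_nf
  rfl

/-- The contraction with a `3`-form as a polynomial in interior multiplications. The sign is that of
the reversal of three indices. -/
lemma contr_three {p : ℕ} (b : Alt V 3) (a : Alt V (p + 3)) :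
    (Pi.single p (contr s s p 3 b a) : Tot V)
      = - (6 : ℝ)⁻¹ • (∑ i, ∑ j, ∑ k, b ![s i, s j, s k] •
        (insOp (s i) * insOp (s j) * insOp (s k))) (Pi.single (p + 3) a) := by
  simp only [LinearMap.sum_apply, LinearMap.smul_apply, Module.End.mul_apply, insOp_single,
    ← single_smul', ← single_sum]
  congr 1
  simp only [contr_succ, contr_zero, map_sum, map_smul, Finset.smul_sum, smul_smul]
  refine Finset.sum_congr rfl fun i _ ↦ Finset.sum_congr rfl fun j _ ↦
    Finset.sum_congr rfl fun k _ ↦ ?_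
  have : ins p (s k) (ins (p + 1) (s j) (ins (p + 2) (s i) a))
      = - ins p (s i) (ins (p + 1) (s j) (ins (p + 2) (s k) a)) := by
    rw [ins_ins_swap (s j) (s i), map_neg, ins_ins_swap (s k) (s i), neg_neg,
      ins_ins_swap (s k) (s j), map_neg]
  rw [show ins (p + 0) (s k) (ins (p + 1) (s j) (ins (p + 2) (s i) a)) = _ from this, smul_neg,
    ← neg_smul]
  have e : (ins 0 (s k) (ins 1 (s j) (ins 2 (s i) b))) ![] = b ![s i, s j, s k] := rfl
  rw [← e]
  push_cast
  ring_nf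

lemma DualBases.map_update (h : DualBases s σ) {p : ℕ} (a : Alt V p) (v : Fin p → V) (i : Fin p)
    (x : V) : a (Function.update v i x) = ∑ m, σ m x * a (Function.update v i (s m)) := by
  conv_lhs => rw [← h.sum_eq x]
  have := map_sum (a.toMultilinearMap.toLinearMap v i) (fun m ↦ σ m x • s m) Finset.univ
  simp only [map_smul, smul_eq_mul] at this
  exact this

/-- The derivation of the algebra of forms induced by an endomorphism `A` of `V`: `A` is inserted
into one argument at a time, with a positive sign. -/
abbrev der {p : ℕ} (A : V →L[ℝ] V) (a : Alt V p) : Alt V p :=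
  a.fderivCompContinuousLinearMap (ContinuousLinearMap.id ℝ V) A

lemma der_zero (A : V →L[ℝ] V) (a : Alt V 0) : der A a = 0 := by
  ext v
  simp [ContinuousAlternatingMap.fderivCompContinuousLinearMap_apply]

lemma der_apply {p : ℕ} (A : V →L[ℝ] V) (a : Alt V p) (v : Fin p → V) :
    der A a v = ∑ i, a (Function.update v i (A (v i))) := by
  rw [ContinuousAlternatingMap.fderivCompContinuousLinearMap_apply]
  refine Finset.sum_congr rfl fun i _ ↦ ?_
  congr 1
  funext j
  by_cases h : j = i
  · subst h; simp
  · simp [h]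

lemma DualBases.der_succ (h : DualBases s σ) {p : ℕ} (A : V →L[ℝ] V) (a : Alt V (p + 1)) :
    der A a = ∑ k, ext p (σ k) (ins p (A (s k)) a) := by
  have : der A a = alternatizeUncurryFin (((ins p).flip a) ∘L A) := by
    ext v
    rw [der_apply, alternatizeUncurryFin_apply]
    refine Finset.sum_congr rfl fun i _ ↦ ?_
    change _ = _ • a (Matrix.vecCons (A (v i)) (i.removeNth v))
    rw [← i.insertNth_removeNth]
    exact AlternatingMap.map_insertNth a.toAlternatingMap i (A (v i)) (i.removeNth v)
  rw [this, h.alternatize]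
  rfl

/-- The derivation induced by an endomorphism is `∑ A(eₖ)_l eᵏ ∧ ι(e_l)`. -/
lemma DualBases.single_der (h : DualBases s σ) {p : ℕ} (A : V →L[ℝ] V) (a : Alt V p) :
    (Pi.single p (der A a) : Tot V)
      = (∑ k, ∑ l, σ l (A (s k)) • (extOp (σ k) * insOp (s l))) (Pi.single p a) := by
  simp only [LinearMap.sum_apply, LinearMap.smul_apply, Module.End.mul_apply]
  cases p with
  | zero => simp [der_zero, insOp_single_zero]
  | succ p =>
    simp only [insOp_single, extOp_single, ← single_smul', ← single_sum]
    rw [h.der_succ]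
    congr 1
    refine Finset.sum_congr rfl fun k _ ↦ ?_
    conv_lhs => rw [← h.sum_eq (A (s k))]
    simp

/-- The properties of the curvature `F u v w = R(u, v) w` at a point, for a metric for which the
basis `s` is orthonormal, and of a `3`-form which it annihilates: antisymmetry, skew-adjointness,
the first Bianchi identity and the annihilation of `φ`. -/
structure IsCurvature (σ : ι → V →L[ℝ] ℝ) (s : ι → V) (φ : Alt V 3) (F : V → V → V →L[ℝ] V) : Prop where
  swap : ∀ u v, F v u = - F u v
  skew : ∀ u v k l, σ k (F u v (s l)) = - σ l (F u v (s k))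
  bianchi : ∀ u v w, F u v w + F v w u + F w u v = 0
  annih : ∀ u v, der (F u v) φ = 0

variable {φ : Alt V 3} {F : V → V → V →L[ℝ] V}

lemma IsCurvature.curvatureOf (h : DualBases s σ)
    (hF : IsCurvature σ s φ F) :
    CurvatureOf (fun i j k ↦ φ ![s i, s j, s k]) (fun j i k l ↦ σ l (F (s j) (s i) (s k))) where
  φ12 a b c := by
    have := φ.map_swap ![s a, s b, s c] (i := 0) (j := 1) (by decide)
    refine Eq.trans (congrArg φ ?_) this
    funext i
    fin_cases i <;> rfl
  φ23 a b c := by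
    have := φ.map_swap ![s a, s b, s c] (i := 1) (j := 2) (by decide)
    refine Eq.trans (congrArg φ ?_) this
    funext i
    fin_cases i <;> rfl
  anti₁ j i k l := by rw [hF.swap]; simp
  anti₂ j i k l := hF.skew _ _ _ _
  bianchi j i k l := by
    have := congrArg (σ l) (hF.bianchi (s j) (s i) (s k))
    simpa using this
  annih j i a b c := by
    have := congrArg (fun z ↦ z ![s a, s b, s c]) (hF.annih (s j) (s i))
    simp only [der_apply, Fin.sum_univ_three] at this
    rw [h.map_update φ _ 0, h.map_update φ _ 1, h.map_update φ _ 2, ← Finset.sum_add_distrib,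
      ← Finset.sum_add_distrib] at this
    refine Eq.trans ?_ this
    refine Finset.sum_congr rfl fun m _ ↦ ?_
    congr 1
    · congr 1
      · congr 2
        funext i
        fin_cases i <;> rfl
      · congr 2
        funext i
        fin_cases i <;> rfl
    · congr 2
      funext i
      fin_cases i <;> rfl

lemma single_injective' {p : ℕ} {a : Alt V p} (h : (Pi.single p a : Tot V) = 0) : a = 0 := by
  simpa using h

/-- For a parallel form `φ` and a form `α` which is closed (`hε`) and coclosed (`hι`), with second
covariant derivatives `A j i = ∇ⱼ ∇ᵢ α`, the second order part of `d d* (φ ∧ α)` vanishes. The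
hypothesis `hι` is stated for operators on all forms, so that it makes sense in degree `0`. -/
lemma IsCurvature.sum_ext_ins_wedge (hF : IsCurvature σ s φ F) (h : DualBases s σ) {p : ℕ}
    {α : Alt V p} {A : ι → ι → Alt V p} (hA : ∀ j i, A j i = A i j - der (F (s j) (s i)) α)
    (hε : ∀ j, ∑ i, ext p (σ i) (A j i) = 0)
    (hι : ∀ j, ∑ i, insOp (s i) (Pi.single p (A j i)) = 0) :
    ∑ j, ∑ i, ext (p + 2) (σ j) (ins (p + 2) (s i) (wedge p 3 φ (A j i))) = 0 := by
  apply single_injective'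
  have key := (hF.curvatureOf h).sum_ext_ins_eq_zero (ι := fun i ↦ insOp (s i))
    (e := fun i ↦ extOp (σ i)) (M := Tot V) (A := fun j i ↦ Pi.single p (A j i))
    (α := Pi.single p α) (fun a b ↦ extOp_mul_extOp _ _) (fun a b ↦ by
      rw [insOp_mul_extOp, h.dual]
      simp only [eq_comm (a := b), ite_smul, one_smul, zero_smul]) (fun j i ↦ by
      conv_lhs => rw [hA j i]
      rw [sub_eq_add_neg, sub_eq_add_neg, Pi.single_add, Pi.single_neg, h.single_der]
      rfl) (fun j ↦ by
      simp only [Module.End.smul_def, extOp_single]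
      rw [← single_sum, hε, Pi.single_zero]) (fun j ↦ hι j)
  have e : ∀ j i, (Pi.single (p + 3) (ext (p + 2) (σ j) (ins (p + 2) (s i) (wedge p 3 φ (A j i)))) :
      Tot V) = (6 : ℝ)⁻¹ • (extOp (σ j) * insOp (s i) * ∑ a, ∑ b, ∑ c, φ ![s a, s b, s c] •
        (extOp (σ a) * extOp (σ b) * extOp (σ c))) • Pi.single p (A j i) := fun j i ↦ by
    rw [← extOp_single, ← insOp_single]
    change extOp (σ j) (insOp (s i) (Pi.single (p + 3) (wedge p 3 φ (A j i)))) = _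
    rw [h.wedge_three]
    simp only [Module.End.smul_def, map_smul, Module.End.mul_apply]
  simp only [single_sum, e, ← Finset.smul_sum, key, smul_zero]

/-- For a parallel form `φ` and a form `α` which is closed and coclosed, with second covariant
derivatives `A`, the second order part of `d* d` of the contraction of `α` with `φ` vanishes. -/
lemma IsCurvature.sum_ins_ext_contr (hF : IsCurvature σ s φ F) (h : DualBases s σ) {p : ℕ}
    {α : Alt V (p + 3)} {A : ι → ι → Alt V (p + 3)}
    (hA : ∀ j i, A j i = A i j - der (F (s j) (s i)) α)
    (hε : ∀ j, ∑ i, ext (p + 3) (σ i) (A j i) = 0)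
    (hι : ∀ j, ∑ i, ins (p + 2) (s i) (A j i) = 0) :
    ∑ j, ∑ i, ins p (s j) (ext p (σ i) (contr s s p 3 φ (A j i))) = 0 := by
  apply single_injective'
  have key := (hF.curvatureOf h).sum_ins_contr_eq_zero (ι := fun i ↦ insOp (s i))
    (e := fun i ↦ extOp (σ i)) (M := Tot V) (A := fun j i ↦ Pi.single (p + 3) (A j i))
    (α := Pi.single (p + 3) α) (fun a b ↦ insOp_mul_insOp _ _) (fun a b ↦ by
      rw [insOp_mul_extOp, h.dual]
      simp only [eq_comm (a := b), ite_smul, one_smul, zero_smul]) (fun j i ↦ by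
      conv_lhs => rw [hA j i]
      rw [sub_eq_add_neg, sub_eq_add_neg, Pi.single_add, Pi.single_neg, h.single_der]
      rfl) (fun j ↦ by
      simp only [Module.End.smul_def, extOp_single]
      rw [← single_sum, hε, Pi.single_zero]) (fun j ↦ by
      simp only [Module.End.smul_def, insOp_single]
      rw [← single_sum, hι, Pi.single_zero])
  have e : ∀ j i, (Pi.single p (ins p (s j) (ext p (σ i) (contr s s p 3 φ (A j i)))) :
      Tot V) = - (6 : ℝ)⁻¹ • (insOp (s j) * extOp (σ i) * ∑ a, ∑ b, ∑ c, φ ![s a, s b, s c] •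
        (insOp (s a) * insOp (s b) * insOp (s c))) • Pi.single (p + 3) (A j i) := fun j i ↦ by
    rw [← insOp_single, ← extOp_single, contr_three]
    simp only [Module.End.smul_def, map_smul, Module.End.mul_apply]
  simp only [single_sum, e, ← Finset.smul_sum, key, smul_zero]

end

/-! ### Metrics on open sets of a vector space and their covariant derivatives -/

section

variable {V : Type*} [NormedAddCommGroup V] [NormedSpace ℝ V]

/-- Bilinear forms on `V`. -/
abbrev Bil (V : Type*) [NormedAddCommGroup V] [NormedSpace ℝ V] := V →L[ℝ] V →L[ℝ] ℝ

/-- `g` is symmetric and positive definite. -/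
structure IsInner (g : Bil V) : Prop where
  symm : ∀ u v, g u v = g v u
  pos : ∀ v, v ≠ 0 → 0 < g v v

lemma IsInner.eq_of_forall {g : Bil V} (h : IsInner g) {u v : V} (huv : ∀ w, g u w = g v w) :
    u = v := by
  by_contra hne
  have := h.pos (u - v) (sub_ne_zero.2 hne)
  simp only [map_sub, sub_apply] at this
  have h1 := huv u
  have h2 := huv v
  have h3 := h.symm u v
  linarith

/-- The inverse of the isomorphism `V → V*` given by a metric. It is only used for invertible `g`;
otherwise `ContinuousLinearMap.inverse` is `0`. -/
def sharp (g : Bil V) : (V →L[ℝ] ℝ) →L[ℝ] V := ContinuousLinearMap.inverse g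

section

variable [FiniteDimensional ℝ V]

lemma IsInner.isInvertible {g : Bil V} (h : IsInner g) : g.IsInvertible := by
  have hinj : Function.Injective (g : V →ₗ[ℝ] (V →L[ℝ] ℝ)) := fun u v huv ↦
    h.eq_of_forall fun w ↦ congrArg (fun t : V →L[ℝ] ℝ ↦ t w) huv
  have hdim : Module.finrank ℝ V = Module.finrank ℝ (V →L[ℝ] ℝ) := by
    rw [← LinearEquiv.finrank_eq (LinearMap.toContinuousLinearMap (𝕜 := ℝ) (E := V) (F' := ℝ))]
    exact (Subspace.dual_finrank_eq).symm
  refine ⟨(LinearMap.linearEquivOfInjective _ hinj hdim).toContinuousLinearEquiv, ?_⟩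
  ext u w
  rfl

lemma IsInner.apply_sharp {g : Bil V} (h : IsInner g) (θ : V →L[ℝ] ℝ) : g (sharp g θ) = θ := by
  obtain ⟨e, he⟩ := h.isInvertible
  rw [sharp, ← he, ContinuousLinearMap.inverse_equiv]
  exact e.apply_symm_apply θ

lemma IsInner.sharp_apply {g : Bil V} (h : IsInner g) (u : V) : sharp g (g u) = u :=
  h.eq_of_forall fun w ↦ by rw [h.apply_sharp]

end

/-- The Koszul expression `(D u v w + D v u w - D w u v) / 2`. -/
def koszul (D : V →L[ℝ] Bil V) : V →L[ℝ] Bil V :=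
  (2⁻¹ : ℝ) • (D + D.flip -
    (ContinuousLinearMap.flipₗᵢ ℝ V V ℝ).toContinuousLinearEquiv.toContinuousLinearMap ∘L D.flip)

lemma koszul_apply (D : V →L[ℝ] Bil V) (u v w : V) :
    koszul D u v w = (D u v w + D v u w - D w u v) / 2 := by
  rw [koszul, div_eq_inv_mul]
  rfl

/-- The Christoffel symbols `Γ(u, v)` of the metric `g`, as a bilinear map. -/
def chr (g : V → Bil V) (y : V) : V →L[ℝ] V →L[ℝ] V :=
  (ContinuousLinearMap.compL ℝ V (V →L[ℝ] ℝ) V (sharp (g y))) ∘L koszul (fderiv ℝ g y)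

lemma chr_apply (g : V → Bil V) (y u v : V) :
    chr g y u v = sharp (g y) (koszul (fderiv ℝ g y) u v) := rfl

/-- The covariant derivative `u ↦ ∇_u a` of a field of forms for the Levi-Civita connection of `g`.
-/
def cov (g : V → Bil V) {p : ℕ} (a : V → Alt V p) (y : V) : V →L[ℝ] Alt V p :=
  fderiv ℝ a y - (a y).fderivCompContinuousLinearMap (ContinuousLinearMap.id ℝ V) ∘L chr g y

lemma cov_apply (g : V → Bil V) {p : ℕ} (a : V → Alt V p) (y u : V) :
    cov g a y u = fderiv ℝ a y u - der (chr g y u) (a y) := rfl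

lemma two_le_infty : (1 + 1 : WithTop ℕ∞) ≤ (∞ : WithTop ℕ∞) := by
  rw [one_add_one_eq_two]
  exact WithTop.coe_le_coe.2 (le_top : (2 : ℕ∞) ≤ ⊤)

lemma hasFDerivAt_bil_apply {W : Type*} [NormedAddCommGroup W] [NormedSpace ℝ W] {g : W → Bil V}
    {g' : W →L[ℝ] Bil V} {y : W} {a b : W → V} {a' b' : W →L[ℝ] V}
    (hg : HasFDerivAt g g' y) (ha : HasFDerivAt a a' y) (hb : HasFDerivAt b b' y) (u : W) :
    fderiv ℝ (fun z ↦ g z (a z) (b z)) y u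
      = g' u (a y) (b y) + g y (a' u) (b y) + g y (a y) (b' u) := by
  rw [((hg.clm_apply ha).clm_apply hb).fderiv]
  simp only [add_apply, ContinuousLinearMap.comp_apply, ContinuousLinearMap.flip_apply]
  ring

lemma fderiv_bil_apply {W : Type*} [NormedAddCommGroup W] [NormedSpace ℝ W] {g : W → Bil V} {y : W}
    (hg : DifferentiableAt ℝ g y) (u : W) (v w : V) :
    fderiv ℝ (fun z ↦ g z v w) y u = fderiv ℝ g y u v w := by
  rw [hasFDerivAt_bil_apply hg.hasFDerivAt (hasFDerivAt_const v y) (hasFDerivAt_const w y)]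
  simp

/-- `g` is a smooth Riemannian metric on the open set `O`. -/
structure IsMetricOn (g : V → Bil V) (O : Set V) : Prop where
  isOpen : IsOpen O
  smooth : ContDiffOn ℝ ∞ g O
  inner : ∀ y ∈ O, IsInner (g y)

section

variable [FiniteDimensional ℝ V] {g : V → Bil V} {O : Set V} (h : IsMetricOn g O)

include h

lemma IsMetricOn.contDiffAt {y : V} (hy : y ∈ O) : ContDiffAt ℝ ∞ g y :=
  h.smooth.contDiffAt (h.isOpen.mem_nhds hy)

lemma IsMetricOn.differentiableAt {y : V} (hy : y ∈ O) : DifferentiableAt ℝ g y :=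
  (h.contDiffAt hy).differentiableAt (by simp)

lemma IsMetricOn.fderiv_symm {y : V} (hy : y ∈ O) (u v w : V) :
    fderiv ℝ g y u v w = fderiv ℝ g y u w v := by
  rw [← fderiv_bil_apply (h.differentiableAt hy), ← fderiv_bil_apply (h.differentiableAt hy)]
  congr 1
  exact Filter.EventuallyEq.fderiv_eq
    (Filter.eventually_of_mem (h.isOpen.mem_nhds hy) fun z hz ↦ (h.inner z hz).symm v w)

lemma IsMetricOn.apply_chr {y : V} (hy : y ∈ O) (u v w : V) :
    g y (chr g y u v) w
      = (fderiv ℝ g y u v w + fderiv ℝ g y v u w - fderiv ℝ g y w u v) / 2 := by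
  rw [chr_apply, (h.inner y hy).apply_sharp, koszul_apply]

lemma IsMetricOn.eq_chr {y : V} (hy : y ∈ O) {u v x : V}
    (hx : ∀ w, g y x w = (fderiv ℝ g y u v w + fderiv ℝ g y v u w - fderiv ℝ g y w u v) / 2) :
    x = chr g y u v :=
  (h.inner y hy).eq_of_forall fun w ↦ by rw [hx, h.apply_chr hy]

lemma IsMetricOn.chr_symm {y : V} (hy : y ∈ O) (u v : V) : chr g y u v = chr g y v u :=
  h.eq_chr hy fun w ↦ by rw [h.apply_chr hy, h.fderiv_symm hy w u v]; ring

/-- The connection is compatible with the metric. -/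
lemma IsMetricOn.fderiv_eq {y : V} (hy : y ∈ O) (u v w : V) :
    fderiv ℝ g y u v w = g y (chr g y u v) w + g y v (chr g y u w) := by
  rw [(h.inner y hy).symm v, h.apply_chr hy, h.apply_chr hy, h.fderiv_symm hy u w v,
    h.fderiv_symm hy v u w, h.fderiv_symm hy w u v]
  ring

lemma IsMetricOn.contDiffOn_sharp : ContDiffOn ℝ ∞ (fun y ↦ sharp (g y)) O := fun y hy ↦ by
  obtain ⟨e, he⟩ := (h.inner y hy).isInvertible
  have : ContDiffAt ℝ ∞ ContinuousLinearMap.inverse (g y) := by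
    rw [← he]; exact contDiffAt_map_inverse e
  exact (this.comp y (h.contDiffAt hy)).contDiffWithinAt

lemma IsMetricOn.contDiffOn_chr : ContDiffOn ℝ ∞ (chr g) O := by
  have h1 : ContDiffOn ℝ ∞ (fderiv ℝ g) O := h.smooth.fderiv_of_isOpen h.isOpen (by simp)
  have h2 : ContDiffOn ℝ ∞ (fun y ↦ koszul (fderiv ℝ g y)) O := by
    unfold koszul
    have hf : ContDiffOn ℝ ∞ (fun y ↦ (fderiv ℝ g y).flip) O :=
      (ContinuousLinearMap.flipₗᵢ ℝ V V (V →L[ℝ] ℝ)).contDiff.comp_contDiffOn h1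
    exact ContDiffOn.const_smul _ ((h1.add hf).sub (contDiffOn_const.clm_comp hf))
  exact ((ContinuousLinearMap.compL ℝ V (V →L[ℝ] ℝ) V).contDiff.comp_contDiffOn
    h.contDiffOn_sharp).clm_comp h2

lemma IsMetricOn.contDiffOn_cov {p : ℕ} {a : V → Alt V p} (ha : ContDiffOn ℝ ∞ a O) :
    ContDiffOn ℝ ∞ (cov g a) O := by
  have h1 : ContDiffOn ℝ ∞ (fderiv ℝ a) O := ha.fderiv_of_isOpen h.isOpen (by simp)
  let L : Alt V p →L[ℝ] (V →L[ℝ] V) →L[ℝ] Alt V p :=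
    ContinuousAlternatingMap.fderivCompContinuousLinearMapCLM ℝ (ContinuousLinearMap.id ℝ V)
  exact h1.sub ((L.contDiff.comp_contDiffOn ha).clm_comp h.contDiffOn_chr)

/-- The connection is torsion-free: the exterior derivative is the alternatization of the
covariant derivative. -/
lemma IsMetricOn.extDeriv_eq {p : ℕ} (a : V → Alt V p) {y : V} (hy : y ∈ O) :
    extDeriv a y = alternatizeUncurryFin (cov g a y) := by
  have := ContinuousAlternatingMap.alternatizeUncurryFin_fderivCompContinuousLinearMap_eq_zero (a y)
    (ContinuousLinearMap.id ℝ V) (h := chr g y) (h.chr_symm hy)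
  have h2 := map_sub (alternatizeUncurryFinCLM ℝ V ℝ (n := p)) (fderiv ℝ a y)
    ((a y).fderivCompContinuousLinearMap (ContinuousLinearMap.id ℝ V) ∘L chr g y)
  refine Eq.symm (Eq.trans h2 ?_)
  change _ - alternatizeUncurryFin _ = _
  rw [this, sub_zero]; rfl

omit h in
/-- The transformation law of the Christoffel symbols under `q`, for the metric `g' = q* g`. -/
lemma IsMetricOn.fderiv_chr_pullback {g' : V → Bil V} {O' : Set V} (h : IsMetricOn g O)
    (h' : IsMetricOn g' O') {q : V → V} {z : V} (hz : z ∈ O') (hqz : q z ∈ O)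
    (hq : ContDiffAt ℝ ∞ q z) (hinv : (fderiv ℝ q z).IsInvertible)
    (hg' : ∀ᶠ w in 𝓝 z, ∀ u v, g' w u v = g (q w) (fderiv ℝ q w u) (fderiv ℝ q w v)) (u v : V) :
    fderiv ℝ q z (chr g' z u v)
      = chr g (q z) (fderiv ℝ q z u) (fderiv ℝ q z v) + fderiv ℝ (fderiv ℝ q) z u v := by
  obtain ⟨e, he⟩ := hinv
  have hDq : HasFDerivAt q (fderiv ℝ q z) z := (hq.differentiableAt (by simp)).hasFDerivAt
  have hD2 : DifferentiableAt ℝ (fderiv ℝ q) z :=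
    (hq.fderiv_right (m := 1) two_le_infty).differentiableAt (by simp)
  have hB : ∀ v, HasFDerivAt (fun w ↦ fderiv ℝ q w v) ((fderiv ℝ (fderiv ℝ q) z).flip v) z :=
    fun v ↦ by
      have := hD2.hasFDerivAt.clm_apply (hasFDerivAt_const v z)
      simpa using this
  have hsymm : ∀ u v, fderiv ℝ (fderiv ℝ q) z u v = fderiv ℝ (fderiv ℝ q) z v u :=
    hq.isSymmSndFDerivAt (by simpa [one_add_one_eq_two] using two_le_infty)
  have hgq : HasFDerivAt (fun w ↦ g (q w)) (fderiv ℝ g (q z) ∘L fderiv ℝ q z) z :=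
    (h.differentiableAt hqz).hasFDerivAt.comp z hDq
  -- differentiate `g' = q* g`; the claim then follows from the Koszul formula for `g` and `g'`
  have key : ∀ u v w, fderiv ℝ g' z u v w
      = fderiv ℝ g (q z) (fderiv ℝ q z u) (fderiv ℝ q z v) (fderiv ℝ q z w)
        + g (q z) (fderiv ℝ (fderiv ℝ q) z u v) (fderiv ℝ q z w)
        + g (q z) (fderiv ℝ q z v) (fderiv ℝ (fderiv ℝ q) z u w) := fun u v w ↦ by
    rw [← fderiv_bil_apply (h'.differentiableAt hz),
      Filter.EventuallyEq.fderiv_eq (hg'.mono fun w' hw' ↦ hw' v w),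
      hasFDerivAt_bil_apply hgq (hB v) (hB w)]
    rfl
  set r := chr g (q z) (fderiv ℝ q z u) (fderiv ℝ q z v) + fderiv ℝ (fderiv ℝ q) z u v with hr
  have hx : e.symm r = chr g' z u v := h'.eq_chr hz fun w ↦ by
    have her : fderiv ℝ q z (e.symm r) = r := by rw [← he]; exact e.apply_symm_apply r
    rw [hg'.self_of_nhds, her, hr, map_add, add_apply, h.apply_chr hqz, key, key, key,
      hsymm v u, hsymm w u, hsymm w v]
    linarith [(h.inner _ hqz).symm (fderiv ℝ q z v) (fderiv ℝ (fderiv ℝ q) z u w)]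
  rw [← hx, ← he]
  exact e.apply_symm_apply r

omit h in
/-- Naturality of the covariant derivative under `q`, for `g' = q* g` and `a' = q* a`. -/
lemma IsMetricOn.cov_pullback {g' : V → Bil V} {O' : Set V} (h : IsMetricOn g O)
    (h' : IsMetricOn g' O') {q : V → V} {z : V} (hz : z ∈ O') (hqz : q z ∈ O)
    (hq : ContDiffAt ℝ ∞ q z) (hinv : (fderiv ℝ q z).IsInvertible)
    (hg' : ∀ᶠ w in 𝓝 z, ∀ u v, g' w u v = g (q w) (fderiv ℝ q w u) (fderiv ℝ q w v))
    {p : ℕ} {a a' : V → Alt V p} (ha : DifferentiableAt ℝ a (q z))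
    (ha' : ∀ᶠ w in 𝓝 z, a' w = pb (a (q w)) (fderiv ℝ q w)) (u : V) :
    cov g' a' z u = pb (cov g a (q z) (fderiv ℝ q z u)) (fderiv ℝ q z) := by
  have hDq : HasFDerivAt q (fderiv ℝ q z) z := (hq.differentiableAt (by simp)).hasFDerivAt
  have hD2 : DifferentiableAt ℝ (fderiv ℝ q) z :=
    (hq.fderiv_right (m := 1) two_le_infty).differentiableAt (by simp)
  have hd := HasFDerivAt.continuousAlternatingMapCompContinuousLinearMap
    (ha.hasFDerivAt.comp z hDq) hD2.hasFDerivAt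
  have hd' : fderiv ℝ a' z = _ := (Filter.EventuallyEq.fderiv_eq ha').trans hd.fderiv
  rw [cov_apply, cov_apply, hd', ha'.self_of_nhds]
  ext v
  have hc := h.fderiv_chr_pullback h' hz hqz hq hinv hg'
  have e1 : (ContinuousAlternatingMap.fderivCompContinuousLinearMap (a (q z)) (fderiv ℝ q z)
      (fderiv ℝ (fderiv ℝ q) z u)) v = ∑ i, a (q z) (Function.update (fun j ↦ fderiv ℝ q z (v j)) i
        (fderiv ℝ (fderiv ℝ q) z u (v i))) := by
    rw [ContinuousAlternatingMap.fderivCompContinuousLinearMap_apply]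
    refine Finset.sum_congr rfl fun i _ ↦ ?_
    congr 1
    funext j
    by_cases h : j = i
    · subst h; simp
    · simp [h]
  have e2 : der (chr g' z u) (pb (a (q z)) (fderiv ℝ q z)) v
      = ∑ i, a (q z) (Function.update (fun j ↦ fderiv ℝ q z (v j)) i
        (chr g (q z) (fderiv ℝ q z u) (fderiv ℝ q z (v i)) + fderiv ℝ (fderiv ℝ q) z u (v i))) := by
    rw [der_apply]
    refine Finset.sum_congr rfl fun i _ ↦ ?_
    rw [pb_apply, ← hc]
    congr 1
    funext j
    by_cases h : j = i
    · subst h; simp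
    · simp [h]
  have e3 : pb (der (chr g (q z) (fderiv ℝ q z u)) (a (q z))) (fderiv ℝ q z) v
      = ∑ i, a (q z) (Function.update (fun j ↦ fderiv ℝ q z (v j)) i
        (chr g (q z) (fderiv ℝ q z u) (fderiv ℝ q z (v i)))) := by
    rw [pb_apply, der_apply]
  change pb (fderiv ℝ a (q z) (fderiv ℝ q z u)) (fderiv ℝ q z) v
    + (ContinuousAlternatingMap.fderivCompContinuousLinearMap (a (q z)) (fderiv ℝ q z)
      (fderiv ℝ (fderiv ℝ q) z u)) v - der (chr g' z u) (pb (a (q z)) (fderiv ℝ q z)) v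
    = pb (fderiv ℝ a (q z) (fderiv ℝ q z u)) (fderiv ℝ q z) v - pb (der _ _) _ v
  rw [e3, e2]
  simp only [ContinuousAlternatingMap.map_update_add, Finset.sum_add_distrib]
  rw [← e1]
  ring

end

end

/-! ### Smoothness of contractions, inner products and pairings -/

section

section Families

variable {V W : Type*} [NormedAddCommGroup V] [NormedSpace ℝ V]
  [NormedAddCommGroup W] [NormedSpace ℝ W] {ι : Type*} [Fintype ι]

/-- Contraction with an alternatization `∑ᵢ eⁱ ∧ N(eᵢ)`. For `N = ∇β` this identifies a contraction
with `dβ`. -/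
lemma contr_alternatize {p q : ℕ} (e f : ι → V) (N : V →L[ℝ] Alt V q) (c : Alt V (p + q + 1)) :
    contr e f p (q + 1) (alternatizeUncurryFin N) c
      = ∑ i, contr e f p q (N (e i)) (ins (p + q) (f i) c) := by
  induction q with
  | zero => rw [contr_succ]; simp [ins_alternatize_zero]
  | succ q ih =>
    rw [contr_succ]
    simp only [ins_alternatize, map_sub, sub_apply]
    have ih' := fun (N : V →L[ℝ] Alt V q) (c : Alt V (p + (q + 1))) ↦ ih N c
    simp only [ih']
    rw [Finset.sum_sub_distrib]
    have h1 : ∑ j, ∑ i, contr e f p q ((ins q (e j) ∘L N) (e i))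
          (ins (p + q) (f i) (ins (p + q + 1) (f j) c))
        = - ((q + 1 : ℝ) • ∑ i, contr e f p (q + 1) (N (e i)) (ins (p + q + 1) (f i) c)) := by
      rw [Finset.sum_comm, Finset.smul_sum, ← Finset.sum_neg_distrib]
      refine Finset.sum_congr rfl fun i _ ↦ ?_
      rw [contr_succ, smul_smul, mul_inv_cancel₀ (by positivity), one_smul,
        ← Finset.sum_neg_distrib]
      refine Finset.sum_congr rfl fun j _ ↦ ?_
      rw [ins_ins_swap, map_neg]
      rfl
    refine Eq.trans (congrArg (fun t ↦ _ • (_ - t)) h1) ?_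
    have hS : ∀ S : Alt V p, (((q + 1 : ℕ) : ℝ) + 1)⁻¹ • (S - -(((q : ℝ) + 1) • S)) = S := fun S ↦ by
      have : S - -(((q : ℝ) + 1) • S) = (((q + 1 : ℕ) : ℝ) + 1) • S := by
        push_cast; module
      rw [this, smul_smul, inv_mul_cancel₀ (by positivity), one_smul]
    exact hS _

/-- Interior multiplication commutes with the contraction with a `2`-form. -/
lemma ins_contr_two {p : ℕ} (e f : ι → V) (b : Alt V 2) (a : Alt V (p + 1 + 2)) (v : V) :
    ins p v (contr e f (p + 1) 2 b a) = contr e f p 2 b (ins (p + 2) v a) := by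
  simp only [contr_succ, contr_zero, map_smul, map_sum]
  congr 1
  refine Finset.sum_congr rfl fun i _ ↦ ?_
  congr 1
  refine Finset.sum_congr rfl fun j _ ↦ ?_
  congr 1
  have h1 : ins p v (ins (p + 1) (f j) (ins (p + 2) (f i) a))
      = - ins p (f j) (ins (p + 1) v (ins (p + 2) (f i) a)) := ins_ins_swap _ _ _
  have h2 : ins (p + 1) v (ins (p + 2) (f i) a) = - ins (p + 1) (f i) (ins (p + 2) v a) :=
    ins_ins_swap _ _ _
  refine h1.trans ?_
  rw [h2, map_neg, neg_neg]
  rfl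

lemma hasFDerivAt_clm {A B : Type*} [NormedAddCommGroup A] [NormedSpace ℝ A]
    [NormedAddCommGroup B] [NormedSpace ℝ B] (L : A →L[ℝ] B) {a : W → A} {a' : W →L[ℝ] A} {y : W}
    (ha : HasFDerivAt a a' y) : HasFDerivAt (fun z ↦ L (a z)) (L ∘L a') y :=
  L.hasFDerivAt.comp y ha

lemma hasFDerivAt_eval_zero {b : W → Alt V 0} {b' : W →L[ℝ] Alt V 0} {y : W}
    (hb : HasFDerivAt b b' y) :
    HasFDerivAt (fun z ↦ b z ![]) (ContinuousAlternatingMap.apply ℝ V ℝ ![] ∘L b') y :=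
  (ContinuousAlternatingMap.apply ℝ V ℝ ![]).hasFDerivAt.comp y hb

/-- The Leibniz rule for contractions at a point where the derivative of the family `e` vanishes. -/
lemma exists_hasFDerivAt_contr {p q : ℕ} {e : W → ι → V} (f : ι → V) {y : W}
    (he : ∀ i, HasFDerivAt (fun z ↦ e z i) (0 : W →L[ℝ] V) y)
    {b : W → Alt V q} {a : W → Alt V (p + q)} {b' : W →L[ℝ] Alt V q} {a' : W →L[ℝ] Alt V (p + q)}
    (hb : HasFDerivAt b b' y) (ha : HasFDerivAt a a' y) :
    ∃ L : W →L[ℝ] Alt V p, HasFDerivAt (fun z ↦ contr (e z) f p q (b z) (a z)) L y ∧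
      ∀ u, L u = contr (e y) f p q (b' u) (a y) + contr (e y) f p q (b y) (a' u) := by
  induction q with
  | zero =>
    have ha' : HasFDerivAt (F := Alt V p) a a' y := ha
    have h1 := (hasFDerivAt_eval_zero hb).smul ha'
    simp only [contr_zero]
    refine ⟨_, h1, fun u ↦ ?_⟩
    rw [add_comm]
    rfl
  | succ q ih =>
    have h1 : ∀ i, HasFDerivAt (fun z ↦ ins q (e z i) (b z)) (ins q (e y i) ∘L b') y := fun i ↦ by
      have := (hasFDerivAt_clm (ins q) (he i)).clm_apply hb
      rw [ContinuousLinearMap.comp_zero] at this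
      refine this.congr_fderiv ?_
      ext1 u
      simp
    have h2 : ∀ i, HasFDerivAt (fun z ↦ ins (p + q) (f i) (a z)) (ins (p + q) (f i) ∘L a') y :=
      fun i ↦ hasFDerivAt_clm (ins (p + q) (f i)) ha
    choose L hL hL' using fun i ↦ ih (h1 i) (h2 i)
    refine ⟨(q + 1 : ℝ)⁻¹ • ∑ i, L i, ?_, fun u ↦ ?_⟩
    · simp only [contr_succ]
      have hs := HasFDerivAt.fun_sum (u := Finset.univ) fun i _ ↦ hL i
      exact hs.const_smul (q + 1 : ℝ)⁻¹
    · rw [contr_succ, contr_succ, ← smul_add, ← Finset.sum_add_distrib, smul_apply, sum_apply]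
      exact congrArg _ (Finset.sum_congr rfl fun i _ ↦ hL' i u)

/-- The Leibniz rule for inner products at a point where the derivative of the family `e` vanishes.
-/
lemma exists_hasFDerivAt_inn {p : ℕ} {e : W → ι → V} (f : ι → V) {y : W}
    (he : ∀ i, HasFDerivAt (fun z ↦ e z i) (0 : W →L[ℝ] V) y)
    {b : W → Alt V p} {a : W → Alt V p} {b' : W →L[ℝ] Alt V p} {a' : W →L[ℝ] Alt V p}
    (hb : HasFDerivAt b b' y) (ha : HasFDerivAt a a' y) :
    ∃ L : W →L[ℝ] ℝ, HasFDerivAt (fun z ↦ inn (e z) f p (b z) (a z)) L y ∧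
      ∀ u, L u = inn (e y) f p (b' u) (a y) + inn (e y) f p (b y) (a' u) := by
  induction p with
  | zero =>
    have h1 := (hasFDerivAt_eval_zero hb).mul (hasFDerivAt_eval_zero ha)
    simp only [inn_zero]
    refine ⟨_, h1, fun u ↦ ?_⟩
    rw [add_comm, mul_comm (b' u ![])]
    rfl
  | succ p ih =>
    have h1 : ∀ i, HasFDerivAt (fun z ↦ ins p (e z i) (b z)) (ins p (e y i) ∘L b') y := fun i ↦ by
      have := (hasFDerivAt_clm (ins p) (he i)).clm_apply hb
      rw [ContinuousLinearMap.comp_zero] at this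
      refine this.congr_fderiv ?_
      ext1 u
      simp
    have h2 : ∀ i, HasFDerivAt (fun z ↦ ins p (f i) (a z)) (ins p (f i) ∘L a') y :=
      fun i ↦ hasFDerivAt_clm (ins p (f i)) ha
    choose L hL hL' using fun i ↦ ih (h1 i) (h2 i)
    refine ⟨(p + 1 : ℝ)⁻¹ • ∑ i, L i, ?_, fun u ↦ ?_⟩
    · simp only [inn_succ]
      have hs := HasFDerivAt.fun_sum (u := Finset.univ) fun i _ ↦ hL i
      exact hs.const_mul (p + 1 : ℝ)⁻¹
    · rw [inn_succ, inn_succ, ← mul_add, ← Finset.sum_add_distrib, smul_apply, sum_apply]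
      exact congrArg _ (Finset.sum_congr rfl fun i _ ↦ hL' i u)

lemma contDiffOn_contr {p q : ℕ} {e : W → ι → V} (f : ι → V) {O : Set W}
    (he : ∀ i, ContDiffOn ℝ ∞ (fun z ↦ e z i) O)
    {b : W → Alt V q} {a : W → Alt V (p + q)} (hb : ContDiffOn ℝ ∞ b O)
    (ha : ContDiffOn ℝ ∞ a O) :
    ContDiffOn ℝ ∞ (fun z ↦ contr (e z) f p q (b z) (a z)) O := by
  induction q with
  | zero =>
    simp only [contr_zero]
    exact ((ContinuousAlternatingMap.apply ℝ V ℝ ![]).contDiff.comp_contDiffOn hb).smul ha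
  | succ q ih =>
    simp only [contr_succ]
    refine (ContDiffOn.sum fun i _ ↦ ih ?_ ?_).const_smul _
    · exact ((ins q).contDiff.comp_contDiffOn (he i)).clm_apply hb
    · exact (ins (p + q) (f i)).contDiff.comp_contDiffOn ha

lemma contDiffOn_inn {p : ℕ} {e : W → ι → V} (f : ι → V) {O : Set W}
    (he : ∀ i, ContDiffOn ℝ ∞ (fun z ↦ e z i) O)
    {b a : W → Alt V p} (hb : ContDiffOn ℝ ∞ b O) (ha : ContDiffOn ℝ ∞ a O) :
    ContDiffOn ℝ ∞ (fun z ↦ inn (e z) f p (b z) (a z)) O := by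
  induction p with
  | zero =>
    simp only [inn_zero]
    exact ((ContinuousAlternatingMap.apply ℝ V ℝ ![]).contDiff.comp_contDiffOn hb).mul
      ((ContinuousAlternatingMap.apply ℝ V ℝ ![]).contDiff.comp_contDiffOn ha)
  | succ p ih =>
    simp only [inn_succ]
    refine contDiffOn_const.mul (ContDiffOn.sum fun i _ ↦ ih ?_ ?_)
    · exact ((ins p).contDiff.comp_contDiffOn (he i)).clm_apply hb
    · exact (ins p (f i)).contDiff.comp_contDiffOn ha

/-- The `1`-form given by a covector. -/
def toOne : (V →L[ℝ] ℝ) →L[ℝ] Alt V 1 :=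
  (ext 0).flip (ContinuousAlternatingMap.constOfIsEmpty ℝ V (Fin 0) 1)

lemma ins_toOne (θ : V →L[ℝ] ℝ) (v : V) :
    ins 0 v (toOne θ) = θ v • ContinuousAlternatingMap.constOfIsEmpty ℝ V (Fin 0) 1 :=
  ins_ext_zero θ v _

lemma toOne_apply (θ : V →L[ℝ] ℝ) (v : Fin 1 → V) : toOne θ v = θ (v 0) := by
  change ext 0 θ _ v = _
  simp [ext_apply]

/-- The `1`-form `u ↦ ⟨a, ι_u c⟩`. -/
def pairing (e f : ι → V) {p : ℕ} (a : Alt V p) (c : Alt V (p + 1)) : Alt V 1 :=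
  toOne ((inn e f p a) ∘L (ins p).flip c)

lemma ins_pairing (e f : ι → V) {p : ℕ} (a : Alt V p) (c : Alt V (p + 1)) (u : V) :
    ins 0 u (pairing e f a c)
      = inn e f p a (ins p u c) • ContinuousAlternatingMap.constOfIsEmpty ℝ V (Fin 0) 1 :=
  ins_toOne _ _

end Families

end

/-! ### The codifferential in coordinates, and normal coordinates -/

section

variable {V : Type*} [NormedAddCommGroup V] [NormedSpace ℝ V] {ι : Type*} [Fintype ι]
  [DecidableEq ι] {s : ι → V} {σ : ι → V →L[ℝ] ℝ} {g : V → Bil V} {O : Set V} {y : V}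

/-- The frame `sharp (σ i)`, which is dual to `s` with respect to the metric: the `gⁱʲ sⱼ` if `σ` is
the dual basis of `s`. No orthonormal frame needs to be chosen, and this one is as smooth as the
metric. -/
abbrev frame (g : V → Bil V) (σ : ι → V →L[ℝ] ℝ) (z : V) (i : ι) : V := sharp (g z) (σ i)

/-- The codifferential `- ∑ᵢ ι(σᵢ♯) ∇_{sᵢ} a = - ∑ gⁱʲ ι(sⱼ) ∇_{sᵢ} a` of a field of forms. -/
def codiffOn (g : V → Bil V) (s : ι → V) (σ : ι → V →L[ℝ] ℝ) {p : ℕ} (a : V → Alt V (p + 1))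
    (y : V) : Alt V p :=
  - ∑ i, ins p (frame g σ y i) (cov g a y (s i))

variable (s σ g O y) in
/-- The coordinates are normal for the metric `g` at the point `y`: the basis `s` is orthonormal at
`y`, and the first derivatives of the metric vanish at `y`. -/
structure IsNormalAt : Prop extends IsMetricOn g O, DualBases s σ where
  mem : y ∈ O
  orth : ∀ i, g y (s i) = σ i
  flat : fderiv ℝ g y = 0

lemma DualBases.pairing_eq (h : DualBases s σ) (e : ι → V) {p : ℕ} (a : Alt V p)
    (c : Alt V (p + 1)) :
    pairing e s a c = ∑ i, (inn e s p a (ins p (s i) c)) • toOne (σ i) := by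
  rw [pairing]
  simp only [← map_smul, ← map_sum]
  congr 1
  ext v
  conv_lhs => rw [← h.sum_eq v]
  simp [sum_apply, mul_comm]

section

variable [FiniteDimensional ℝ V]

lemma IsMetricOn.contDiffOn_frame (h : IsMetricOn g O) (i : ι) :
    ContDiffOn ℝ ∞ (fun z ↦ frame g σ z i) O :=
  h.contDiffOn_sharp.clm_apply contDiffOn_const

lemma IsMetricOn.contDiffOn_codiffOn (h : IsMetricOn g O) {p : ℕ} {a : V → Alt V (p + 1)}
    (ha : ContDiffOn ℝ ∞ a O) : ContDiffOn ℝ ∞ (codiffOn g s σ a) O := by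
  refine (ContDiffOn.sum fun i _ ↦ ?_).neg
  exact ((ins p).contDiff.comp_contDiffOn (h.contDiffOn_frame i)).clm_apply
    ((h.contDiffOn_cov ha).clm_apply contDiffOn_const)

lemma IsMetricOn.contDiffOn_pairing (h : IsMetricOn g O) (hs : DualBases s σ) {p : ℕ}
    {a : V → Alt V p} {c : V → Alt V (p + 1)} (ha : ContDiffOn ℝ ∞ a O) (hc : ContDiffOn ℝ ∞ c O) :
    ContDiffOn ℝ ∞ (fun z ↦ pairing (frame g σ z) s (a z) (c z)) O := by
  simp only [hs.pairing_eq]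
  refine ContDiffOn.sum fun i _ ↦ ?_
  have h1 := contDiffOn_inn s (h.contDiffOn_frame (σ := σ)) ha
    ((ins p (s i)).contDiff.comp_contDiffOn hc)
  exact h1.smul (contDiffOn_const (c := toOne (σ i)))

end

namespace IsNormalAt

variable (h : IsNormalAt s σ g O y)

include h

lemma mem_nhds : O ∈ 𝓝 y := h.isOpen.mem_nhds h.mem

lemma chr_eq_zero : chr g y = 0 := by
  have : koszul (0 : V →L[ℝ] Bil V) = 0 := by
    ext u v w; rw [koszul_apply]; simp
  rw [chr, h.flat, this, ContinuousLinearMap.comp_zero]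

lemma cov_eq {p : ℕ} (a : V → Alt V p) : cov g a y = fderiv ℝ a y := by
  rw [cov, h.chr_eq_zero, ContinuousLinearMap.comp_zero, sub_zero]

variable [FiniteDimensional ℝ V]

lemma frame_eq : frame g σ y = s := by
  funext i
  rw [frame, ← h.orth, (h.inner y h.mem).sharp_apply]

lemma hasFDerivAt_frame (i : ι) : HasFDerivAt (fun z ↦ frame g σ z i) (0 : V →L[ℝ] V) y := by
  obtain ⟨e, he⟩ := (h.inner y h.mem).isInvertible
  have h1 : DifferentiableAt ℝ ContinuousLinearMap.inverse (g y) := by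
    rw [← he]; exact (contDiffAt_map_inverse e (n := 1)).differentiableAt (by simp)
  have h2 := h1.hasFDerivAt.comp y (h.differentiableAt h.mem).hasFDerivAt
  rw [h.flat, ContinuousLinearMap.comp_zero] at h2
  have h3 := h2.clm_apply (hasFDerivAt_const (σ i) y)
  refine h3.congr_fderiv ?_
  ext1 u
  simp

lemma codiffOn_eq {p : ℕ} (a : V → Alt V (p + 1)) :
    codiffOn g s σ a y = - ∑ i, ins p (s i) (fderiv ℝ a y (s i)) := by
  rw [codiffOn, h.frame_eq, h.cov_eq]

lemma extDeriv_eq' {p : ℕ} (a : V → Alt V p) :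
    extDeriv a y = ∑ i, ext p (σ i) (fderiv ℝ a y (s i)) :=
  h.alternatize _

lemma cov_wedge {p q : ℕ} {b : V → Alt V q} {a : V → Alt V p} (hb : DifferentiableAt ℝ b y)
    (ha : DifferentiableAt ℝ a y) (u : V) :
    cov g (fun z ↦ wedge p q (b z) (a z)) y u
      = wedge p q (cov g b y u) (a y) + wedge p q (b y) (cov g a y u) := by
  have := ((hasFDerivAt_clm (wedge p q) hb.hasFDerivAt).clm_apply ha.hasFDerivAt).fderiv
  rw [h.cov_eq, h.cov_eq, h.cov_eq, this]
  exact add_comm _ _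

lemma cov_contr {p q : ℕ} {b : V → Alt V q} {a : V → Alt V (p + q)} (hb : DifferentiableAt ℝ b y)
    (ha : DifferentiableAt ℝ a y) (u : V) :
    cov g (fun z ↦ contr (frame g σ z) s p q (b z) (a z)) y u
      = contr s s p q (cov g b y u) (a y) + contr s s p q (b y) (cov g a y u) := by
  obtain ⟨L, hL, hL'⟩ := exists_hasFDerivAt_contr (e := frame g σ) s h.hasFDerivAt_frame hb.hasFDerivAt
    ha.hasFDerivAt
  rw [h.cov_eq, h.cov_eq, h.cov_eq, hL.fderiv, hL', h.frame_eq]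

/-- At the centre of normal coordinates, `d* ⟨a, ι c⟩ = ⟨a, d* c⟩ - ⟨da, c⟩` (as a constant form in
degree `0`). -/
lemma codiffOn_pairing {p : ℕ} {a : V → Alt V p} {c : V → Alt V (p + 1)}
    (ha : DifferentiableAt ℝ a y) (hc : DifferentiableAt ℝ c y) :
    codiffOn g s σ (fun z ↦ pairing (frame g σ z) s (a z) (c z)) y
      = (inn s s p (a y) (codiffOn g s σ c y) - inn s s (p + 1) (extDeriv a y) (c y)) •
        ContinuousAlternatingMap.constOfIsEmpty ℝ V (Fin 0) 1 := by
  choose L hL hL' using fun i ↦ exists_hasFDerivAt_inn (e := frame g σ) s h.hasFDerivAt_frame ha.hasFDerivAt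
    (hasFDerivAt_clm (ins p (s i)) hc.hasFDerivAt)
  have h1 : HasFDerivAt (fun z ↦ pairing (frame g σ z) s (a z) (c z))
      (∑ i, (L i).smulRight (toOne (σ i))) y := by
    simp only [h.pairing_eq]
    exact HasFDerivAt.fun_sum fun i _ ↦ (hL i).smul_const _
  rw [h.codiffOn_eq, h1.fderiv, h.codiffOn_eq]
  have h2 : ∀ i, ins 0 (s i) ((∑ j, (L j).smulRight (toOne (σ j))) (s i))
      = (L i (s i)) • ContinuousAlternatingMap.constOfIsEmpty ℝ V (Fin 0) 1 := fun i ↦ by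
    rw [sum_apply, map_sum]
    simp [ins_toOne, h.dual]
  simp only [h2]
  rw [← Finset.sum_smul, ← neg_smul]
  congr 1
  simp only [hL', h.frame_eq, Finset.sum_add_distrib]
  rw [extDeriv, inn_alternatize, map_neg, map_sum]
  simp only [ContinuousLinearMap.comp_apply]
  ring

/-- At the centre of normal coordinates, `d* (C_b a) = C_b (d* a) - C_{db} a` for a `2`-form `b`. -/
lemma codiffOn_contr_two {p : ℕ} {b : V → Alt V 2} {a : V → Alt V (p + 3)}
    (hb : DifferentiableAt ℝ b y) (ha : DifferentiableAt ℝ a y) :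
    codiffOn g s σ (fun z ↦ contr (frame g σ z) s (p + 1) 2 (b z) (a z)) y
      = contr s s p 2 (b y) (codiffOn g s σ a y) - contr s s p 3 (extDeriv b y) (a y) := by
  obtain ⟨L, hL, hL'⟩ := exists_hasFDerivAt_contr (p := p + 1) (e := frame g σ) s h.hasFDerivAt_frame hb.hasFDerivAt
    (a := a) ha.hasFDerivAt
  rw [h.codiffOn_eq, hL.fderiv, h.codiffOn_eq, extDeriv]
  refine Eq.trans ?_ (congrArg (fun t ↦ _ - t) (contr_alternatize (p := p) (q := 2) s s
    (fderiv ℝ b y) (a y)).symm)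
  simp only [hL', map_add, ins_contr_two, h.frame_eq, Finset.sum_add_distrib]
  rw [map_neg, map_sum]
  abel

lemma differentiableAt_chr : DifferentiableAt ℝ (chr g) y :=
  (h.contDiffOn_chr.contDiffAt h.mem_nhds).differentiableAt (by simp)

lemma hasFDerivAt_chr (v : V) :
    HasFDerivAt (fun z ↦ chr g z v) ((fderiv ℝ (chr g) y).flip v) y := by
  refine (h.differentiableAt_chr.hasFDerivAt.clm_apply (hasFDerivAt_const v y)).congr_fderiv ?_
  ext1 u
  simp

lemma hasFDerivAt_chr_apply (v w : V) :
    HasFDerivAt (fun z ↦ chr g z v w) (((fderiv ℝ (chr g) y).flip v).flip w) y := by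
  refine ((h.hasFDerivAt_chr v).clm_apply (hasFDerivAt_const w y)).congr_fderiv ?_
  ext1 u
  simp

/-- At the centre of normal coordinates only the derivative of the Christoffel symbols enters the
second covariant derivative, since the symbols themselves vanish there. -/
lemma fderiv_cov {p : ℕ} {a : V → Alt V p} (ha : ContDiffOn ℝ ∞ a O) (u v : V) :
    fderiv ℝ (fun z ↦ cov g a z v) y u
      = fderiv ℝ (fderiv ℝ a) y u v - der (fderiv ℝ (chr g) y u v) (a y) := by
  let L : Alt V p →L[ℝ] (V →L[ℝ] V) →L[ℝ] Alt V p :=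
    ContinuousAlternatingMap.fderivCompContinuousLinearMapCLM ℝ (ContinuousLinearMap.id ℝ V)
  have hay := ha.contDiffAt h.mem_nhds
  have hD2 : DifferentiableAt ℝ (fderiv ℝ a) y :=
    (hay.fderiv_right (m := 1) two_le_infty).differentiableAt (by simp)
  have h1 : HasFDerivAt (fun z ↦ fderiv ℝ a z v) ((fderiv ℝ (fderiv ℝ a) y).flip v) y := by
    refine (hD2.hasFDerivAt.clm_apply (hasFDerivAt_const v y)).congr_fderiv ?_
    ext1 u
    simp
  have h2 := (hasFDerivAt_clm L (hay.differentiableAt (by simp)).hasFDerivAt).clm_apply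
    (h.hasFDerivAt_chr v)
  rw [h.chr_eq_zero] at h2
  have h3 : HasFDerivAt (fun z ↦ cov g a z v) _ y := h1.sub h2
  rw [h3.fderiv]
  change fderiv ℝ (fderiv ℝ a) y u v - (der (fderiv ℝ (chr g) y u v) (a y)
    + L (fderiv ℝ a y u) ((0 : V →L[ℝ] V →L[ℝ] V) v)) = _
  rw [zero_apply, map_zero, add_zero]

/-- The Ricci identity. -/
lemma fderiv_cov_comm {p : ℕ} {a : V → Alt V p} (ha : ContDiffOn ℝ ∞ a O) (u v : V) :
    fderiv ℝ (fun z ↦ cov g a z v) y u = fderiv ℝ (fun z ↦ cov g a z u) y v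
      - der (fderiv ℝ (chr g) y u v - fderiv ℝ (chr g) y v u) (a y) := by
  have hsymm : fderiv ℝ (fderiv ℝ a) y u v = fderiv ℝ (fderiv ℝ a) y v u :=
    (ha.contDiffAt h.mem_nhds).isSymmSndFDerivAt (by simpa [one_add_one_eq_two] using two_le_infty)
      u v
  rw [h.fderiv_cov ha, h.fderiv_cov ha, hsymm, der, der, der, map_sub]
  abel

/-- The curvature at the centre of normal coordinates is `R(u, v) = ∂_u Γ_v - ∂_v Γ_u`, and it
annihilates parallel forms. -/
lemma isCurvature {φ : V → Alt V 3} (hφ : ContDiffOn ℝ ∞ φ O) (hpar : ∀ z ∈ O, cov g φ z = 0) :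
    IsCurvature σ s (φ y)
      (fun u v ↦ fderiv ℝ (chr g) y u v - fderiv ℝ (chr g) y v u) where
  swap u v := by abel
  bianchi u v w := by
    have hs : ∀ u v w, fderiv ℝ (chr g) y u v w = fderiv ℝ (chr g) y u w v := fun u v w ↦ by
      have h1 := h.hasFDerivAt_chr_apply v w
      have h2 := (h.hasFDerivAt_chr_apply w v).congr_of_eventuallyEq
        (Filter.eventually_of_mem h.mem_nhds fun z hz ↦ h.chr_symm hz v w)
      exact congrArg (fun t : V →L[ℝ] V ↦ t u) (h1.unique h2)
    simp only [sub_apply]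
    rw [hs u w v, hs v w u, hs w v u]
    abel
  annih u v := by
    have h0 : ∀ v, fderiv ℝ (fun z ↦ cov g φ z v) y = 0 := fun v ↦ by
      have : (fun z ↦ cov g φ z v) =ᶠ[𝓝 y] fun _ ↦ 0 :=
        Filter.eventually_of_mem h.mem_nhds fun z hz ↦ by
          change cov g φ z v = 0
          rw [hpar z hz]; rfl
      rw [this.fderiv_eq]
      exact (hasFDerivAt_const _ _).fderiv
    have := h.fderiv_cov_comm hφ u v
    rw [h0, h0, zero_apply] at this
    change 0 = 0 - der _ _ at this
    rw [zero_sub, eq_comm, neg_eq_zero] at this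
    exact this
  skew u v k l := by
    have hD2 : DifferentiableAt ℝ (fderiv ℝ g) y :=
      ((h.contDiffAt h.mem).fderiv_right (m := 1) two_le_infty).differentiableAt (by simp)
    have hsymm : ∀ u v, fderiv ℝ (fderiv ℝ g) y u v = fderiv ℝ (fderiv ℝ g) y v u :=
      (h.contDiffAt h.mem).isSymmSndFDerivAt (by simpa [one_add_one_eq_two] using two_le_infty)
    -- differentiate the compatibility of the connection with the metric, and antisymmetrize in `u`
    -- and `v`
    have key : ∀ u v w w', fderiv ℝ (fderiv ℝ g) y u v w w'
        = g y (fderiv ℝ (chr g) y u v w) w' + g y w (fderiv ℝ (chr g) y u v w') := by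
      intro u v w w'
      have h1 : HasFDerivAt (fun z ↦ fderiv ℝ g z v) ((fderiv ℝ (fderiv ℝ g) y).flip v) y := by
        refine (hD2.hasFDerivAt.clm_apply (hasFDerivAt_const v y)).congr_fderiv ?_
        ext1 u
        simp
      have h2 := fderiv_bil_apply h1.differentiableAt u w w'
      rw [h1.fderiv] at h2
      have h3 : (fun z ↦ fderiv ℝ g z v w w')
          =ᶠ[𝓝 y] fun z ↦ g z (chr g z v w) w' + g z w (chr g z v w') :=
        Filter.eventually_of_mem h.mem_nhds fun z hz ↦ h.fderiv_eq hz v w w'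
      have hg := (h.differentiableAt h.mem).hasFDerivAt
      have d1 := (hg.clm_apply (h.hasFDerivAt_chr_apply v w)).clm_apply (hasFDerivAt_const w' y)
      have d2 := (hg.clm_apply (hasFDerivAt_const w y)).clm_apply (h.hasFDerivAt_chr_apply v w')
      have e1 := hasFDerivAt_bil_apply hg (h.hasFDerivAt_chr_apply v w) (hasFDerivAt_const w' y) u
      have e2 := hasFDerivAt_bil_apply hg (hasFDerivAt_const w y) (h.hasFDerivAt_chr_apply v w') u
      rw [h3.fderiv_eq, fderiv_fun_add d1.differentiableAt d2.differentiableAt, add_apply, e1, e2,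
        h.flat, h.chr_eq_zero] at h2
      simpa using h2.symm
    have k1 := key u v (s l) (s k)
    have k2 := key v u (s l) (s k)
    rw [hsymm v u] at k2
    rw [← h.orth, ← h.orth, (h.inner y h.mem).symm (s k)]
    simp only [sub_apply, map_sub]
    linarith

lemma hasFDerivAt_cov {p : ℕ} {a : V → Alt V p} (ha : ContDiffOn ℝ ∞ a O) (v : V) :
    HasFDerivAt (fun z ↦ cov g a z v) (fderiv ℝ (fun z ↦ cov g a z v) y) y :=
  DifferentiableAt.hasFDerivAt <|
    (((h.contDiffOn_cov ha).clm_apply contDiffOn_const).contDiffAt h.mem_nhds).differentiableAt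
      (by simp)

lemma hasFDerivAt_ins_frame {p : ℕ} {c : V → Alt V (p + 1)} {c' : V →L[ℝ] Alt V (p + 1)}
    (hc : HasFDerivAt c c' y) (i : ι) :
    HasFDerivAt (fun z ↦ ins p (frame g σ z i) (c z)) (ins p (s i) ∘L c') y := by
  have := (hasFDerivAt_clm (ins p) (h.hasFDerivAt_frame i)).clm_apply hc
  rw [ContinuousLinearMap.comp_zero, h.frame_eq] at this
  refine this.congr_fderiv ?_
  ext1 u
  simp

/-- The covariant derivative of the equation `dα = 0`. -/
lemma sum_ext_fderiv_cov {p : ℕ} {α : V → Alt V p} (hα : ContDiffOn ℝ ∞ α O)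
    (hd : ∀ z ∈ O, extDeriv α z = 0) (u : V) :
    ∑ i, ext p (σ i) (fderiv ℝ (fun z ↦ cov g α z (s i)) y u) = 0 := by
  have h1 : HasFDerivAt (fun z ↦ ∑ i, ext p (σ i) (cov g α z (s i)))
      (∑ i, ext p (σ i) ∘L fderiv ℝ (fun z ↦ cov g α z (s i)) y) y :=
    HasFDerivAt.fun_sum fun i _ ↦ hasFDerivAt_clm _ (h.hasFDerivAt_cov hα (s i))
  have h2 : (fun z ↦ ∑ i, ext p (σ i) (cov g α z (s i))) =ᶠ[𝓝 y] fun _ ↦ 0 :=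
    Filter.eventually_of_mem h.mem_nhds fun z hz ↦ by
      have := h.extDeriv_eq α hz
      rw [hd z hz, h.alternatize] at this
      exact this.symm
  have h3 := congrArg (fun t : V →L[ℝ] _ ↦ t u)
    (h1.unique ((hasFDerivAt_const (0 : Alt V (p + 1)) y).congr_of_eventuallyEq h2))
  simpa [sum_apply] using h3

/-- The covariant derivative of the equation `d* α = 0`. -/
lemma sum_ins_fderiv_cov {p : ℕ} {α : V → Alt V (p + 1)} (hα : ContDiffOn ℝ ∞ α O)
    (hδ : ∀ z ∈ O, codiffOn g s σ α z = 0) (u : V) :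
    ∑ i, ins p (s i) (fderiv ℝ (fun z ↦ cov g α z (s i)) y u) = 0 := by
  have h1 : HasFDerivAt (fun z ↦ ∑ i, ins p (frame g σ z i) (cov g α z (s i)))
      (∑ i, ins p (s i) ∘L fderiv ℝ (fun z ↦ cov g α z (s i)) y) y :=
    HasFDerivAt.fun_sum fun i _ ↦ h.hasFDerivAt_ins_frame (h.hasFDerivAt_cov hα (s i)) i
  have h2 : (fun z ↦ ∑ i, ins p (frame g σ z i) (cov g α z (s i))) =ᶠ[𝓝 y] fun _ ↦ 0 :=
    Filter.eventually_of_mem h.mem_nhds fun z hz ↦ neg_eq_zero.1 (hδ z hz)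
  have h3 := congrArg (fun t : V →L[ℝ] _ ↦ t u)
    (h1.unique ((hasFDerivAt_const (0 : Alt V p) y).congr_of_eventuallyEq h2))
  simpa [sum_apply] using h3

lemma hasFDerivAt_of_parallel {q : ℕ} {φ : V → Alt V q} (hφ : ContDiffOn ℝ ∞ φ O)
    (hpar : ∀ z ∈ O, cov g φ z = 0) : HasFDerivAt φ (0 : V →L[ℝ] Alt V q) y := by
  rw [← hpar y h.mem, h.cov_eq]
  exact ((hφ.contDiffAt h.mem_nhds).differentiableAt (by simp)).hasFDerivAt

/-- If `α` is closed and coclosed and `φ` is parallel, then `d d* (φ ∧ α) = 0` at the centre of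
normal coordinates. The first derivatives of `φ` drop out of `d* (φ ∧ α)` by `hcov`, and what
remains is the algebraic identity `IsCurvature.sum_ext_ins_wedge`. -/
lemma extDeriv_codiffOn_wedge {φ : V → Alt V 3} (hφ : ContDiffOn ℝ ∞ φ O)
    (hpar : ∀ z ∈ O, cov g φ z = 0) {p : ℕ} {α : V → Alt V p} (hα : ContDiffOn ℝ ∞ α O)
    (hcov : ∀ z ∈ O, ∀ u, cov g (fun z ↦ wedge p 3 (φ z) (α z)) z u
      = wedge p 3 (φ z) (cov g α z u))
    (hd : ∀ z ∈ O, extDeriv α z = 0)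
    (hδ : ∀ z ∈ O, ∑ i, insOp (frame g σ z i) (Pi.single p (cov g α z (s i))) = 0) :
    extDeriv (codiffOn g s σ (p := p + 2) fun z ↦ wedge p 3 (φ z) (α z)) y = 0 := by
  have hφ' := h.hasFDerivAt_of_parallel hφ hpar
  have h1 : HasFDerivAt (fun z ↦ - ∑ i, ins (p + 2) (frame g σ z i)
      (wedge p 3 (φ z) (cov g α z (s i))))
      (- ∑ i, ins (p + 2) (s i) ∘L wedge p 3 (φ y) ∘L fderiv ℝ (fun z ↦ cov g α z (s i)) y) y := by
    refine (HasFDerivAt.fun_sum fun i _ ↦ h.hasFDerivAt_ins_frame (p := p + 2) ?_ i).neg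
    refine ((hasFDerivAt_clm (wedge p 3) hφ').clm_apply
      (h.hasFDerivAt_cov hα (s i))).congr_fderiv ?_
    ext1 u
    simp
  have h2 : codiffOn g s σ (p := p + 2) (fun z ↦ wedge p 3 (φ z) (α z))
      =ᶠ[𝓝 y] (fun z ↦ - ∑ i, ins (p + 2) (frame g σ z i)
      (wedge p 3 (φ z) (cov g α z (s i)))) :=
    Filter.eventually_of_mem h.mem_nhds fun z hz ↦ by
      rw [codiffOn]
      refine congrArg _ (Finset.sum_congr rfl fun i _ ↦ ?_)
      exact congrArg _ (hcov z hz (s i))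
  have key := (h.isCurvature hφ hpar).sum_ext_ins_wedge h.toDualBases (α := α y)
    (A := fun j i ↦ fderiv ℝ (fun z ↦ cov g α z (s i)) y (s j))
    (fun j i ↦ h.fderiv_cov_comm hα (s j) (s i)) (fun j ↦ h.sum_ext_fderiv_cov hα hd (s j))
    (fun j ↦ by
      cases p with
      | zero => simp [insOp_single_zero]
      | succ p =>
        simp only [insOp_single, ← single_sum] at hδ ⊢
        rw [h.sum_ins_fderiv_cov hα (fun z hz ↦ by
          rw [codiffOn, single_injective' (hδ z hz), neg_zero]), Pi.single_zero])
  rw [h.extDeriv_eq', h2.fderiv_eq, h1.fderiv]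
  simp only [neg_apply, sum_apply, ContinuousLinearMap.comp_apply, map_neg, map_sum,
    Finset.sum_neg_distrib]
  rw [key, neg_zero]

/-- If `α` is closed and coclosed and `φ` is parallel, then `d* d` of the contraction of `α` with
`φ` vanishes at the centre of normal coordinates, by `IsCurvature.sum_ins_ext_contr`. -/
lemma codiffOn_extDeriv_contr {φ : V → Alt V 3} (hφ : ContDiffOn ℝ ∞ φ O)
    (hpar : ∀ z ∈ O, cov g φ z = 0) {p : ℕ} {α : V → Alt V (p + 3)} (hα : ContDiffOn ℝ ∞ α O)
    (hcov : ∀ z ∈ O, ∀ u, cov g (fun z ↦ contr (frame g σ z) s p 3 (φ z) (α z)) z u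
      = contr (frame g σ z) s p 3 (φ z) (cov g α z u))
    (hd : ∀ z ∈ O, extDeriv α z = 0) (hδ : ∀ z ∈ O, codiffOn g s σ (p := p + 2) α z = 0) :
    codiffOn g s σ (extDeriv fun z ↦ contr (frame g σ z) s p 3 (φ z) (α z)) y = 0 := by
  have hφ' := h.hasFDerivAt_of_parallel hφ hpar
  have h1 : HasFDerivAt (fun z ↦ ∑ i, ext p (σ i)
      (contr (frame g σ z) s p 3 (φ z) (cov g α z (s i))))
      (∑ i, ext p (σ i) ∘L contr s s p 3 (φ y) ∘L fderiv ℝ (fun z ↦ cov g α z (s i)) y) y := by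
    refine HasFDerivAt.fun_sum fun i _ ↦ hasFDerivAt_clm (ext p (σ i)) ?_
    obtain ⟨L, hL, hL'⟩ := exists_hasFDerivAt_contr (e := frame g σ) s h.hasFDerivAt_frame hφ'
      (h.hasFDerivAt_cov hα (s i))
    refine hL.congr_fderiv ?_
    ext1 u
    rw [hL', h.frame_eq]
    simp
  have h2 : extDeriv (fun z ↦ contr (frame g σ z) s p 3 (φ z) (α z))
      =ᶠ[𝓝 y] (fun z ↦ ∑ i, ext p (σ i)
      (contr (frame g σ z) s p 3 (φ z) (cov g α z (s i)))) :=
    Filter.eventually_of_mem h.mem_nhds fun z hz ↦ by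
      rw [h.extDeriv_eq _ hz, h.alternatize]
      refine Finset.sum_congr rfl fun i _ ↦ ?_
      rw [hcov z hz (s i)]
  have key := (h.isCurvature hφ hpar).sum_ins_ext_contr h.toDualBases (α := α y)
    (A := fun j i ↦ fderiv ℝ (fun z ↦ cov g α z (s i)) y (s j))
    (fun j i ↦ h.fderiv_cov_comm hα (s j) (s i)) (fun j ↦ h.sum_ext_fderiv_cov hα hd (s j))
    (fun j ↦ h.sum_ins_fderiv_cov (p := p + 2) hα hδ (s j))
  rw [h.codiffOn_eq, h2.fderiv_eq, h1.fderiv]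
  simp only [sum_apply, ContinuousLinearMap.comp_apply, map_sum]
  rw [key, neg_zero]

end IsNormalAt

end

/-! ### Parametrizations of a manifold and pullbacks of differential forms -/

section

open RiemForm Bundle

section Smooth

variable {V W U : Type*} [NormedAddCommGroup V] [NormedSpace ℝ V] [NormedAddCommGroup W]
  [NormedSpace ℝ W] [NormedAddCommGroup U] [NormedSpace ℝ U]
  {ι : Type*} [Fintype ι] [DecidableEq ι] {s : ι → V} {σ : ι → V →L[ℝ] ℝ}

lemma DualBases.sum_ext_ins (h : DualBases s σ) {p : ℕ} (a : Alt V (p + 1)) :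
    ∑ k, ext p (σ k) (ins p (s k) a) = (p + 1 : ℝ) • a := by
  have := h.der_succ (ContinuousLinearMap.id ℝ V) a
  simp only [ContinuousLinearMap.id_apply] at this
  rw [← this]
  ext v
  rw [der_apply]
  simp

/-- Smoothness of a pullback `z ↦ M(z)* a(z)`, by induction on the degree. -/
lemma DualBases.contDiffOn_pb (h : DualBases s σ) {p : ℕ} {O : Set U} {a : U → Alt W p}
    {M : U → V →L[ℝ] W} (ha : ContDiffOn ℝ ∞ a O) (hM : ContDiffOn ℝ ∞ M O) :
    ContDiffOn ℝ ∞ (fun z ↦ pb (a z) (M z)) O := by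
  induction p with
  | zero =>
    have : (fun z ↦ pb (a z) (M z)) = fun z ↦ (a z ![]) •
        ContinuousAlternatingMap.constOfIsEmpty ℝ V (Fin 0) (1 : ℝ) := by
      funext z
      ext v
      rw [pb_apply, Subsingleton.elim (fun i ↦ M z (v i)) ![]]
      simp
    rw [this]
    exact ((ContinuousAlternatingMap.apply ℝ W ℝ ![]).contDiff.comp_contDiffOn ha).smul
      (contDiffOn_const (c := ContinuousAlternatingMap.constOfIsEmpty ℝ V (Fin 0) (1 : ℝ)))
  | succ p ih =>
    have : (fun z ↦ pb (a z) (M z)) = fun z ↦ (p + 1 : ℝ)⁻¹ •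
        ∑ k, ext p (σ k) (pb (ins p (M z (s k)) (a z)) (M z)) := by
      funext z
      simp only [← ins_pb]
      rw [h.sum_ext_ins, smul_smul, inv_mul_cancel₀ (by positivity), one_smul]
    rw [this]
    refine (ContDiffOn.sum fun k _ ↦ (ext p (σ k)).contDiff.comp_contDiffOn (ih ?_)).const_smul _
    exact ((ins p).contDiff.comp_contDiffOn (hM.clm_apply contDiffOn_const)).clm_apply ha

end Smooth

section Param

variable {n : ℕ} {X : Type*} [TopologicalSpace X] [ChartedSpace (EucSp n) X]

/-- The derivative of a map from `ℝⁿ` to the manifold. Tangent spaces are identified with `ℝⁿ` by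
definitional unfolding of `TangentSpace`; this keeps all maps in one space, but the inner product of
the tangent space must then be carried along as `metricAt`. -/
def dParam (ψ : EucSp n → X) (z : EucSp n) : EucSp n →L[ℝ] EucSp n :=
  mfderiv (𝓡 n) (𝓡 n) ψ z

/-- A differential form at a point, with the tangent space identified with `ℝⁿ`. -/
def formAt {p : ℕ} (α : DForm n X p) (x : X) : Alt (EucSp n) p := α x

/-- The pullback of a differential form by a parametrization. -/
def pull {p : ℕ} (ψ : EucSp n → X) (α : DForm n X p) (z : EucSp n) : Alt (EucSp n) p :=
  pb (formAt α (ψ z)) (dParam ψ z)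

lemma inChart_eq {p : ℕ} (α : DForm n X p) (x : X) :
    α.inChart x = pull (extChartAt (𝓡 n) x).symm α := rfl

/-- `ψ` is a smooth map from the open set `O` to the manifold, with invertible derivatives.
Injectivity is not required, since only local quantities are computed in a parametrization. -/
structure IsParam (ψ : EucSp n → X) (O : Set (EucSp n)) : Prop where
  isOpen : IsOpen O
  smooth : ContMDiffOn (𝓡 n) (𝓡 n) ∞ ψ O
  inv : ∀ z ∈ O, (dParam ψ z).IsInvertible

variable {ψ : EucSp n → X} {O : Set (EucSp n)}

lemma IsParam.mem_nhds (h : IsParam ψ O) {z : EucSp n} (hz : z ∈ O) : O ∈ 𝓝 z :=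
  h.isOpen.mem_nhds hz

lemma IsParam.mdifferentiableAt (h : IsParam ψ O) {z : EucSp n} (hz : z ∈ O) :
    MDifferentiableAt (𝓡 n) (𝓡 n) ψ z :=
  (h.smooth.contMDiffAt (h.mem_nhds hz)).mdifferentiableAt (by simp)

lemma IsParam.continuousAt (h : IsParam ψ O) {z : EucSp n} (hz : z ∈ O) : ContinuousAt ψ z :=
  (h.smooth.contMDiffAt (h.mem_nhds hz)).continuousAt

variable [IsManifold (𝓡 n) ∞ X]

lemma isParam_chart (x : X) :
    IsParam (n := n) (extChartAt (𝓡 n) x).symm (extChartAt (𝓡 n) x).target := by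
  refine ⟨isOpen_extChartAt_target x, contMDiffOn_extChartAt_symm x, fun z hz ↦ ?_⟩
  have := isInvertible_mfderivWithin_extChartAt_symm (I := 𝓡 n) hz
  rw [ModelWithCorners.range_eq_univ, mfderivWithin_univ] at this
  exact this

/-- The transition map from a parametrization to the preferred chart at `x`. -/
def trans (ψ : EucSp n → X) (x : X) (w : EucSp n) : EucSp n := extChartAt (𝓡 n) x (ψ w)

variable {x : X} {z : EucSp n}

lemma IsParam.contDiffAt_trans (h : IsParam ψ O) (hz : z ∈ O)
    (hx : ψ z ∈ (extChartAt (𝓡 n) x).source) : ContDiffAt ℝ ∞ (trans ψ x) z := by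
  rw [← contMDiffAt_iff_contDiffAt]
  exact ((contMDiffOn_extChartAt (I := 𝓡 n)).contMDiffAt
    ((chartAt _ x).open_source.mem_nhds (by rwa [← extChartAt_source (𝓡 n)]))).comp z
    (h.smooth.contMDiffAt (h.mem_nhds hz))

lemma IsParam.fderiv_trans (h : IsParam ψ O) (hz : z ∈ O)
    (hx : ψ z ∈ (extChartAt (𝓡 n) x).source) (u : EucSp n) :
    fderiv ℝ (trans ψ x) z u
      = (mfderiv (𝓡 n) (𝓡 n) (extChartAt (𝓡 n) x) (ψ z) : EucSp n →L[ℝ] EucSp n) (dParam ψ z u) := by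
  have h1 := mfderiv_comp z (mdifferentiableAt_extChartAt (I := 𝓡 n)
    (by rwa [← extChartAt_source (𝓡 n)])) (h.mdifferentiableAt hz)
  rw [← mfderiv_eq_fderiv]
  exact congrArg (fun t : EucSp n →L[ℝ] EucSp n ↦ t u) h1

lemma IsParam.trans_mem (hx : ψ z ∈ (extChartAt (𝓡 n) x).source) :
    trans ψ x z ∈ (extChartAt (𝓡 n) x).target := (extChartAt (𝓡 n) x).map_source hx

lemma IsParam.isInvertible_trans (h : IsParam ψ O) (hz : z ∈ O)
    (hx : ψ z ∈ (extChartAt (𝓡 n) x).source) : (fderiv ℝ (trans ψ x) z).IsInvertible := by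
  have h1 := isInvertible_mfderiv_extChartAt (I := 𝓡 n) hx
  have h2 : fderiv ℝ (trans ψ x) z
    = (mfderiv (𝓡 n) (𝓡 n) (extChartAt (𝓡 n) x) (ψ z) : EucSp n →L[ℝ] EucSp n) ∘L (dParam ψ z) := by
    ext1 u; exact h.fderiv_trans hz hx u
  rw [h2]
  exact ContinuousLinearMap.IsInvertible.comp h1 (h.inv z hz)

lemma IsParam.dParam_eq (h : IsParam ψ O) (hz : z ∈ O)
    (hx : ψ z ∈ (extChartAt (𝓡 n) x).source) :
    dParam ψ z = dParam (extChartAt (𝓡 n) x).symm (trans ψ x z) ∘L fderiv ℝ (trans ψ x) z := by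
  have hev : ψ =ᶠ[𝓝 z] (extChartAt (𝓡 n) x).symm ∘ trans ψ x := by
    filter_upwards [(h.continuousAt hz).preimage_mem_nhds
      ((isOpen_extChartAt_source x).mem_nhds hx)] with w hw
    exact ((extChartAt (𝓡 n) x).left_inv hw).symm
  have h1 := mfderiv_comp z ((isParam_chart x).mdifferentiableAt (IsParam.trans_mem hx))
    ((h.contDiffAt_trans hz hx).differentiableAt (by simp)).mdifferentiableAt
  rw [mfderiv_eq_fderiv] at h1
  rw [dParam, hev.mfderiv_eq]
  exact h1

lemma IsParam.eventually_mem (h : IsParam ψ O) (hz : z ∈ O)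
    (hx : ψ z ∈ (extChartAt (𝓡 n) x).source) :
    ∀ᶠ w in 𝓝 z, w ∈ O ∧ ψ w ∈ (extChartAt (𝓡 n) x).source :=
  (Filter.eventually_of_mem (h.mem_nhds hz) fun _ hw ↦ hw).and
    ((h.continuousAt hz).preimage_mem_nhds ((isOpen_extChartAt_source x).mem_nhds hx))

/-- The pullback by a parametrization, by way of a chart. -/
lemma IsParam.pull_eq (h : IsParam ψ O) (hz : z ∈ O)
    (hx : ψ z ∈ (extChartAt (𝓡 n) x).source) {p : ℕ} (α : DForm n X p) :
    pull ψ α z = pb (α.inChart x (trans ψ x z)) (fderiv ℝ (trans ψ x) z) := by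
  rw [pull, h.dParam_eq hz hx, inChart_eq, pull, trans, (extChartAt (𝓡 n) x).left_inv hx]
  rfl

end Param

end

/-! ### Metric, covariant derivative and codifferential in a parametrization -/

section

open RiemForm Bundle

section Metric

variable {n : ℕ} {X : Type*} [TopologicalSpace X] [ChartedSpace (EucSp n) X]
  [RiemannianBundle (fun x : X ↦ TangentSpace (𝓡 n) x)]

/-- The inner product on the tangent space at `x`, as a bilinear form on `ℝⁿ`. -/
def metricAt (x : X) : Bil (EucSp n) := innerSL ℝ (E := TangentSpace (𝓡 n) x)

lemma metricAt_apply (x : X) (u v : EucSp n) :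
    metricAt x u v = inner ℝ (show TangentSpace (𝓡 n) x from u) (show TangentSpace (𝓡 n) x from v) :=
  rfl

lemma isInner_metricAt (x : X) : IsInner (metricAt (n := n) x) where
  symm u v := by rw [metricAt_apply, metricAt_apply]; exact real_inner_comm _ _
  pos v hv := by
    rw [metricAt_apply]
    exact real_inner_self_pos.2 hv

/-- The metric in the coordinates given by a parametrization. -/
def pullMetric (ψ : EucSp n → X) (z : EucSp n) : Bil (EucSp n) :=
  (metricAt (ψ z)).bilinearComp (dParam ψ z) (dParam ψ z)

lemma chartMetric_eq (x : X) : chartMetric (n := n) x = pullMetric (extChartAt (𝓡 n) x).symm := rfl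

/-- The orthonormal basis of the tangent space at `x`, as a family of vectors in `ℝⁿ`. -/
def onb (x : X) (i : Fin (Module.finrank ℝ (TangentSpace (𝓡 n) x))) : EucSp n := tangentONB x i

lemma pointInner_eq {p : ℕ} (α β : DForm n X p) (x : X) :
    α.pointInner β x = inn (onb x) (onb x) p (formAt α x) (formAt β x) := by
  rw [inn_eq_sum]; rfl

lemma sum_metricAt_onb (x : X) (v : EucSp n) : ∑ i, metricAt x (onb x i) v • onb x i = v := by
  exact (tangentONB x).sum_repr' (show TangentSpace (𝓡 n) x from v)

end Metric

section

variable {V : Type*} [NormedAddCommGroup V] [NormedSpace ℝ V] [FiniteDimensional ℝ V]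
  {ι κ : Type*} [Fintype ι] [DecidableEq ι] [Fintype κ] {s : ι → V} {σ : ι → V →L[ℝ] ℝ}

omit [FiniteDimensional ℝ V] in
lemma IsInner.bilinearComp {g : Bil V} (hg : IsInner g) {M : V →L[ℝ] V} (hM : M.IsInvertible) :
    IsInner (g.bilinearComp M M) := by
  obtain ⟨e, rfl⟩ := hM
  exact ⟨fun u v ↦ hg.symm (e u) (e v), fun v hv ↦ hg.pos (e v) (by simpa using hv)⟩

/-- The metric tensor on covectors does not depend on the bases: it is `∑ bᵢ ⊗ bᵢ` for an
orthonormal basis `b`, and `∑ σᵢ♯ ⊗ sᵢ` for an arbitrary basis `s` with dual basis `σ`. -/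
lemma IsInner.sameTensor {g : Bil V} (hg : IsInner g) (h : DualBases s σ) {b : κ → V}
    (hb : ∀ v, ∑ i, g (b i) v • b i = v) : SameTensor b b (fun i ↦ sharp g (σ i)) s := by
  intro B
  have h1 : ∀ j, sharp g (σ j) = ∑ i, σ j (b i) • b i := fun j ↦ by
    conv_lhs => rw [← hb (sharp g (σ j))]
    refine Finset.sum_congr rfl fun i _ ↦ ?_
    rw [hg.symm, hg.apply_sharp]
  simp only [h1, map_sum, map_smul, LinearMap.sum_apply, LinearMap.smul_apply]
  rw [Finset.sum_comm]
  refine Finset.sum_congr rfl fun i _ ↦ ?_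
  have := congrArg (fun t ↦ B (b i) t) (h.sum_eq (b i))
  simpa only [map_sum, map_smul] using this.symm

end

section

variable {n : ℕ} {X : Type*} [TopologicalSpace X] [ChartedSpace (EucSp n) X]
  [RiemannianBundle (fun x : X ↦ TangentSpace (𝓡 n) x)] [IsManifold (𝓡 n) ∞ X]
  [IsContMDiffRiemannianBundle (𝓡 n) ∞ (EucSp n) (fun x : X ↦ TangentSpace (𝓡 n) x)]
  {ψ : EucSp n → X} {O : Set (EucSp n)}

lemma IsParam.contDiffOn_pullMetric (h : IsParam ψ O) : ContDiffOn ℝ ∞ (pullMetric ψ) O := by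
  refine contDiffOn_clm_apply.2 fun u ↦ contDiffOn_clm_apply.2 fun v ↦ ?_
  have hsec : ∀ u : EucSp n, ContMDiffOn (𝓡 n) ((𝓡 n).prod 𝓘(ℝ, EucSp n)) ∞
      (fun z ↦ (⟨ψ z, dParam ψ z u⟩ : TotalSpace (EucSp n) (TangentSpace (𝓡 n) : X → Type _))) O := by
    intro u
    have h1 := h.smooth.contMDiffOn_tangentMapWithin (m := ∞) (by simp) h.isOpen.uniqueMDiffOn
    have h2 := (contMDiff_vectorSpace_iff_contDiff (𝕜 := ℝ) (E := EucSp n) (n := ∞)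
      (V := fun _ ↦ u)).2 contDiff_const
    have h3 := h1.comp h2.contMDiffOn (s := O) (fun z hz ↦ hz)
    refine h3.congr fun z hz ↦ ?_
    simp only [Function.comp_apply, tangentMapWithin, mfderivWithin_of_mem_nhds (h.mem_nhds hz)]
    rfl
  rw [← contMDiffOn_iff_contDiffOn]
  exact (hsec u).inner_bundle (hsec v)

lemma IsParam.isMetricOn (h : IsParam ψ O) : IsMetricOn (pullMetric ψ) O where
  isOpen := h.isOpen
  smooth := h.contDiffOn_pullMetric
  inner z hz := (isInner_metricAt (ψ z)).bilinearComp (h.inv z hz)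

variable {x : X} {z : EucSp n}

omit [IsContMDiffRiemannianBundle (𝓡 n) ∞ (EucSp n) (fun x : X ↦ TangentSpace (𝓡 n) x)] in
lemma IsParam.pullMetric_eq (h : IsParam ψ O) (hz : z ∈ O)
    (hx : ψ z ∈ (extChartAt (𝓡 n) x).source) (u v : EucSp n) :
    pullMetric ψ z u v = chartMetric x (trans ψ x z) (fderiv ℝ (trans ψ x) z u)
      (fderiv ℝ (trans ψ x) z v) := by
  rw [pullMetric, h.dParam_eq hz hx, chartMetric_eq, pullMetric]
  have : ψ z = (extChartAt (𝓡 n) x).symm (trans ψ x z) := ((extChartAt (𝓡 n) x).left_inv hx).symm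
  rw [this]
  rfl

/-- The standard basis of `ℝⁿ`. -/
def stdB (n : ℕ) (i : Fin n) : EucSp n := EuclideanSpace.single i 1

/-- The coordinates on `ℝⁿ`. -/
def stdC (n : ℕ) (i : Fin n) : EucSp n →L[ℝ] ℝ := EuclideanSpace.proj i

lemma dualBases_std (n : ℕ) : DualBases (stdB n) (stdC n) where
  dual i j := by simp [stdB, stdC]
  sum_eq v := by
    ext j
    simp [stdB, stdC, Pi.single_apply]

lemma IsParam.contDiffOn_pull (h : IsParam ψ O) {p : ℕ} {α : DForm n X p} (hα : α.IsSmooth) :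
    ContDiffOn ℝ ∞ (pull ψ α) O := by
  intro z hz
  set x := ψ z
  have hx : ψ z ∈ (extChartAt (𝓡 n) x).source := mem_extChartAt_source x
  obtain ⟨O', hO', hOo, hzO'⟩ := mem_nhds_iff.1 (h.eventually_mem hz hx)
  have hc : ContDiffOn ℝ ∞ (trans ψ x) O' := fun w hw ↦
    (h.contDiffAt_trans (hO' hw).1 (hO' hw).2).contDiffWithinAt
  have h1 := (dualBases_std n).contDiffOn_pb
    ((hα x).comp hc fun w hw ↦ IsParam.trans_mem (hO' hw).2)
    (hc.fderiv_of_isOpen hOo (m := ∞) (by simp))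
  refine ((h1.congr fun w hw ↦ ?_).contDiffAt (hOo.mem_nhds hzO')).contDiffWithinAt
  exact h.pull_eq (hO' hw).1 (hO' hw).2 α

/-- The derivative at `x` of the preferred chart, with tangent spaces identified with `ℝⁿ`. -/
def dChart (x : X) : EucSp n →L[ℝ] EucSp n := chartD x

/-- The covariant derivative of a form, with tangent spaces identified with `ℝⁿ`. -/
def covAt {p : ℕ} (α : DForm n X p) (x : X) (u : EucSp n) : Alt (EucSp n) p := α.covDeriv x u

omit [RiemannianBundle (fun x : X ↦ TangentSpace (𝓡 n) x)]
  [IsContMDiffRiemannianBundle (𝓡 n) ∞ (EucSp n) (fun x : X ↦ TangentSpace (𝓡 n) x)] in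
lemma dParam_chart_dChart (x : X) (v : EucSp n) :
    dParam (extChartAt (𝓡 n) x).symm (extChartAt (𝓡 n) x x) (dChart x v) = v := by
  have h := mfderivWithin_extChartAt_symm_comp_mfderiv_extChartAt' (I := 𝓡 n) (x := x) (y := x)
    (mem_extChartAt_source x)
  rw [ModelWithCorners.range_eq_univ, mfderivWithin_univ] at h
  exact congrArg (fun t : EucSp n →L[ℝ] EucSp n ↦ t v) h

omit [RiemannianBundle (fun x : X ↦ TangentSpace (𝓡 n) x)]
  [IsContMDiffRiemannianBundle (𝓡 n) ∞ (EucSp n) (fun x : X ↦ TangentSpace (𝓡 n) x)] in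
lemma dChart_dParam_chart (x : X) (v : EucSp n) :
    dChart x (dParam (extChartAt (𝓡 n) x).symm (extChartAt (𝓡 n) x x) v) = v := by
  have h := mfderiv_extChartAt_comp_mfderivWithin_extChartAt_symm' (I := 𝓡 n) (x := x) (y := x)
    (mem_extChartAt_source x)
  rw [ModelWithCorners.range_eq_univ, mfderivWithin_univ] at h
  exact congrArg (fun t : EucSp n →L[ℝ] EucSp n ↦ t v) h

/-- The Christoffel symbols computed with an orthonormal basis are those computed with the inverse
of the metric. -/
lemma christoffel_eq (x : X) (u v : EucSp n) :
    christoffel x u v = chr (pullMetric (extChartAt (𝓡 n) x).symm) (extChartAt (𝓡 n) x x) u v := by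
  have hm := (isParam_chart (n := n) x).isMetricOn
  set y := extChartAt (𝓡 n) x x with hy
  set g := pullMetric (n := n) (extChartAt (𝓡 n) x).symm with hgd
  refine hm.eq_chr (mem_extChartAt_target x) fun w ↦ ?_
  have hg : ∀ i w, g y (dChart x (onb x i)) w
      = metricAt x (onb x i) (dParam (extChartAt (𝓡 n) x).symm y w) := fun i w ↦ by
    change metricAt ((extChartAt (𝓡 n) x).symm y)
      (dParam (extChartAt (𝓡 n) x).symm y (dChart x (onb x i))) _ = _
    rw [dParam_chart_dChart, hy, extChartAt_to_inv]
    rfl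
  have hw : ∑ i, g y (dChart x (onb x i)) w • dChart x (onb x i) = w := by
    simp only [hg, ← map_smul, ← map_sum]
    rw [sum_metricAt_onb, dChart_dParam_chart]
  have hc : christoffel x u v
      = ∑ i, koszul (fderiv ℝ g y) u v (dChart x (onb x i)) • dChart x (onb x i) := by
    simp only [koszul_apply]
    rfl
  rw [hc, ← koszul_apply]
  conv_rhs => rw [← hw]
  simp only [map_sum, map_smul, sum_apply, smul_apply, smul_eq_mul]
  exact Finset.sum_congr rfl fun i _ ↦ mul_comm _ _

/-- The covariant derivative of a differential form may be computed in every parametrization. -/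
lemma IsParam.pb_covDeriv (h : IsParam ψ O) (hz : z ∈ O) {p : ℕ} {α : DForm n X p}
    (hα : α.IsSmooth) (u : EucSp n) :
    pb (covAt α (ψ z) (dParam ψ z u)) (dParam ψ z)
      = cov (pullMetric ψ) (pull ψ α) z u := by
  set x := ψ z with hxz
  have hx : ψ z ∈ (extChartAt (𝓡 n) x).source := mem_extChartAt_source x
  have hm := (isParam_chart (n := n) x).isMetricOn
  have hev := h.eventually_mem hz hx
  have hD : ∀ v, fderiv ℝ (trans ψ x) z v = dChart x (dParam ψ z v) := fun v ↦ h.fderiv_trans hz hx v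
  rw [hm.cov_pullback h.isMetricOn hz (IsParam.trans_mem hx) (h.contDiffAt_trans hz hx)
    (h.isInvertible_trans hz hx) (hev.mono fun w hw ↦ h.pullMetric_eq hw.1 hw.2)
    (a := α.inChart x)
    (((hα x).contDiffAt ((isOpen_extChartAt_target x).mem_nhds
      (IsParam.trans_mem hx))).differentiableAt (by simp))
    (hev.mono fun w hw ↦ h.pull_eq hw.1 hw.2 α)]
  have h1 : covAt α x (dParam ψ z u)
      = pb (cov (pullMetric (extChartAt (𝓡 n) x).symm) (α.inChart x) (trans ψ x z)
        (dChart x (dParam ψ z u))) (dChart x) := by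
    have hc : christoffel x (dChart x (dParam ψ z u))
        = chr (pullMetric (extChartAt (𝓡 n) x).symm) (extChartAt (𝓡 n) x x)
          (dChart x (dParam ψ z u)) := by
      ext1 v; exact christoffel_eq x _ v
    change pb (fderiv ℝ (α.inChart x) (extChartAt (𝓡 n) x x) (dChart x (dParam ψ z u)) -
      der (christoffel x (dChart x (dParam ψ z u))) (α.inChart x (extChartAt (𝓡 n) x x))) _ = _
    rw [hc]
    rfl
  rw [h1, hD]
  ext v
  change cov _ _ _ _ (fun i ↦ dChart x (dParam ψ z (v i))) = cov _ _ _ _ (fun i ↦ _)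
  simp only [← hD]
  rfl

/-- The exterior derivative may be computed in every parametrization. -/
lemma IsParam.pull_extd (h : IsParam ψ O) (hz : z ∈ O) {p : ℕ} {α : DForm n X p}
    (hα : α.IsSmooth) : pull ψ α.extd z = extDeriv (pull ψ α) z := by
  set x := ψ z with hxz
  have hx : ψ z ∈ (extChartAt (𝓡 n) x).source := mem_extChartAt_source x
  have hev := h.eventually_mem hz hx
  have hD : ∀ v, fderiv ℝ (trans ψ x) z v = dChart x (dParam ψ z v) := fun v ↦ h.fderiv_trans hz hx v
  have h1 : pull ψ α =ᶠ[𝓝 z] fun w ↦ pb (α.inChart x (trans ψ x w)) (fderiv ℝ (trans ψ x) w) :=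
    hev.mono fun w hw ↦ h.pull_eq hw.1 hw.2 α
  have h2 := extDeriv_pullback (r := ∞) (((hα x).contDiffAt ((isOpen_extChartAt_target x).mem_nhds
      (IsParam.trans_mem hx))).differentiableAt (by simp)) (h.contDiffAt_trans hz hx)
      (by simpa [one_add_one_eq_two] using two_le_infty)
  have h3 : extDeriv (pull ψ α) z
      = extDeriv (fun w ↦ pb (α.inChart x (trans ψ x w)) (fderiv ℝ (trans ψ x) w)) z := by
    rw [extDeriv, extDeriv, h1.fderiv_eq]
  rw [h3, h2]
  ext v
  change (extDeriv (α.inChart x) (extChartAt (𝓡 n) x x)) (fun i ↦ dChart x (dParam ψ z (v i))) = _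
  simp only [← hD]
  rfl

/-- The orthonormal basis of the tangent space, read in a parametrization, represents the metric
tensor on covectors. -/
lemma IsParam.exists_onb (h : IsParam ψ O) (hz : z ∈ O) :
    ∃ b : Fin (Module.finrank ℝ (TangentSpace (𝓡 n) (ψ z))) → EucSp n,
      (∀ i, dParam ψ z (b i) = onb (ψ z) i) ∧
      SameTensor b b (frame (pullMetric ψ) (stdC n) z) (stdB n) := by
  obtain ⟨e, he⟩ := h.inv z hz
  have h1 : ∀ i, dParam ψ z (e.symm (onb (ψ z) i)) = onb (ψ z) i := fun i ↦ by
    rw [← he]; exact e.apply_symm_apply _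
  refine ⟨fun i ↦ e.symm (onb (ψ z) i), h1, ?_⟩
  refine (h.isMetricOn.inner z hz).sameTensor (dualBases_std n) fun v ↦ ?_
  have h2 := sum_metricAt_onb (ψ z) (dParam ψ z v)
  have h3 := congrArg e.symm h2
  rw [map_sum] at h3
  simp only [map_smul] at h3
  have h4 : e.symm (dParam ψ z v) = v := by rw [← he]; exact e.symm_apply_apply v
  rw [h4] at h3
  rw [← h3]
  refine Finset.sum_congr rfl fun i _ ↦ ?_
  congr 1
  change metricAt (ψ z) (dParam ψ z (e.symm (onb (ψ z) i))) (dParam ψ z _) = _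
  rw [h1, h3]

/-- The codifferential may be computed in every parametrization. -/
lemma IsParam.pull_codiff (h : IsParam ψ O) (hz : z ∈ O) {p : ℕ} {α : DForm n X (p + 1)}
    (hα : α.IsSmooth) :
    pull ψ α.codiff z = codiffOn (pullMetric ψ) (stdB n) (stdC n) (pull ψ α) z := by
  obtain ⟨b, hb, hT⟩ := h.exists_onb hz
  have h1 : pull ψ α.codiff z = - ∑ i, ins p (b i) (cov (pullMetric ψ) (pull ψ α) z (b i)) := by
    have h2 : ∀ i, ins p (b i) (cov (pullMetric ψ) (pull ψ α) z (b i))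
        = pb (ins p (onb (ψ z) i) (covAt α (ψ z) (onb (ψ z) i))) (dParam ψ z) := fun i ↦ by
      rw [← h.pb_covDeriv hz hα, ins_pb, hb]
    simp only [h2]
    rw [← pb_sum]
    rfl
  rw [h1, codiffOn]
  congr 1
  exact hT.alt ((ContinuousLinearMap.flip ((ins p).flip ∘L cov (pullMetric ψ) (pull ψ α) z)))

lemma IsParam.pointInner_eq (h : IsParam ψ O) (hz : z ∈ O) {p : ℕ} (α β : DForm n X p) :
    α.pointInner β (ψ z) = inn (frame (pullMetric ψ) (stdC n) z) (stdB n) p (pull ψ α z) (pull ψ β z) := by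
  obtain ⟨b, hb, hT⟩ := h.exists_onb hz
  rw [← hT.inn_eq, pull, pull, inn_pb, FormAlg.pointInner_eq]
  simp only [hb]

end

end

/-! ### Existence of coordinates that are normal at a point -/

section

open RiemForm Bundle

section

variable {V : Type*} [NormedAddCommGroup V] [NormedSpace ℝ V] [FiniteDimensional ℝ V]

lemma isInvertible_of_injective {M : V →L[ℝ] V} (h : Function.Injective M) : M.IsInvertible :=
  ⟨(LinearEquiv.ofInjectiveEndo (M : V →ₗ[ℝ] V) h).toContinuousLinearEquiv, by ext v; rfl⟩

/-- A quadratic change of coordinates with prescribed linear part which cancels the Christoffel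
symbols at a point: `q(z) = y + B z - Γ(B z, B z) / 2`. -/
lemma IsMetricOn.exists_quadratic {g : V → Bil V} {T : Set V} (hm : IsMetricOn g T) {y : V}
    (hy : y ∈ T) (B : V →L[ℝ] V) : ∃ q : V → V, ContDiff ℝ ∞ q ∧ q 0 = y ∧ fderiv ℝ q 0 = B ∧
      ∀ u v, fderiv ℝ (fderiv ℝ q) 0 u v = - chr g y (B u) (B v) := by
  obtain ⟨Q, hQ⟩ : ∃ Q : V →L[ℝ] V →L[ℝ] V, ∀ u v, Q u v = chr g y (B u) (B v) :=
    ⟨(chr g y).bilinearComp B B, fun u v ↦ rfl⟩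
  have hQs : ∀ u v, Q u v = Q v u := fun u v ↦ by rw [hQ, hQ, hm.chr_symm hy]
  have hqd : ∀ z, HasFDerivAt (fun z ↦ y + B z - (2⁻¹ : ℝ) • Q z z) (B - Q z) z := fun z ↦ by
    have h1 := (Q.hasFDerivAt (x := z)).clm_apply (hasFDerivAt_id z)
    refine ((B.hasFDerivAt.const_add y).sub (h1.const_smul (2⁻¹ : ℝ))).congr_fderiv ?_
    ext1 u
    simp only [sub_apply, smul_apply, add_apply, ContinuousLinearMap.comp_apply,
      ContinuousLinearMap.flip_apply, ContinuousLinearMap.id_apply, id_eq]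
    rw [hQs u z]
    module
  have hfq : fderiv ℝ (fun z ↦ y + B z - (2⁻¹ : ℝ) • Q z z) = fun z ↦ B - Q z :=
    funext fun z ↦ (hqd z).fderiv
  refine ⟨fun z ↦ y + B z - (2⁻¹ : ℝ) • Q z z, ?_, by simp, by rw [hfq]; simp, fun u v ↦ ?_⟩
  · exact (contDiff_const.add B.contDiff).sub
      ((Q.contDiff.clm_apply contDiff_id).const_smul (2⁻¹ : ℝ))
  · rw [hfq, ((Q.hasFDerivAt (x := (0 : V))).const_sub B).fderiv, ← hQ]
    rfl

lemma eventually_isInvertible [CompleteSpace V] {q : V → V} {z : V} (hq : ContDiff ℝ ∞ q)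
    (h : (fderiv ℝ q z).IsInvertible) : ∀ᶠ w in 𝓝 z, (fderiv ℝ q w).IsInvertible := by
  obtain ⟨e, he⟩ := h
  have h3 := (hq.continuous_fderiv (by simp)).continuousAt.preimage_mem_nhds (x := z)
    (t := Set.range ((↑) : (V ≃L[ℝ] V) → _)) (by rw [← he]; exact ContinuousLinearEquiv.nhds e)
  filter_upwards [h3] with w hw
  exact hw

/-- The Christoffel symbols vanish at the centre of the new coordinates, by their transformation
law. -/
lemma IsMetricOn.chr_eq_zero {g g' : V → Bil V} {T O : Set V} {q : V → V} (hm : IsMetricOn g T)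
    (hm' : IsMetricOn g' O) {z : V} (hz : z ∈ O) (hqz : q z ∈ T) (hq : ContDiff ℝ ∞ q)
    (hi : (fderiv ℝ q z).IsInvertible)
    (hmet : ∀ z ∈ O, ∀ u v, g' z u v = g (q z) (fderiv ℝ q z u) (fderiv ℝ q z v))
    (h2 : ∀ u v, fderiv ℝ (fderiv ℝ q) z u v
      = - chr g (q z) (fderiv ℝ q z u) (fderiv ℝ q z v)) : chr g' z = 0 := by
  ext1 u
  ext1 v
  have hinj : Function.Injective (fderiv ℝ q z) := by
    obtain ⟨e, he⟩ := hi
    rw [← he]; exact e.injective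
  refine hinj ?_
  have h1 := hm.fderiv_chr_pullback hm' hz hqz hq.contDiffAt hi
    (Filter.eventually_of_mem (hm'.isOpen.mem_nhds hz) hmet) u v
  rw [h1, h2, zero_apply, zero_apply, map_zero]
  exact add_neg_cancel (chr g (q z) (fderiv ℝ q z u) (fderiv ℝ q z v))

end

section

variable {n : ℕ} {X : Type*} [TopologicalSpace X] [ChartedSpace (EucSp n) X]
  [RiemannianBundle (fun x : X ↦ TangentSpace (𝓡 n) x)]

/-- A linear isometry from `ℝⁿ` to the tangent space. -/
lemma exists_orthonormal_map (x : X) :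
    ∃ M : EucSp n →L[ℝ] EucSp n, ∀ i v, metricAt x (M (stdB n i)) (M v) = stdC n i v := by
  let e : OrthonormalBasis (Fin n) ℝ (TangentSpace (𝓡 n) x) :=
    (tangentONB x).reindex (finCongr (finrank_euclideanSpace_fin (𝕜 := ℝ) (n := n)))
  let c : Fin n → EucSp n := fun i ↦ e i
  have hc : ∀ i j, metricAt x (c i) (c j) = if i = j then 1 else 0 := fun i j ↦ by
    rw [metricAt_apply]
    exact orthonormal_iff_ite.1 e.orthonormal i j
  refine ⟨∑ i, (stdC n i).smulRight (c i), fun i v ↦ ?_⟩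
  have h1 : (∑ j, (stdC n j).smulRight (c j)) (stdB n i) = c i := by
    simp [sum_apply, (dualBases_std n).dual]
  rw [h1, sum_apply, map_sum]
  simp [hc]

variable [IsManifold (𝓡 n) ∞ X]
  [IsContMDiffRiemannianBundle (𝓡 n) ∞ (EucSp n) (fun x : X ↦ TangentSpace (𝓡 n) x)]

lemma pullMetric_chart_dChart (x : X) (u v : EucSp n) :
    pullMetric (extChartAt (𝓡 n) x).symm (extChartAt (𝓡 n) x x) (dChart x u) (dChart x v)
      = metricAt x u v := by
  have h : pullMetric (extChartAt (𝓡 n) x).symm (extChartAt (𝓡 n) x x) (dChart x u) (dChart x v)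
    = metricAt ((extChartAt (𝓡 n) x).symm (extChartAt (𝓡 n) x x))
      (dParam (extChartAt (𝓡 n) x).symm (extChartAt (𝓡 n) x x) (dChart x u))
      (dParam (extChartAt (𝓡 n) x).symm (extChartAt (𝓡 n) x x) (dChart x v)) := rfl
  rw [h, dParam_chart_dChart, dParam_chart_dChart, extChartAt_to_inv]

omit [RiemannianBundle (fun x : X ↦ TangentSpace (𝓡 n) x)]
  [IsContMDiffRiemannianBundle (𝓡 n) ∞ (EucSp n) (fun x : X ↦ TangentSpace (𝓡 n) x)] in
lemma IsParam.dParam_comp {ψ : EucSp n → X} {T : Set (EucSp n)} (h : IsParam ψ T)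
    {q : EucSp n → EucSp n} (hq : ContDiff ℝ ∞ q) {z : EucSp n} (hz : q z ∈ T) :
    dParam (ψ ∘ q) z = dParam ψ (q z) ∘L fderiv ℝ q z := by
  have h1 := mfderiv_comp z (h.mdifferentiableAt hz)
    (hq.differentiable (by simp) z).mdifferentiableAt
  rw [mfderiv_eq_fderiv] at h1
  exact h1

omit [RiemannianBundle (fun x : X ↦ TangentSpace (𝓡 n) x)]
  [IsContMDiffRiemannianBundle (𝓡 n) ∞ (EucSp n) (fun x : X ↦ TangentSpace (𝓡 n) x)] in
lemma IsParam.comp {ψ : EucSp n → X} {T : Set (EucSp n)} (h : IsParam ψ T)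
    {q : EucSp n → EucSp n} (hq : ContDiff ℝ ∞ q) {O : Set (EucSp n)} (hO : IsOpen O)
    (hT : ∀ z ∈ O, q z ∈ T) (hi : ∀ z ∈ O, (fderiv ℝ q z).IsInvertible) : IsParam (ψ ∘ q) O := by
  refine ⟨hO, h.smooth.comp hq.contMDiff.contMDiffOn hT, fun z hz ↦ ?_⟩
  rw [h.dParam_comp hq (hT z hz)]
  exact (h.inv _ (hT z hz)).comp (hi z hz)

omit [IsContMDiffRiemannianBundle (𝓡 n) ∞ (EucSp n) (fun x : X ↦ TangentSpace (𝓡 n) x)] in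
lemma IsParam.pullMetric_comp {ψ : EucSp n → X} {T : Set (EucSp n)} (h : IsParam ψ T)
    {q : EucSp n → EucSp n} (hq : ContDiff ℝ ∞ q) {z : EucSp n} (hz : q z ∈ T) (u v : EucSp n) :
    pullMetric (ψ ∘ q) z u v = pullMetric ψ (q z) (fderiv ℝ q z u) (fderiv ℝ q z v) := by
  rw [pullMetric, h.dParam_comp hq hz]
  rfl

/-- Around every point there are coordinates in which the metric agrees with the Euclidean one to
first order at this point. They come from a quadratic change of coordinates, without the exponential
map. -/
lemma exists_isNormalAt (x : X) : ∃ (ψ : EucSp n → X) (O : Set (EucSp n)), IsParam ψ O ∧ 0 ∈ O ∧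
    ψ 0 = x ∧ IsNormalAt (stdB n) (stdC n) (pullMetric ψ) O 0 := by
  have hyT : extChartAt (𝓡 n) x x ∈ (extChartAt (𝓡 n) x).target := mem_extChartAt_target x
  have hP := isParam_chart (n := n) x
  obtain ⟨M, hM⟩ := exists_orthonormal_map (n := n) x
  obtain ⟨q, hq, hq0, hq1, hq2⟩ := hP.isMetricOn.exists_quadratic hyT (dChart x ∘L M)
  have hgB : ∀ i v, pullMetric (extChartAt (𝓡 n) x).symm (q 0) (fderiv ℝ q 0 (stdB n i))
      (fderiv ℝ q 0 v) = stdC n i v := fun i v ↦ by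
    rw [← hM, hq0, hq1]
    exact pullMetric_chart_dChart x _ _
  have hinv : (fderiv ℝ q 0).IsInvertible := isInvertible_of_injective fun u v huv ↦ by
    rw [← (dualBases_std n).sum_eq u, ← (dualBases_std n).sum_eq v]
    refine Finset.sum_congr rfl fun i _ ↦ ?_
    rw [← hgB i u, ← hgB i v, huv]
  have h1 : ∀ᶠ z in 𝓝 (0 : EucSp n), q z ∈ (extChartAt (𝓡 n) x).target :=
    hq.continuous.continuousAt.preimage_mem_nhds (by
      rw [hq0]; exact (isOpen_extChartAt_target x).mem_nhds hyT)
  obtain ⟨O, hO, hOo, h0⟩ := mem_nhds_iff.1 (h1.and (eventually_isInvertible hq hinv))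
  have hψ := hP.comp hq hOo (fun z hz ↦ (hO hz).1) (fun z hz ↦ (hO hz).2)
  have hmet := fun z (hz : z ∈ O) u v ↦ hP.pullMetric_comp hq (hO hz).1 u v
  have hchr := hP.isMetricOn.chr_eq_zero hψ.isMetricOn h0 (hO h0).1 hq (hO h0).2 hmet
    (fun u v ↦ by rw [hq2, hq0, hq1])
  refine ⟨(extChartAt (𝓡 n) x).symm ∘ q, O, hψ, h0, ?_,
    ⟨hψ.isMetricOn, dualBases_std n, h0, fun i ↦ ?_, ?_⟩⟩
  · rw [Function.comp_apply, hq0, extChartAt_to_inv]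
  · ext1 v
    rw [hmet 0 h0]
    exact hgB i v
  · ext1 u
    ext1 v
    ext1 w
    rw [hψ.isMetricOn.fderiv_eq h0, hchr]
    simp

end

end

/-! ### Wedge product, contraction and pairing of differential forms -/

section

open RiemForm Bundle

section

variable {V : Type*} [NormedAddCommGroup V] [NormedSpace ℝ V]
  {ι κ : Type*} [Fintype ι] [Fintype κ] {s : ι → V} {σ : ι → V →L[ℝ] ℝ}

lemma mul_mul_mul_anticomm {R : Type*} [Ring R] {a b c t : R} (ha : a * t = - (t * a))
    (hb : b * t = - (t * b)) (hc : c * t = - (t * c)) : - (a * b * c * t) = t * (a * b * c) := by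
  have h1 : - (a * b * c * t) = - (a * b * (c * t)) := by noncomm_ring
  have h2 : - (a * b * - (t * c)) = a * (b * t) * c := by noncomm_ring
  have h3 : a * - (t * b) * c = - (a * t) * b * c := by noncomm_ring
  rw [h1, hc, h2, hb, h3, ha]
  noncomm_ring

/-- Exterior multiplication by a covector anticommutes with the wedge product with a `3`-form. -/
lemma DualBases.ext_wedge_three [DecidableEq ι] (h : DualBases s σ) {p : ℕ} (θ : V →L[ℝ] ℝ)
    (b : Alt V 3) (a : Alt V p) :
    ext (p + 3) θ (wedge p 3 b a) = - wedge (p + 1) 3 b (ext p θ a) := by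
  have h1 : (Pi.single (p + 4) (ext (p + 3) θ (wedge p 3 b a)) : Tot V)
      = - Pi.single (p + 4) (wedge (p + 1) 3 b (ext p θ a)) := by
    rw [← extOp_single]
    refine Eq.trans ?_ (congrArg (fun t : Tot V ↦ -t) (h.wedge_three b (ext p θ a)).symm)
    rw [h.wedge_three, ← extOp_single, map_smul, ← smul_neg]
    congr 1
    simp only [← Module.End.mul_apply, ← LinearMap.neg_apply]
    congr 1
    simp only [Finset.mul_sum, Finset.sum_mul, ← Finset.sum_neg_distrib, mul_smul_comm,
      smul_mul_assoc, ← smul_neg]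
    refine Finset.sum_congr rfl fun i _ ↦ Finset.sum_congr rfl fun j _ ↦
      Finset.sum_congr rfl fun k _ ↦ congrArg _ ?_
    exact (mul_mul_mul_anticomm (extOp_mul_extOp _ _) (extOp_mul_extOp _ _)
      (extOp_mul_extOp _ _)).symm
  rw [← Pi.single_neg] at h1
  exact Pi.single_injective _ h1

/-- Interior multiplication anticommutes with the contraction with a `3`-form. -/
lemma ins_contr_three {p : ℕ} (s : ι → V) (v : V) (b : Alt V 3) (a : Alt V (p + 1 + 3)) :
    ins p v (contr s s (p + 1) 3 b a) = - contr s s p 3 b (ins (p + 3) v a) := by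
  simp only [contr_succ, contr_zero, map_smul, map_sum, ← smul_neg, ← Finset.sum_neg_distrib]
  refine congrArg _ (Finset.sum_congr rfl fun i _ ↦ congrArg _ (Finset.sum_congr rfl fun j _ ↦
    congrArg _ (Finset.sum_congr rfl fun k _ ↦ congrArg _ ?_)))
  have e1 := ins_ins_swap v (s k) (ins (p + 1 + 1) (s j) (ins (p + 1 + 2) (s i) a))
  have e2 := ins_ins_swap v (s j) (ins (p + 1 + 2) (s i) a)
  have e3 := ins_ins_swap v (s i) a
  refine e1.trans (congrArg _ ?_)
  refine (congrArg (ins p (s k)) e2).trans ?_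
  rw [map_neg, neg_eq_iff_eq_neg, ← map_neg]
  refine congrArg _ ?_
  rw [← map_neg]
  refine congrArg _ ?_
  exact e3

lemma pairing_pb {V' : Type*} [NormedAddCommGroup V'] [NormedSpace ℝ V'] (e f : ι → V') {p : ℕ}
    (a : Alt V p) (c : Alt V (p + 1)) (M : V' →L[ℝ] V) :
    pairing e f (pb a M) (pb c M) = pb (pairing (fun i ↦ M (e i)) (fun i ↦ M (f i)) a c) M := by
  ext v
  rw [pb_apply, pairing, pairing, toOne_apply, toOne_apply]
  simp only [ContinuousLinearMap.comp_apply, ContinuousLinearMap.flip_apply]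
  rw [ins_pb, inn_pb]

lemma SameTensor.pairing_eq {p : ℕ} {e f : ι → V} {e' f' : κ → V} (h : SameTensor e f e' f')
    (a : Alt V p) (c : Alt V (p + 1)) : pairing e f a c = pairing e' f' a c := by
  ext v
  rw [pairing, pairing, toOne_apply, toOne_apply]
  exact h.inn_eq _ _

lemma pb_injective {p : ℕ} {a b : Alt V p} {M : V →L[ℝ] V} (hM : M.IsInvertible)
    (h : pb a M = pb b M) : a = b := by
  obtain ⟨e, rfl⟩ := hM
  ext v
  have h1 : (fun i ↦ (e : V →L[ℝ] V) (e.symm (v i))) = v := funext fun i ↦ e.apply_symm_apply (v i)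
  have h2 := congrArg (fun t : Alt V p ↦ t fun i ↦ e.symm (v i)) h
  simp only [pb_apply, h1] at h2
  exact h2

end

section

variable {n : ℕ} {X : Type*} [TopologicalSpace X] [ChartedSpace (EucSp n) X] {p q : ℕ}

/-- The wedge product `b ∧ a` of two differential forms. -/
def wedgeForm (b : DForm n X q) (a : DForm n X p) : DForm n X (p + q) :=
  fun x ↦ wedge (V := EucSp n) p q (formAt b x) (formAt a x)

lemma pull_wedgeForm (ψ : EucSp n → X) (b : DForm n X q) (a : DForm n X p) (z : EucSp n) :
    pull ψ (wedgeForm b a) z = wedge p q (pull ψ b z) (pull ψ a z) := wedge_pb _ _ _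

lemma IsParam.ext_pull {ψ : EucSp n → X} {O : Set (EucSp n)} (h : IsParam ψ O) {z : EucSp n}
    (hz : z ∈ O) {a b : DForm n X p} (hab : pull ψ a z = pull ψ b z) : a (ψ z) = b (ψ z) :=
  pb_injective (h.inv z hz) hab

variable [RiemannianBundle (fun x : X ↦ TangentSpace (𝓡 n) x)]

/-- The contraction of a differential form `a` with a form `b`, which is adjoint to the wedge
product with `b`. -/
def contrForm (b : DForm n X q) (a : DForm n X (p + q)) : DForm n X p :=
  fun x ↦ contr (V := EucSp n) (onb x) (onb x) p q (formAt b x) (formAt a x)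

/-- The `1`-form `u ↦ ⟨a, ι_u c⟩`. -/
def pairForm (a : DForm n X p) (c : DForm n X (p + 1)) : DForm n X 1 :=
  fun x ↦ pairing (V := EucSp n) (onb x) (onb x) (formAt a x) (formAt c x)

/-- The contraction with `b` is the pointwise adjoint of the wedge product with `b`. -/
lemma pointInner_wedgeForm (b : DForm n X q) (a : DForm n X p) (c : DForm n X (p + q)) (x : X) :
    (wedgeForm b a).pointInner c x = a.pointInner (contrForm b c) x := by
  rw [FormAlg.pointInner_eq, FormAlg.pointInner_eq]
  exact inn_wedge _ _ _ _ _

variable [IsManifold (𝓡 n) ∞ X]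
  [IsContMDiffRiemannianBundle (𝓡 n) ∞ (EucSp n) (fun x : X ↦ TangentSpace (𝓡 n) x)]
  {ψ : EucSp n → X} {O : Set (EucSp n)} {z : EucSp n}

lemma IsParam.pull_contrForm (h : IsParam ψ O) (hz : z ∈ O) (b : DForm n X q)
    (a : DForm n X (p + q)) :
    pull ψ (contrForm b a) z
      = contr (frame (pullMetric ψ) (stdC n) z) (stdB n) p q (pull ψ b z) (pull ψ a z) := by
  obtain ⟨e, he, hT⟩ := h.exists_onb hz
  rw [← hT.contr_eq, pull, pull, pull, contr_pb]
  simp only [he]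
  rfl

lemma IsParam.pull_pairForm (h : IsParam ψ O) (hz : z ∈ O) (a : DForm n X p)
    (c : DForm n X (p + 1)) :
    pull ψ (pairForm a c) z
      = pairing (frame (pullMetric ψ) (stdC n) z) (stdB n) (pull ψ a z) (pull ψ c z) := by
  obtain ⟨e, he, hT⟩ := h.exists_onb hz
  rw [← hT.pairing_eq, pull, pull, pull, pairing_pb]
  simp only [he]
  rfl

/-- Smoothness may be checked in parametrizations. -/
lemma isSmooth_of_pull {a : DForm n X p}
    (h : ∀ (ψ : EucSp n → X) (O : Set (EucSp n)), IsParam ψ O → ContDiffOn ℝ ∞ (pull ψ a) O) :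
    a.IsSmooth := fun x ↦ h _ _ (isParam_chart x)

section Smooth

variable {a : DForm n X p} {b : DForm n X q}

lemma isSmooth_wedgeForm (hb : b.IsSmooth) (ha : a.IsSmooth) : (wedgeForm b a).IsSmooth :=
  isSmooth_of_pull fun ψ O h ↦ by
    refine ContDiffOn.congr ?_ fun z hz ↦ pull_wedgeForm ψ b a z
    exact ((wedge p q).contDiff.comp_contDiffOn (h.contDiffOn_pull hb)).clm_apply
      (h.contDiffOn_pull ha)

lemma isSmooth_contrForm {a : DForm n X (p + q)} (hb : b.IsSmooth) (ha : a.IsSmooth) :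
    (contrForm b a).IsSmooth :=
  isSmooth_of_pull fun ψ O h ↦ by
    refine ContDiffOn.congr ?_ fun z hz ↦ h.pull_contrForm hz b a
    exact contDiffOn_contr _ (h.isMetricOn.contDiffOn_frame) (h.contDiffOn_pull hb)
      (h.contDiffOn_pull ha)

lemma isSmooth_pairForm {c : DForm n X (p + 1)} (ha : a.IsSmooth) (hc : c.IsSmooth) :
    (pairForm a c).IsSmooth :=
  isSmooth_of_pull fun ψ O h ↦ by
    refine ContDiffOn.congr ?_ fun z hz ↦ h.pull_pairForm hz a c
    exact h.isMetricOn.contDiffOn_pairing (dualBases_std n) (h.contDiffOn_pull ha)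
      (h.contDiffOn_pull hc)

lemma isSmooth_extd (ha : a.IsSmooth) : a.extd.IsSmooth :=
  isSmooth_of_pull fun ψ O h ↦ by
    refine ContDiffOn.congr ?_ fun z hz ↦ h.pull_extd hz ha
    exact (alternatizeUncurryFinCLM ℝ (EucSp n) ℝ).contDiff.comp_contDiffOn
      ((h.contDiffOn_pull ha).fderiv_of_isOpen h.isOpen (by simp))

lemma isSmooth_codiff {a : DForm n X (p + 1)} (ha : a.IsSmooth) : a.codiff.IsSmooth :=
  isSmooth_of_pull fun ψ O h ↦ by
    refine ContDiffOn.congr ?_ fun z hz ↦ h.pull_codiff hz ha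
    exact h.isMetricOn.contDiffOn_codiffOn (h.contDiffOn_pull ha)

lemma IsParam.differentiableAt_pull (h : IsParam ψ O) (hz : z ∈ O) (ha : a.IsSmooth) :
    DifferentiableAt ℝ (pull ψ a) z :=
  ((h.contDiffOn_pull ha).contDiffAt (h.mem_nhds hz)).differentiableAt (by simp)

lemma cov_congr {V : Type*} [NormedAddCommGroup V] [NormedSpace ℝ V] {g : V → Bil V}
    {a a' : V → Alt V p} {y : V} (h : a =ᶠ[𝓝 y] a') : cov g a y = cov g a' y := by
  rw [cov, cov, h.fderiv_eq, h.eq_of_nhds]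

lemma extDeriv_congr {V : Type*} [NormedAddCommGroup V] [NormedSpace ℝ V]
    {a a' : V → Alt V p} {y : V} (h : a =ᶠ[𝓝 y] a') : extDeriv a y = extDeriv a' y := by
  rw [extDeriv, extDeriv, h.fderiv_eq]

lemma codiffOn_congr {V : Type*} [NormedAddCommGroup V] [NormedSpace ℝ V] {g : V → Bil V}
    {ι : Type*} [Fintype ι] [DecidableEq ι] {s : ι → V} {σ : ι → V →L[ℝ] ℝ}
    {a a' : V → Alt V (p + 1)} {y : V} (h : a =ᶠ[𝓝 y] a') :
    codiffOn g s σ a y = codiffOn g s σ a' y := by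
  rw [codiffOn, codiffOn, cov_congr h]

/-- The Leibniz rule `∇_u (b ∧ a) = ∇_u b ∧ a + b ∧ ∇_u a`. -/
lemma covAt_wedgeForm (hb : b.IsSmooth) (ha : a.IsSmooth) (x : X) (u : EucSp n) :
    covAt (wedgeForm b a) x u = wedge p q (covAt b x u) (formAt a x)
      + wedge p q (formAt b x) (covAt a x u) := by
  obtain ⟨ψ, O, h, h0, rfl, hN⟩ := exists_isNormalAt (n := n) x
  obtain ⟨e, he⟩ := h.inv 0 h0
  obtain ⟨v, rfl⟩ : ∃ v, dParam ψ 0 v = u := ⟨e.symm u, by rw [← he]; exact e.apply_symm_apply u⟩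
  refine pb_injective (h.inv 0 h0) ?_
  rw [h.pb_covDeriv h0 (isSmooth_wedgeForm hb ha), pb_add, wedge_pb, wedge_pb,
    h.pb_covDeriv h0 hb, h.pb_covDeriv h0 ha]
  rw [funext (pull_wedgeForm ψ b a)]
  exact hN.cov_wedge (h.differentiableAt_pull h0 hb) (h.differentiableAt_pull h0 ha) v

/-- The Leibniz rule for contractions; the metric, which enters the contraction, is parallel. -/
lemma covAt_contrForm {a : DForm n X (p + q)} (hb : b.IsSmooth) (ha : a.IsSmooth) (x : X)
    (u : EucSp n) :
    covAt (contrForm b a) x u = contr (onb x) (onb x) p q (covAt b x u) (formAt a x)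
      + contr (onb x) (onb x) p q (formAt b x) (covAt a x u) := by
  obtain ⟨ψ, O, h, h0, rfl, hN⟩ := exists_isNormalAt (n := n) x
  obtain ⟨e, he⟩ := h.inv 0 h0
  obtain ⟨v, rfl⟩ : ∃ v, dParam ψ 0 v = u := ⟨e.symm u, by rw [← he]; exact e.apply_symm_apply u⟩
  refine pb_injective (h.inv 0 h0) ?_
  obtain ⟨f, hf, hT⟩ := h.exists_onb h0
  rw [show onb (ψ 0) = fun i ↦ dParam ψ 0 (f i) from funext fun i ↦ (hf i).symm]
  rw [h.pb_covDeriv h0 (isSmooth_contrForm hb ha), pb_add, ← contr_pb, ← contr_pb,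
    h.pb_covDeriv h0 hb, h.pb_covDeriv h0 ha, hT.contr_eq, hT.contr_eq, hN.frame_eq]
  rw [cov_congr (Filter.eventually_of_mem (h.mem_nhds h0) fun z hz ↦ h.pull_contrForm hz b a)]
  exact hN.cov_contr (h.differentiableAt_pull h0 hb) (h.differentiableAt_pull h0 ha) v

end Smooth

end

end

/-! ### Products with a parallel form, and divergence identities -/

section

open RiemForm Bundle

variable {n : ℕ} {X : Type*} [TopologicalSpace X] [ChartedSpace (EucSp n) X] {p q : ℕ}
  [RiemannianBundle (fun x : X ↦ TangentSpace (𝓡 n) x)]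

/-- A form is coclosed if its codifferential vanishes; all functions are coclosed. -/
def IsCoclosed : {p : ℕ} → DForm n X p → Prop
  | 0, _ => True
  | _ + 1, a => a.codiff = 0

variable [IsManifold (𝓡 n) ∞ X]
  [IsContMDiffRiemannianBundle (𝓡 n) ∞ (EucSp n) (fun x : X ↦ TangentSpace (𝓡 n) x)]
  {ψ : EucSp n → X} {O : Set (EucSp n)} {z : EucSp n}

/-- An equation between differential forms may be checked at the centres of normal coordinates. -/
lemma dform_ext_normal {a b : DForm n X p} (h : ∀ (ψ : EucSp n → X) (O : Set (EucSp n)),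
    IsParam ψ O → 0 ∈ O → IsNormalAt (stdB n) (stdC n) (pullMetric ψ) O 0 →
    pull ψ a 0 = pull ψ b 0) : a = b := by
  funext x
  obtain ⟨ψ, O, hψ, h0, rfl, hN⟩ := exists_isNormalAt (n := n) x
  exact hψ.ext_pull h0 (h ψ O hψ h0 hN)

omit [RiemannianBundle (fun x : X ↦ TangentSpace (𝓡 n) x)] [IsManifold (𝓡 n) ∞ X]
  [IsContMDiffRiemannianBundle (𝓡 n) ∞ (EucSp n) (fun x : X ↦ TangentSpace (𝓡 n) x)] in
lemma pull_zero (ψ : EucSp n → X) (z : EucSp n) : pull ψ (0 : DForm n X p) z = 0 := rfl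

section Parallel

variable {φ : DForm n X 3} (hφ : φ.IsSmooth) (hpar : φ.IsParallel)

include hφ hpar

lemma IsParam.cov_pull_parallel (h : IsParam ψ O) (hz : z ∈ O) :
    cov (pullMetric ψ) (pull ψ φ) z = 0 := by
  ext1 u
  rw [← h.pb_covDeriv hz hφ]
  have : covAt φ (ψ z) (dParam ψ z u) = 0 := hpar _ _
  rw [this]
  rfl

lemma IsParam.cov_pull_wedge (h : IsParam ψ O) (hz : z ∈ O) {a : DForm n X p} (ha : a.IsSmooth)
    (u : EucSp n) : cov (pullMetric ψ) (pull ψ (wedgeForm φ a)) z u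
      = wedge p 3 (pull ψ φ z) (cov (pullMetric ψ) (pull ψ a) z u) := by
  have h1 : covAt φ (ψ z) (dParam ψ z u) = 0 := hpar _ _
  rw [← h.pb_covDeriv hz (isSmooth_wedgeForm hφ ha), covAt_wedgeForm hφ ha, h1, map_zero,
    zero_apply, zero_add, wedge_pb, h.pb_covDeriv hz ha]
  rfl

lemma IsParam.cov_pull_contr (h : IsParam ψ O) (hz : z ∈ O) {a : DForm n X (p + 3)}
    (ha : a.IsSmooth) (u : EucSp n) : cov (pullMetric ψ) (pull ψ (contrForm φ a)) z u
      = contr (frame (pullMetric ψ) (stdC n) z) (stdB n) p 3 (pull ψ φ z)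
        (cov (pullMetric ψ) (pull ψ a) z u) := by
  have h1 : covAt φ (ψ z) (dParam ψ z u) = 0 := hpar _ _
  obtain ⟨f, hf, hT⟩ := h.exists_onb hz
  rw [← h.pb_covDeriv hz (isSmooth_contrForm hφ ha), covAt_contrForm hφ ha, h1, map_zero,
    zero_apply, zero_add, ← hT.contr_eq, ← h.pb_covDeriv hz ha]
  rw [show onb (ψ z) = fun i ↦ dParam ψ z (f i) from funext fun i ↦ (hf i).symm]
  exact (contr_pb _ _ _ _ _).symm

/-- The wedge product of a closed form with a parallel `3`-form is closed. -/
lemma extd_wedgeForm {a : DForm n X p} (ha : a.IsSmooth) (hd : a.extd = 0) :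
    (wedgeForm φ a).extd = 0 := dform_ext_normal fun ψ O h h0 hN ↦ by
  have hD : ∑ i, ext p (stdC n i) (cov (pullMetric ψ) (pull ψ a) 0 (stdB n i)) = 0 := by
    rw [← hN.alternatize, ← hN.toIsMetricOn.extDeriv_eq _ h0, ← h.pull_extd h0 ha, hd, pull_zero]
  rw [h.pull_extd h0 (isSmooth_wedgeForm hφ ha), hN.toIsMetricOn.extDeriv_eq _ h0, hN.alternatize,
    pull_zero]
  simp only [h.cov_pull_wedge hφ hpar h0 ha, hN.ext_wedge_three]
  rw [Finset.sum_neg_distrib, neg_eq_zero]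
  refine (map_sum (wedge (p + 1) 3 (pull ψ φ 0)) _ _).symm.trans ?_
  rw [hD, map_zero]

/-- The contraction of a coclosed form with a parallel `3`-form is coclosed. -/
lemma codiff_contrForm {a : DForm n X (p + 1 + 3)} (ha : a.IsSmooth)
    (hδ : DForm.codiff (p := p + 3) a = 0) :
    (contrForm φ a).codiff = 0 := dform_ext_normal fun ψ O h h0 hN ↦ by
  have hD : ∑ i, ins (p + 3) (stdB n i) (cov (pullMetric ψ) (pull ψ a) 0 (stdB n i)) = 0 := by
    have := h.pull_codiff (p := p + 3) h0 ha
    rw [hδ, pull_zero, codiffOn, hN.frame_eq, eq_comm, neg_eq_zero] at this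
    exact this
  rw [h.pull_codiff h0 (isSmooth_contrForm hφ ha), pull_zero, codiffOn, hN.frame_eq]
  simp only [h.cov_pull_contr (p := p + 1) hφ hpar h0 ha, hN.frame_eq, ins_contr_three]
  rw [Finset.sum_neg_distrib, neg_neg]
  refine (map_sum (contr (stdB n) (stdB n) p 3 (pull ψ φ 0)) _ _).symm.trans ?_
  rw [hD, map_zero]

/-- If `α` is closed and coclosed and `φ` is a parallel `3`-form, then `d d* (φ ∧ α) = 0`. Together
with `extd_wedgeForm` this shows that `φ ∧ α` is harmonic. -/
lemma extd_codiff_wedgeForm {a : DForm n X p} (ha : a.IsSmooth) (hd : a.extd = 0)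
    (hδ : IsCoclosed a) : (DForm.codiff (p := p + 2) (wedgeForm (p := p) (q := 3) φ a)).extd = 0 :=
  dform_ext_normal fun ψ O h h0 hN ↦ by
  have hw : pull ψ (wedgeForm φ a) = fun z ↦ wedge p 3 (pull ψ φ z) (pull ψ a z) :=
    funext (pull_wedgeForm ψ φ a)
  have hs : (wedgeForm φ a).IsSmooth := isSmooth_wedgeForm hφ ha
  have hs' : (DForm.codiff (p := p + 2) (wedgeForm (p := p) (q := 3) φ a)).IsSmooth :=
    isSmooth_codiff (p := p + 2) hs
  have hc : pull ψ (DForm.codiff (p := p + 2) (wedgeForm (p := p) (q := 3) φ a)) =ᶠ[𝓝 0]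
      codiffOn (p := p + 2) (pullMetric ψ) (stdB n) (stdC n) (pull ψ (wedgeForm (p := p) (q := 3) φ a)) :=
    Filter.eventually_of_mem (h.mem_nhds h0) fun z hz ↦ h.pull_codiff (p := p + 2) hz hs
  rw [h.pull_extd h0 hs', pull_zero, extDeriv_congr hc, hw]
  refine hN.extDeriv_codiffOn_wedge (h.contDiffOn_pull hφ)
    (fun z hz ↦ h.cov_pull_parallel hφ hpar hz) (h.contDiffOn_pull ha)
    (fun z hz u ↦ by rw [← hw, h.cov_pull_wedge hφ hpar hz ha])
    (fun z hz ↦ by rw [← h.pull_extd hz ha, hd, pull_zero]) fun z hz ↦ ?_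
  cases p with
  | zero => simp [insOp_single_zero]
  | succ p =>
    have h1 : a.codiff = 0 := hδ
    have h2 := h.pull_codiff hz ha
    rw [h1, pull_zero, codiffOn, eq_comm, neg_eq_zero] at h2
    simp only [insOp_single, ← single_sum]
    rw [h2, Pi.single_zero]

/-- If `α` is closed and coclosed and `φ` is a parallel `3`-form, then `d* d (C_φ α) = 0`. Together
with `codiff_contrForm` this shows that `C_φ α` is harmonic. -/
lemma codiff_extd_contrForm {a : DForm n X (p + 3)} (ha : a.IsSmooth) (hd : a.extd = 0)
    (hδ : DForm.codiff (p := p + 2) a = 0) : (contrForm φ a).extd.codiff = 0 :=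
  dform_ext_normal fun ψ O h h0 hN ↦ by
  rw [h.pull_codiff h0 (isSmooth_extd (isSmooth_contrForm hφ ha)), pull_zero,
    codiffOn_congr (Filter.eventually_of_mem (h.mem_nhds h0) fun z hz ↦
      h.pull_extd hz (isSmooth_contrForm hφ ha))]
  have hc : ∀ z ∈ O, pull ψ (contrForm φ a) =ᶠ[𝓝 z] fun z ↦
      contr (frame (pullMetric ψ) (stdC n) z) (stdB n) p 3 (pull ψ φ z) (pull ψ a z) := fun z hz ↦
    Filter.eventually_of_mem (h.mem_nhds hz) fun w hw ↦ h.pull_contrForm hw φ a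
  rw [codiffOn_congr (Filter.eventually_of_mem (h.mem_nhds h0) fun z hz ↦
    extDeriv_congr (hc z hz))]
  exact hN.codiffOn_extDeriv_contr (h.contDiffOn_pull hφ)
    (fun z hz ↦ h.cov_pull_parallel hφ hpar hz) (h.contDiffOn_pull ha)
    (fun z hz u ↦ by rw [← cov_congr (hc z hz), h.cov_pull_contr hφ hpar hz ha])
    (fun z hz ↦ by rw [← h.pull_extd hz ha, hd, pull_zero])
    (fun z hz ↦ by rw [← h.pull_codiff (p := p + 2) hz ha, hδ, pull_zero])

end Parallel

/-- The divergence of the pairing of two forms: `d* ⟨a, ι c⟩ = ⟨a, d* c⟩ - ⟨da, c⟩`. -/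
lemma codiff_pairForm {a : DForm n X p} {c : DForm n X (p + 1)} (ha : a.IsSmooth)
    (hc : c.IsSmooth) (x : X) : (pairForm a c).codiff x ![]
      = a.pointInner c.codiff x - a.extd.pointInner c x := by
  obtain ⟨ψ, O, h, h0, rfl, hN⟩ := exists_isNormalAt (n := n) x
  rw [h.pointInner_eq h0, h.pointInner_eq h0, h.pull_extd h0 ha, h.pull_codiff h0 hc, hN.frame_eq]
  have h1 := h.pull_codiff h0 (isSmooth_pairForm ha hc)
  rw [codiffOn_congr (Filter.eventually_of_mem (h.mem_nhds h0) fun z hz ↦ h.pull_pairForm hz a c),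
    hN.codiffOn_pairing (h.differentiableAt_pull h0 ha) (h.differentiableAt_pull h0 hc)] at h1
  have h2 := congrArg (fun t : Alt (EucSp n) 0 ↦ t ![]) h1
  simp only [pull, pb_apply] at h2
  rw [Subsingleton.elim (fun i ↦ dParam ψ 0 (![] i)) ![]] at h2
  refine Eq.trans h2 ?_
  simp [smul_apply, pull]

/-- `d* (C_b a) = C_b (d* a) - C_{db} a` for a `2`-form `b`. -/
lemma codiff_contrForm_two {b : DForm n X 2} {a : DForm n X (p + 3)} (hb : b.IsSmooth)
    (ha : a.IsSmooth) : (contrForm (p := p + 1) b a).codiff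
      = contrForm b (DForm.codiff (p := p + 2) a) - contrForm b.extd a :=
  dform_ext_normal fun ψ O h h0 hN ↦ by
  have h1 : pull ψ (contrForm b (DForm.codiff (p := p + 2) a) - contrForm b.extd a) 0
    = pull ψ (contrForm b (DForm.codiff (p := p + 2) a)) 0 - pull ψ (contrForm b.extd a) 0 := rfl
  rw [h.pull_codiff h0 (isSmooth_contrForm (p := p + 1) hb ha), h1, h.pull_contrForm h0,
    h.pull_contrForm h0, h.pull_codiff (p := p + 2) h0 ha, h.pull_extd h0 hb, hN.frame_eq,
    codiffOn_congr (Filter.eventually_of_mem (h.mem_nhds h0) fun z hz ↦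
      h.pull_contrForm (p := p + 1) hz b a)]
  exact hN.codiffOn_contr_two (h.differentiableAt_pull h0 hb) (h.differentiableAt_pull h0 ha)

end

/-! ### The Riemannian volume in charts -/

section

open RiemForm Bundle

section Density

variable {n : ℕ}

/-- The matrix of a bilinear form in the standard basis. -/
def gram (g : Bil (EucSp n)) : Matrix (Fin n) (Fin n) ℝ :=
  Matrix.of fun i j ↦ g (stdB n i) (stdB n j)

/-- The density `√(det g_{ij})` of the Riemannian measure with respect to the Lebesgue measure. -/
def dens (g : Bil (EucSp n)) : ℝ := √(gram g).det

lemma stdC_apply (i : Fin n) (v : EucSp n) : stdC n i v = v i := rfl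

lemma bil_apply (g : Bil (EucSp n)) (u v : EucSp n) :
    g u v = ∑ i, ∑ j, u i * (g (stdB n i) (stdB n j) * v j) := by
  have hu := (dualBases_std n).sum_eq u
  have hv := (dualBases_std n).sum_eq v
  conv_lhs => rw [← hu, ← hv]
  simp only [map_sum, map_smul, sum_apply, smul_apply, smul_eq_mul]
  simp only [Finset.mul_sum]
  rw [Finset.sum_comm]
  refine Finset.sum_congr rfl fun i _ ↦ Finset.sum_congr rfl fun j _ ↦ ?_
  rw [stdC_apply, stdC_apply]
  ring

lemma IsInner.det_gram_pos {g : Bil (EucSp n)} (hg : IsInner g) : 0 < (gram g).det := by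
  refine Matrix.PosDef.det_pos (Matrix.PosDef.of_dotProduct_mulVec_pos ?_ fun v hv ↦ ?_)
  · ext i j
    simp [gram, hg.symm (stdB n i)]
  · have h0 : WithLp.toLp 2 v ≠ (0 : EucSp n) := by simpa using hv
    have := hg.pos _ h0
    rw [bil_apply] at this
    simpa [dotProduct, Matrix.mulVec, gram, Finset.mul_sum] using this

lemma IsInner.dens_pos {g : Bil (EucSp n)} (hg : IsInner g) : 0 < dens g :=
  Real.sqrt_pos.2 hg.det_gram_pos

/-- The density transforms with the absolute value of the Jacobian determinant. -/
lemma dens_bilinearComp (g : Bil (EucSp n)) (M : EucSp n →L[ℝ] EucSp n) :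
    dens (g.bilinearComp M M) = |M.det| * dens g := by
  let B := LinearMap.toMatrix (EuclideanSpace.basisFun (Fin n) ℝ).toBasis
    (EuclideanSpace.basisFun (Fin n) ℝ).toBasis (M : EucSp n →ₗ[ℝ] EucSp n)
  have hB : ∀ i j, B i j = M (stdB n j) i := fun i j ↦ by
    simp [B, LinearMap.toMatrix_apply, stdB]
  have h1 : gram (g.bilinearComp M M) = B.transpose * gram g * B := by
    ext i j
    change g (M (stdB n i)) (M (stdB n j)) = _
    rw [bil_apply, Matrix.mul_apply]
    simp only [Matrix.mul_apply, Matrix.transpose_apply, hB, Finset.sum_mul]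
    rw [Finset.sum_comm]
    refine Finset.sum_congr rfl fun a _ ↦ Finset.sum_congr rfl fun b _ ↦ ?_
    simp only [gram, Matrix.of_apply]
    ring
  have h2 : M.det = B.det := (LinearMap.det_toMatrix _ _).symm
  rw [dens, dens, h1, Matrix.det_mul, Matrix.det_mul, Matrix.det_transpose, h2,
    show B.det * (gram g).det * B.det = B.det ^ 2 * (gram g).det by ring,
    Real.sqrt_mul (sq_nonneg _), Real.sqrt_sq_eq_abs]

lemma contDiff_det_gram : ContDiff ℝ ∞ fun g : Bil (EucSp n) ↦ (gram g).det := by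
  simp only [Matrix.det_apply']
  refine ContDiff.sum fun s _ ↦ contDiff_const.mul (contDiff_prod fun i _ ↦ ?_)
  exact ((ContinuousLinearMap.apply ℝ ℝ (stdB n i)).comp
    (ContinuousLinearMap.apply ℝ (EucSp n →L[ℝ] ℝ) (stdB n (s i)))).contDiff

lemma IsMetricOn.contDiffOn_dens {g : EucSp n → Bil (EucSp n)} {O : Set (EucSp n)}
    (h : IsMetricOn g O) : ContDiffOn ℝ ∞ (fun y ↦ dens (g y)) O :=
  (contDiff_det_gram.comp_contDiffOn h.smooth).sqrt fun y hy ↦ (h.inner y hy).det_gram_pos.ne'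

end Density

section Volume

variable {n : ℕ} {X : Type*} [TopologicalSpace X] [ChartedSpace (EucSp n) X]
  [RiemannianBundle (fun x : X ↦ TangentSpace (𝓡 n) x)] [IsManifold (𝓡 n) ∞ X]
  [IsContMDiffRiemannianBundle (𝓡 n) ∞ (EucSp n) (fun x : X ↦ TangentSpace (𝓡 n) x)]
  [MeasurableSpace X] [BorelSpace X]

omit [RiemannianBundle (fun x : X ↦ TangentSpace (𝓡 n) x)] [IsManifold (𝓡 n) ∞ X]
  [IsContMDiffRiemannianBundle (𝓡 n) ∞ (EucSp n) (fun x : X ↦ TangentSpace (𝓡 n) x)] in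
lemma aemeasurable_chart (x : X) :
    AEMeasurable (extChartAt (𝓡 n) x).symm ((volume : Measure (EucSp n)).restrict (extChartAt (𝓡 n) x).target) :=
  (continuousOn_extChartAt_symm x).aemeasurable (isOpen_extChartAt_target x).measurableSet

lemma aemeasurable_dens (x : X) :
    AEMeasurable (fun y ↦ ENNReal.ofReal (dens (chartMetric (n := n) x y)))
      ((volume : Measure (EucSp n)).restrict (extChartAt (𝓡 n) x).target) :=
  ((isParam_chart x).isMetricOn.contDiffOn_dens.continuousOn.aemeasurable
    (isOpen_extChartAt_target x).measurableSet).ennreal_ofReal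

omit [IsManifold (𝓡 n) ∞ X]
  [IsContMDiffRiemannianBundle (𝓡 n) ∞ (EucSp n) (fun x : X ↦ TangentSpace (𝓡 n) x)]
  [BorelSpace X] in
lemma chartVolume_eq (x : X) : chartVolume (n := n) x
    = (((volume : Measure (EucSp n)).restrict (extChartAt (𝓡 n) x).target).withDensity
      fun y ↦ ENNReal.ofReal (dens (chartMetric x y))).map (extChartAt (𝓡 n) x).symm := rfl

/-- Integration against the measure of a chart, in coordinates. -/
lemma lintegral_chartVolume (x : X) {f : X → ℝ≥0∞} (hf : Measurable f) :
    ∫⁻ z, f z ∂(chartVolume (n := n) x)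
      = ∫⁻ y in (extChartAt (𝓡 n) x).target, ENNReal.ofReal (dens (chartMetric x y)) * f ((extChartAt (𝓡 n) x).symm y) := by
  have h1 := (aemeasurable_chart (n := n) x).mono_ac (withDensity_absolutelyContinuous _
    fun y ↦ ENNReal.ofReal (dens (chartMetric (n := n) x y)))
  rw [chartVolume_eq, lintegral_map' hf.aemeasurable h1,
    lintegral_withDensity_eq_lintegral_mul₀ (aemeasurable_dens x)
      (g := fun y ↦ f ((extChartAt (𝓡 n) x).symm y))
      (hf.comp_aemeasurable (aemeasurable_chart x))]
  rfl

lemma setLIntegral_chartVolume (x x' : X) {f : X → ℝ≥0∞} (hf : Measurable f) :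
    ∫⁻ z in (extChartAt (𝓡 n) x').source, f z ∂(chartVolume (n := n) x)
      = ∫⁻ y in (extChartAt (𝓡 n) x).target ∩ (extChartAt (𝓡 n) x).symm ⁻¹' (extChartAt (𝓡 n) x').source, ENNReal.ofReal (dens (chartMetric x y)) * f ((extChartAt (𝓡 n) x).symm y) := by
  have hS : MeasurableSet (extChartAt (𝓡 n) x').source := (isOpen_extChartAt_source x').measurableSet
  have hO : IsOpen ((extChartAt (𝓡 n) x).target ∩ (extChartAt (𝓡 n) x).symm ⁻¹' (extChartAt (𝓡 n) x').source) :=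
    (continuousOn_extChartAt_symm x).isOpen_inter_preimage (isOpen_extChartAt_target x)
      (isOpen_extChartAt_source x')
  rw [← lintegral_indicator hS, lintegral_chartVolume x (hf.indicator hS),
    ← lintegral_indicator (isOpen_extChartAt_target x).measurableSet,
    ← lintegral_indicator hO.measurableSet]
  refine lintegral_congr fun y ↦ ?_
  by_cases h1 : y ∈ (extChartAt (𝓡 n) x).target
  · by_cases h2 : (extChartAt (𝓡 n) x).symm y ∈ (extChartAt (𝓡 n) x').source
    · rw [Set.indicator_of_mem h1, Set.indicator_of_mem h2,
        Set.indicator_of_mem (show y ∈ (extChartAt (𝓡 n) x).target ∩ (extChartAt (𝓡 n) x).symm ⁻¹' (extChartAt (𝓡 n) x').source from ⟨h1, h2⟩)]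
    · rw [Set.indicator_of_mem h1, Set.indicator_of_notMem h2,
        Set.indicator_of_notMem (fun h ↦ h2 h.2), mul_zero]
  · rw [Set.indicator_of_notMem h1, Set.indicator_of_notMem (fun h ↦ h1 h.1)]

/-- The measures of two charts agree on the intersection of their domains, by the change of
variables formula. -/
lemma setLIntegral_chartVolume_comm (x x' : X) {f : X → ℝ≥0∞} (hf : Measurable f) :
    ∫⁻ z in (extChartAt (𝓡 n) x').source, f z ∂(chartVolume (n := n) x) = ∫⁻ z in (extChartAt (𝓡 n) x).source, f z ∂(chartVolume (n := n) x') := by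
  rw [setLIntegral_chartVolume x x' hf, setLIntegral_chartVolume x' x hf]
  have hP := isParam_chart (n := n) x
  have him : (extChartAt (𝓡 n) x').target ∩ (extChartAt (𝓡 n) x').symm ⁻¹' (extChartAt (𝓡 n) x).source = trans (extChartAt (𝓡 n) x).symm x' '' ((extChartAt (𝓡 n) x).target ∩ (extChartAt (𝓡 n) x).symm ⁻¹' (extChartAt (𝓡 n) x').source) := by
    ext y
    constructor
    · rintro ⟨h1, h2⟩
      refine ⟨extChartAt (𝓡 n) x ((extChartAt (𝓡 n) x').symm y), ⟨(extChartAt (𝓡 n) x).map_source h2, ?_⟩, ?_⟩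
      · rw [Set.mem_preimage, (extChartAt (𝓡 n) x).left_inv h2]
        exact (extChartAt (𝓡 n) x').map_target h1
      · rw [trans, (extChartAt (𝓡 n) x).left_inv h2, (extChartAt (𝓡 n) x').right_inv h1]
    · rintro ⟨w, ⟨h1, h2⟩, rfl⟩
      refine ⟨IsParam.trans_mem h2, ?_⟩
      rw [Set.mem_preimage, trans, (extChartAt (𝓡 n) x').left_inv h2]
      exact (extChartAt (𝓡 n) x).map_target h1
  have hO : IsOpen ((extChartAt (𝓡 n) x).target ∩ (extChartAt (𝓡 n) x).symm ⁻¹' (extChartAt (𝓡 n) x').source) :=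
    (continuousOn_extChartAt_symm x).isOpen_inter_preimage (isOpen_extChartAt_target x)
      (isOpen_extChartAt_source x')
  rw [him, lintegral_image_eq_lintegral_abs_det_fderiv_mul _ hO.measurableSet
    (f' := fderiv ℝ (trans (extChartAt (𝓡 n) x).symm x'))]
  · refine setLIntegral_congr_fun hO.measurableSet fun y hy ↦ ?_
    have h1 : chartMetric x y = (chartMetric x' (trans (extChartAt (𝓡 n) x).symm x' y)).bilinearComp
        (fderiv ℝ (trans (extChartAt (𝓡 n) x).symm x') y) (fderiv ℝ (trans (extChartAt (𝓡 n) x).symm x') y) := by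
      ext1 u
      ext1 v
      exact hP.pullMetric_eq hy.1 hy.2 u v
    rw [h1, dens_bilinearComp, ENNReal.ofReal_mul (abs_nonneg _), mul_assoc]
    congr 3
    rw [trans, (extChartAt (𝓡 n) x').left_inv hy.2]
  · exact fun y hy ↦ ((hP.contDiffAt_trans hy.1 hy.2).differentiableAt
      (by simp)).hasFDerivAt.hasFDerivWithinAt
  · intro y hy w hw h
    have h2 := (extChartAt (𝓡 n) x').injOn hy.2 hw.2 h
    exact (extChartAt (𝓡 n) x).symm.injOn hy.1 hw.1 h2

lemma chartVolume_restrict_comm (x x' : X) : (chartVolume (n := n) x).restrict (extChartAt (𝓡 n) x').source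
    = (chartVolume (n := n) x').restrict (extChartAt (𝓡 n) x).source := by
  ext A hA
  have := setLIntegral_chartVolume_comm (n := n) x x' (measurable_one.indicator hA)
  rwa [lintegral_indicator_one hA, lintegral_indicator_one hA] at this

lemma chartVolume_restrict_source (x : X) :
    (chartVolume (n := n) x).restrict (extChartAt (𝓡 n) x).source = chartVolume (n := n) x := by
  refine Measure.restrict_eq_self_of_ae_mem ?_
  have h1 := (aemeasurable_chart (n := n) x).mono_ac (withDensity_absolutelyContinuous _
    fun y ↦ ENNReal.ofReal (dens (chartMetric (n := n) x y)))
  have hS : MeasurableSet {z | z ∈ (extChartAt (𝓡 n) x).source} :=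
    (isOpen_extChartAt_source x).measurableSet
  rw [chartVolume_eq, ae_map_iff h1 hS]
  refine (withDensity_absolutelyContinuous _ _).ae_le ?_
  filter_upwards [self_mem_ae_restrict (isOpen_extChartAt_target x).measurableSet] with y hy
  exact (extChartAt (𝓡 n) x).map_target hy

/-- On the domain of each chart the Riemannian measure, a supremum over all charts, is the measure
of this chart. -/
lemma riemVolume_restrict (x : X) :
    (riemVolume n X).restrict (extChartAt (𝓡 n) x).source = chartVolume (n := n) x := by
  have hS : MeasurableSet (extChartAt (𝓡 n) x).source := (isOpen_extChartAt_source x).measurableSet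
  refine le_antisymm ?_ ?_
  · have h1 : riemVolume n X ≤ chartVolume (n := n) x + (⊤ : Measure X).restrict (extChartAt (𝓡 n) x).sourceᶜ := by
      refine iSup_le fun x' ↦ ?_
      rw [← Measure.restrict_add_restrict_compl (μ := chartVolume (n := n) x') hS]
      refine add_le_add ?_ (Measure.restrict_mono le_rfl le_top)
      rw [chartVolume_restrict_comm]
      exact Measure.restrict_le_self
    refine (Measure.restrict_mono le_rfl h1).trans ?_
    rw [Measure.restrict_add, Measure.restrict_restrict hS, Set.inter_compl_self,
      Measure.restrict_empty, add_zero]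
    exact Measure.restrict_le_self
  · rw [← chartVolume_restrict_source (n := n)]
    exact Measure.restrict_mono le_rfl (le_iSup (fun x : X ↦ chartVolume (n := n) x) x)

end Volume

end

/-! ### The divergence in coordinates -/

section

open RiemForm Bundle

section Jacobi

variable {n : ℕ}

lemma hasDerivAt_det_add_smul (A C : Matrix (Fin n) (Fin n) ℝ) :
    HasDerivAt (fun t : ℝ ↦ (A + t • (A * C)).det) (A.det * C.trace) 0 := by
  have h1 : ∀ t : ℝ, (A + t • (A * C)).det = A.det *
      (Matrix.det (1 + (Polynomial.X : Polynomial ℝ) • C.map Polynomial.C)).eval t := fun t ↦ by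
    have h2 : (Matrix.det (1 + (Polynomial.X : Polynomial ℝ) • C.map Polynomial.C)).eval t
        = (1 + t • C).det := by
      rw [← Polynomial.coe_evalRingHom, RingHom.map_det]
      congr 1
      ext i j
      simp only [RingHom.mapMatrix_apply, Matrix.map_apply, Matrix.add_apply, Matrix.smul_apply,
        smul_eq_mul, Polynomial.coe_evalRingHom, Polynomial.eval_add, Polynomial.eval_mul,
        Polynomial.eval_X, Polynomial.eval_C, Matrix.one_apply]
      split_ifs <;> simp
    rw [h2, ← Matrix.det_mul, mul_add, mul_one, mul_smul_comm]
  simp only [h1]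
  rw [← Matrix.derivative_det_one_add_X_smul C]
  exact (Polynomial.hasDerivAt _ _).const_mul _

/-- Jacobi's formula for the determinant of the Gram matrix. -/
lemma fderiv_det_gram (g B : Bil (EucSp n)) (C : Matrix (Fin n) (Fin n) ℝ)
    (h : gram B = gram g * C) :
    fderiv ℝ (fun g : Bil (EucSp n) ↦ (gram g).det) g B = (gram g).det * C.trace := by
  have h1 : HasDerivAt (fun t : ℝ ↦ g + t • B) B 0 := by
    simpa using ((hasDerivAt_id (0 : ℝ)).smul_const B).const_add g
  have h2 : HasFDerivAt (fun g : Bil (EucSp n) ↦ (gram g).det)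
      (fderiv ℝ (fun g : Bil (EucSp n) ↦ (gram g).det) g) (g + (0 : ℝ) • B) := by
    rw [zero_smul, add_zero]
    exact (contDiff_det_gram.differentiable (by simp) g).hasFDerivAt
  have h3 := h2.comp_hasDerivAt (0 : ℝ) h1
  refine h3.unique ?_
  have h4 : ((fun g : Bil (EucSp n) ↦ (gram g).det) ∘ fun t : ℝ ↦ g + t • B)
      = fun t ↦ (gram g + t • (gram g * C)).det := by
    funext t
    rw [← h]
    rfl
  rw [h4]
  exact hasDerivAt_det_add_smul _ _

variable {g : EucSp n → Bil (EucSp n)} {O : Set (EucSp n)} {y : EucSp n}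

/-- The logarithmic derivative of the density is the trace of the Christoffel symbols. -/
lemma IsMetricOn.hasFDerivAt_dens (h : IsMetricOn g O) (hy : y ∈ O) :
    ∃ D : EucSp n →L[ℝ] ℝ, HasFDerivAt (fun z ↦ dens (g z)) D y ∧
      ∀ u, D u = dens (g y) * ∑ k, stdC n k (chr g y u (stdB n k)) := by
  have hpos := (h.inner y hy).det_gram_pos
  have h1 : HasFDerivAt (fun z ↦ (gram (g z)).det)
      (fderiv ℝ (fun g : Bil (EucSp n) ↦ (gram g).det) (g y) ∘L fderiv ℝ g y) y :=
    (contDiff_det_gram.differentiable (by simp) (g y)).hasFDerivAt.comp y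
      (h.differentiableAt hy).hasFDerivAt
  refine ⟨_, h1.sqrt hpos.ne', fun u ↦ ?_⟩
  let N : Matrix (Fin n) (Fin n) ℝ := Matrix.of fun k j ↦ stdC n k (chr g y u (stdB n j))
  have hN : ∀ i j, (gram (g y) * N) i j = g y (stdB n i) (chr g y u (stdB n j)) := fun i j ↦ by
    have := (dualBases_std n).sum_eq (chr g y u (stdB n j))
    conv_rhs => rw [← this]
    simp only [Matrix.mul_apply, map_sum, map_smul, smul_eq_mul]
    exact Finset.sum_congr rfl fun k _ ↦ mul_comm _ _
  have hsym : (gram (g y)).transpose = gram (g y) := by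
    ext i j
    exact (h.inner y hy).symm _ _
  -- metric compatibility: `∂ᵤ G = G N + (G N)ᵀ`, where `G` is the Gram matrix and `N` the matrix
  -- of `Γ(u, ·)`
  have h2 : gram (fderiv ℝ g y u)
      = gram (g y) * ((gram (g y))⁻¹ * N.transpose * gram (g y) + N) := by
    have h3 : gram (g y) * ((gram (g y))⁻¹ * N.transpose * gram (g y))
        = (gram (g y) * N).transpose := by
      rw [Matrix.transpose_mul, hsym, ← mul_assoc, ← mul_assoc,
        Matrix.mul_nonsing_inv _ (isUnit_iff_ne_zero.2 hpos.ne'), one_mul]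
    rw [mul_add, h3]
    ext i j
    rw [Matrix.add_apply, Matrix.transpose_apply, hN, hN, (h.inner y hy).symm (stdB n j)]
    exact h.fderiv_eq hy u _ _
  have h4 : ((gram (g y))⁻¹ * N.transpose * gram (g y) + N).trace = 2 * N.trace := by
    rw [Matrix.trace_add, Matrix.trace_mul_comm, ← mul_assoc,
      Matrix.mul_nonsing_inv _ (isUnit_iff_ne_zero.2 hpos.ne'), one_mul, Matrix.trace_transpose]
    ring
  have h5 : fderiv ℝ (fun g : Bil (EucSp n) ↦ (gram g).det) (g y) (fderiv ℝ g y u)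
      = (gram (g y)).det * (2 * N.trace) := by rw [fderiv_det_gram _ _ _ h2, h4]
  change (1 / (2 * √(gram (g y)).det)) * (fderiv ℝ (fun g : Bil (EucSp n) ↦ (gram g).det) (g y)
    (fderiv ℝ g y u)) = √(gram (g y)).det * N.trace
  rw [h5]
  have h6 := Real.sq_sqrt hpos.le
  have h7 := (Real.sqrt_pos.2 hpos).ne'
  rw [div_mul_eq_mul_div, div_eq_iff (by positivity)]
  linear_combination (-2 * N.trace) * h6

end Jacobi

section Divergence

variable {V : Type*} [NormedAddCommGroup V] [NormedSpace ℝ V]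

/-- The covector given by a `1`-form. -/
def ofOne : Alt V 1 →L[ℝ] V →L[ℝ] ℝ :=
  (ContinuousLinearMap.compL ℝ V (Alt V 0) ℝ (ContinuousAlternatingMap.apply ℝ V ℝ ![])) ∘L
    (ins 0).flip

lemma ofOne_apply (a : Alt V 1) (v : V) : ofOne a v = ins 0 v a ![] := rfl

lemma ofOne_der (A : V →L[ℝ] V) (a : Alt V 1) (v : V) : ofOne (der A a) v = ofOne a (A v) := by
  change der A a ![v] = a ![A v]
  rw [der_apply, Fin.sum_univ_one]
  congr 1
  ext i
  fin_cases i
  rfl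

lemma ofOne_cov (g : V → Bil V) (a : V → Alt V 1) (y u v : V) :
    ofOne (cov g a y u) v = ofOne (fderiv ℝ a y u) v - ofOne (a y) (chr g y u v) := by
  rw [cov_apply, map_sub, sub_apply, ofOne_der]

variable [FiniteDimensional ℝ V] {g : V → Bil V} {O : Set V} {y : V}
  {ι : Type*} [Fintype ι] [DecidableEq ι] {s : ι → V} {σ : ι → V →L[ℝ] ℝ}

lemma IsMetricOn.differentiableAt_frame (h : IsMetricOn g O) (hy : y ∈ O) (i : ι) :
    DifferentiableAt ℝ (fun z ↦ frame g σ z i) y :=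
  ((h.contDiffOn_frame i).contDiffAt (h.isOpen.mem_nhds hy)).differentiableAt (by simp)

/-- The divergence of the dual frame, which is the derivative of the equations `g(σₖ♯, v) = σₖ(v)`.
-/
lemma IsMetricOn.sum_fderiv_frame (h : IsMetricOn g O) (hy : y ∈ O) (hs : DualBases s σ) :
    ∑ k, fderiv ℝ (fun z ↦ frame g σ z k) y (s k)
      = - ∑ k, chr g y (s k) (frame g σ y k)
        - ∑ k, (∑ i, σ i (chr g y (s k) (s i))) • frame g σ y k := by
  refine (h.inner y hy).eq_of_forall fun v ↦ ?_
  have hF : ∀ k w, g y (frame g σ y k) w = σ k w := fun k w ↦ by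
    rw [frame, (h.inner y hy).apply_sharp]
  have h1 : ∀ k, g y (fderiv ℝ (fun z ↦ frame g σ z k) y (s k)) v
      = - g y (chr g y (s k) (frame g σ y k)) v - σ k (chr g y (s k) v) := fun k ↦ by
    have h2 := hasFDerivAt_bil_apply (h.differentiableAt hy).hasFDerivAt
      (h.differentiableAt_frame (σ := σ) hy k).hasFDerivAt (hasFDerivAt_const v y) (s k)
    have h3 : (fun z ↦ g z (frame g σ z k) v) =ᶠ[𝓝 y] fun _ ↦ σ k v :=
      Filter.eventually_of_mem (h.isOpen.mem_nhds hy) fun z hz ↦ by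
        change g z (sharp (g z) (σ k)) v = _
        rw [(h.inner z hz).apply_sharp]
    rw [h3.fderiv_eq, fderiv_fun_const, h.fderiv_eq hy, hF] at h2
    simp only [Pi.zero_apply, zero_apply, map_zero, add_zero] at h2
    linarith
  have h4 : ∑ k, (∑ i, σ i (chr g y (s k) (s i))) * σ k v = ∑ k, σ k (chr g y (s k) v) := by
    have h5 : ∀ i, σ i (chr g y (s i) v) = ∑ k, σ k v * σ i (chr g y (s k) (s i)) := fun i ↦ by
      rw [h.chr_symm hy (s i) v]
      conv_lhs => rw [← hs.sum_eq v]
      simp only [map_sum, map_smul, sum_apply, smul_apply, smul_eq_mul]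
    simp only [h5]
    rw [Finset.sum_comm]
    refine Finset.sum_congr rfl fun k _ ↦ ?_
    rw [Finset.sum_mul]
    exact Finset.sum_congr rfl fun i _ ↦ mul_comm _ _
  simp only [map_sub, map_neg, map_sum, map_smul, sub_apply, neg_apply, sum_apply, smul_apply,
    smul_eq_mul, h1, hF, Finset.sum_sub_distrib, Finset.sum_neg_distrib, h4]

end Divergence

section

variable {n : ℕ} {g : EucSp n → Bil (EucSp n)} {O : Set (EucSp n)} {y : EucSp n}

/-- The `k`-th component of the vector field dual to a `1`-form, multiplied by the density. -/
def flux (g : EucSp n → Bil (EucSp n)) (a : EucSp n → Alt (EucSp n) 1) (k : Fin n) (z : EucSp n) :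
    ℝ := dens (g z) * ofOne (a z) (frame g (stdC n) z k)

lemma IsMetricOn.contDiffOn_flux (h : IsMetricOn g O) {a : EucSp n → Alt (EucSp n) 1}
    (ha : ContDiffOn ℝ ∞ a O) (k : Fin n) : ContDiffOn ℝ ∞ (flux g a k) O := by
  have h1 : ContDiffOn ℝ ∞ (fun z ↦ ofOne (a z)) O :=
    (ofOne (V := EucSp n)).contDiff.comp_contDiffOn ha
  exact h.contDiffOn_dens.mul (h1.clm_apply (h.contDiffOn_frame k))

/-- The codifferential of a `1`-form is minus the divergence of the dual vector field: `√g d* a = -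
∑ ∂ₖ (√g aᵏ)`. -/
lemma IsMetricOn.dens_mul_codiffOn (h : IsMetricOn g O) (hy : y ∈ O)
    {a : EucSp n → Alt (EucSp n) 1} (ha : DifferentiableAt ℝ a y) :
    dens (g y) * codiffOn g (stdB n) (stdC n) a y ![]
      = - ∑ k, fderiv ℝ (flux g a k) y (stdB n k) := by
  obtain ⟨D, hD, hD'⟩ := h.hasFDerivAt_dens hy
  have h1 : ∀ k, fderiv ℝ (flux g a k) y (stdB n k)
      = dens (g y) * ((∑ i, stdC n i (chr g y (stdB n k) (stdB n i))) *
          ofOne (a y) (frame g (stdC n) y k)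
        + ofOne (fderiv ℝ a y (stdB n k)) (frame g (stdC n) y k)
        + ofOne (a y) (fderiv ℝ (fun z ↦ frame g (stdC n) z k) y (stdB n k))) := fun k ↦ by
    have h2 := (hasFDerivAt_clm ofOne ha.hasFDerivAt).clm_apply
      (h.differentiableAt_frame (σ := stdC n) hy k).hasFDerivAt
    have h3 := (hD.mul h2).fderiv
    have h4 : fderiv ℝ (flux g a k) y = _ := h3
    rw [h4]
    simp only [add_apply, smul_apply, ContinuousLinearMap.comp_apply,
      ContinuousLinearMap.flip_apply, smul_eq_mul, hD']
    ring
  have h5 : codiffOn g (stdB n) (stdC n) a y ![]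
      = - ∑ k, ofOne (cov g a y (stdB n k)) (frame g (stdC n) y k) := by
    rw [codiffOn, ContinuousAlternatingMap.neg_apply, ContinuousAlternatingMap.sum_apply]
    rfl
  have h6 := congrArg (ofOne (a y)) (h.sum_fderiv_frame hy (dualBases_std n))
  simp only [map_sub, map_neg, map_sum, map_smul, smul_eq_mul] at h6
  rw [h5]
  simp only [h1, ofOne_cov, ← Finset.mul_sum, Finset.sum_add_distrib, Finset.sum_sub_distrib, h6]
  ring

end

end

/-! ### Continuity, and Lipschitz functions on a Riemannian manifold -/

section

open RiemForm Bundle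

section Continuity

variable {n : ℕ} {X : Type*} [TopologicalSpace X] [ChartedSpace (EucSp n) X]

/-- Continuity may be checked in charts. -/
lemma continuous_of_chart {Y : Type*} [TopologicalSpace Y] {f : X → Y}
    (h : ∀ x, ContinuousOn (fun z ↦ f ((extChartAt (𝓡 n) x).symm z)) (extChartAt (𝓡 n) x).target) :
    Continuous f := by
  rw [continuous_iff_continuousAt]
  intro x
  have h1 := ((h x).continuousAt ((isOpen_extChartAt_target x).mem_nhds
    (mem_extChartAt_target x))).comp (continuousAt_extChartAt (I := 𝓡 n) x)
  refine h1.congr ?_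
  filter_upwards [(isOpen_extChartAt_source (I := 𝓡 n) x).mem_nhds (mem_extChartAt_source x)]
    with y hy
  simp only [Function.comp_apply]
  rw [(extChartAt (𝓡 n) x).left_inv hy]

lemma continuous_apply_zero {a : DForm n X 0} (ha : a.IsSmooth) : Continuous fun x ↦ a x ![] := by
  refine continuous_of_chart (n := n) fun x ↦ ?_
  have h1 := (ContinuousAlternatingMap.apply ℝ (EucSp n) ℝ ![]).continuous.comp_continuousOn
    (ha x).continuousOn
  refine h1.congr fun z _ ↦ ?_
  change a ((extChartAt (𝓡 n) x).symm z) ![] = a ((extChartAt (𝓡 n) x).symm z) _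
  congr 1
  exact Subsingleton.elim _ _

variable [RiemannianBundle (fun x : X ↦ TangentSpace (𝓡 n) x)] [IsManifold (𝓡 n) ∞ X]
  [IsContMDiffRiemannianBundle (𝓡 n) ∞ (EucSp n) (fun x : X ↦ TangentSpace (𝓡 n) x)]

lemma continuous_pointInner {p : ℕ} {a b : DForm n X p} (ha : a.IsSmooth) (hb : b.IsSmooth) :
    Continuous (a.pointInner b) := by
  refine continuous_of_chart (n := n) fun x ↦ ?_
  have hP := isParam_chart (n := n) x
  refine ContinuousOn.congr ?_ fun z hz ↦ hP.pointInner_eq hz a b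
  exact (contDiffOn_inn _ (hP.isMetricOn.contDiffOn_frame) (hP.contDiffOn_pull ha)
    (hP.contDiffOn_pull hb)).continuousOn

lemma continuous_pointNorm {p : ℕ} {a : DForm n X p} (ha : a.IsSmooth) : Continuous a.pointNorm :=
  (continuous_pointInner ha ha).sqrt

variable [MeasurableSpace X] [BorelSpace X]

lemma integral_chartVolume [T2Space X] [SecondCountableTopology X] (x : X) {f : X → ℝ}
    (hf : Continuous f) :
    ∫ z, f z ∂(chartVolume (n := n) x) = ∫ y in (extChartAt (𝓡 n) x).target,
      dens (chartMetric x y) * f ((extChartAt (𝓡 n) x).symm y) := by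
  have h1 := (aemeasurable_chart (n := n) x).mono_ac (withDensity_absolutelyContinuous _
    fun y ↦ ENNReal.ofReal (dens (chartMetric (n := n) x y)))
  rw [chartVolume_eq, integral_map h1 hf.measurable.aestronglyMeasurable,
    integral_withDensity_eq_integral_toReal_smul₀ (aemeasurable_dens x)
      (Filter.Eventually.of_forall fun _ ↦ ENNReal.ofReal_lt_top)]
  refine integral_congr_ae (Filter.Eventually.of_forall fun y ↦ ?_)
  simp only [smul_eq_mul]
  rw [ENNReal.toReal_ofReal (show 0 ≤ dens (chartMetric x y) from Real.sqrt_nonneg _)]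

end Continuity

section Dist

variable {n : ℕ} {X : Type*} [MetricSpace X] [ChartedSpace (EucSp n) X]
  [RiemannianBundle (fun x : X ↦ TangentSpace (𝓡 n) x)]

lemma enorm_tangent (x : X) (v : TangentSpace (𝓡 n) x) :
    ‖v‖ₑ = ENNReal.ofReal √(metricAt (n := n) x v v) := by
  rw [← ofReal_norm, norm_eq_sqrt_real_inner]
  rfl

variable [IsManifold (𝓡 n) ∞ X] [IsRiemannianManifold (𝓡 n) X]
  {ψ : EucSp n → X} {O : Set (EucSp n)}

/-- The Riemannian distance is at most the length of the image of a segment. -/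
lemma IsParam.dist_le (h : IsParam ψ O) {a b : EucSp n} (hab : segment ℝ a b ⊆ O) {C : ℝ}
    (hC : 0 ≤ C) (hb : ∀ z ∈ segment ℝ a b, pullMetric ψ z (b - a) (b - a) ≤ C ^ 2) :
    dist (ψ a) (ψ b) ≤ C := by
  let l : ℝ → EucSp n := fun t ↦ a + t • (b - a)
  have hl : ∀ t ∈ Set.Icc (0 : ℝ) 1, l t ∈ segment ℝ a b := fun t ht ↦ by
    rw [segment_eq_image']
    exact ⟨t, ht, rfl⟩
  have hls : ContDiff ℝ ∞ l := contDiff_const.add (contDiff_id.smul contDiff_const)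
  have hld : ∀ t, HasFDerivAt l ((ContinuousLinearMap.id ℝ ℝ).smulRight (b - a)) t := fun t ↦ by
    exact ((hasFDerivAt_id t).smul_const (b - a)).const_add a
  have h1 : ContMDiffOn 𝓘(ℝ, ℝ) (𝓡 n) 1 (ψ ∘ l) (Set.Icc 0 1) :=
    (h.smooth.comp hls.contMDiff.contMDiffOn fun t ht ↦ hab (hl t ht)).of_le (by simp)
  have h2 : edist (ψ a) (ψ b) ≤ ENNReal.ofReal C := by
    rw [IsRiemannianManifold.out (I := 𝓡 n) (ψ a) (ψ b)]
    refine (Manifold.riemannianEDist_le_pathELength (γ := ψ ∘ l) h1 (by simp [l]) (by simp [l])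
      zero_le_one).trans ?_
    rw [Manifold.pathELength_eq_lintegral_mfderiv_Icc]
    have h3 : ∀ t ∈ Set.Icc (0 : ℝ) 1, ‖mfderiv 𝓘(ℝ, ℝ) (𝓡 n) (ψ ∘ l) t 1‖ₑ ≤ ENNReal.ofReal C := by
      intro t ht
      have h4 : (mfderiv 𝓘(ℝ, ℝ) (𝓡 n) (ψ ∘ l) t 1 : EucSp n) = dParam ψ (l t) (b - a) := by
        have h5 := mfderiv_comp t (h.mdifferentiableAt (hab (hl t ht)))
          (hld t).differentiableAt.mdifferentiableAt
        rw [mfderiv_eq_fderiv, (hld t).fderiv] at h5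
        refine (congrArg (fun L : ℝ →L[ℝ] EucSp n ↦ L 1) h5).trans ?_
        change dParam ψ (l t) ((1 : ℝ) • (b - a)) = _
        rw [one_smul]
      rw [enorm_tangent]
      refine ENNReal.ofReal_le_ofReal (Real.sqrt_le_iff.2 ⟨hC, ?_⟩)
      refine Eq.trans_le ?_ (hb (l t) (hl t ht))
      exact congrArg (fun v : EucSp n ↦ metricAt (ψ (l t)) v v) h4
    refine (setLIntegral_mono' measurableSet_Icc h3).trans ?_
    simp
  rw [edist_dist] at h2
  exact (ENNReal.ofReal_le_ofReal_iff hC).1 h2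

/-- The local Lipschitz constant (slope) of `f` at `x` is at most `w`, as a limit superior. A
pointwise notion is needed, since for cutoff functions the bound depends on the region. -/
def SlopeLE {X : Type*} [MetricSpace X] (f : X → ℝ) (w : ℝ) (x : X) : Prop :=
  ∀ ε > 0, ∀ᶠ y in 𝓝 x, |f y - f x| ≤ (w + ε) * dist x y

variable [IsContMDiffRiemannianBundle (𝓡 n) ∞ (EucSp n) (fun x : X ↦ TangentSpace (𝓡 n) x)]

lemma IsParam.locallyLipschitzOn (h : IsParam ψ O) : LocallyLipschitzOn O ψ := by
  intro y hy
  have h1 : ContinuousAt (fun z ↦ ‖pullMetric ψ z‖) y :=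
    (h.isMetricOn.contDiffAt hy).continuousAt.norm
  have h2 : ∀ᶠ z in 𝓝 y, z ∈ O ∧ ‖pullMetric ψ z‖ < ‖pullMetric ψ y‖ + 1 :=
    (Filter.eventually_of_mem (h.mem_nhds hy) fun _ hz ↦ hz).and
      (h1.eventually_lt continuousAt_const (lt_add_one _))
  obtain ⟨r, hr, hball⟩ := Metric.eventually_nhds_iff_ball.1 h2
  refine ⟨Real.toNNReal √(‖pullMetric ψ y‖ + 1), Metric.ball y r,
    mem_nhdsWithin_of_mem_nhds (Metric.ball_mem_nhds y hr), ?_⟩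
  refine LipschitzOnWith.of_dist_le_mul fun a ha b hb ↦ ?_
  have hseg : segment ℝ a b ⊆ Metric.ball y r := (convex_ball y r).segment_subset ha hb
  rw [Real.coe_toNNReal _ (Real.sqrt_nonneg _)]
  refine h.dist_le (fun z hz ↦ (hball z (hseg hz)).1) (by positivity) fun z hz ↦ ?_
  rw [mul_pow, Real.sq_sqrt (by positivity), dist_comm, dist_eq_norm]
  have h3 := (hball z (hseg hz)).2.le
  calc pullMetric ψ z (b - a) (b - a) ≤ ‖pullMetric ψ z (b - a) (b - a)‖ := le_abs_self _
    _ ≤ ‖pullMetric ψ z‖ * ‖b - a‖ * ‖b - a‖ := ContinuousLinearMap.le_opNorm₂ _ _ _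
    _ ≤ (‖pullMetric ψ y‖ + 1) * ‖b - a‖ ^ 2 := by rw [mul_assoc, ← sq]; gcongr

/-- The gradient of a function is bounded by its slope, at points where the function is
differentiable. -/
lemma IsParam.abs_fderiv_le (h : IsParam ψ O) {y : EucSp n} (hy : y ∈ O) {f : X → ℝ} {w : ℝ}
    (hw : 0 ≤ w) (hf : SlopeLE f w (ψ y)) {F : EucSp n → ℝ} (hF : DifferentiableAt ℝ F y)
    (hfF : F =ᶠ[𝓝 y] fun z ↦ f (ψ z)) (v : EucSp n) :
    |fderiv ℝ F y v| ≤ w * √(pullMetric ψ y v v) := by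
  have key : ∀ ε > 0, |fderiv ℝ F y v| ≤ (w + ε) * √(pullMetric ψ y v v + ε) := by
    intro ε hε
    have hlim : Filter.Tendsto (fun t : ℝ ↦ |t⁻¹ • (F (y + t • v) - F y)|) (𝓝[>] 0)
        (𝓝 |fderiv ℝ F y v|) :=
      (hF.hasFDerivAt.hasLineDerivAt v).tendsto_slope_zero_right.abs
    have hline : Filter.Tendsto (fun t : ℝ ↦ y + t • v) (𝓝 0) (𝓝 y) := by
      have : Continuous fun t : ℝ ↦ y + t • v := by fun_prop
      simpa using this.tendsto 0
    have hcont : ContinuousAt (fun z ↦ pullMetric ψ z v v) y :=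
      (((h.isMetricOn.contDiffAt hy).continuousAt).clm_apply continuousAt_const).clm_apply
        continuousAt_const
    have h2 : ∀ᶠ z in 𝓝 y, z ∈ O ∧ pullMetric ψ z v v < pullMetric ψ y v v + ε :=
      (Filter.eventually_of_mem (h.mem_nhds hy) fun _ hz ↦ hz).and
        (hcont.eventually_lt continuousAt_const (lt_add_of_pos_right _ hε))
    obtain ⟨r, hr, hball⟩ := Metric.eventually_nhds_iff_ball.1 h2
    have hev := ((((h.continuousAt hy).eventually (hf ε hε)).and hfF).and
      (Filter.eventually_of_mem (Metric.ball_mem_nhds y hr) fun _ hz ↦ hz))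
    refine le_of_tendsto hlim ?_
    filter_upwards [(hline.eventually hev).filter_mono nhdsWithin_le_nhds, self_mem_nhdsWithin]
      with t ⟨⟨h3, h4⟩, h5⟩ ht
    have ht0 : (0 : ℝ) < t := ht
    have hpos : 0 ≤ pullMetric ψ y v v + ε := by
      have := (hball y (Metric.mem_ball_self hr)).2
      have h6 : 0 ≤ pullMetric ψ y v v := by
        by_cases hv : v = 0
        · simp [hv]
        · exact ((h.isMetricOn.inner y hy).pos v hv).le
      linarith
    -- near `y` the metric is at most `g_y(v, v) + ε` in the direction `v`
    have hd : dist (ψ y) (ψ (y + t • v)) ≤ t * √(pullMetric ψ y v v + ε) := by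
      have hseg : segment ℝ y (y + t • v) ⊆ Metric.ball y r :=
        (convex_ball y r).segment_subset (Metric.mem_ball_self hr) h5
      refine h.dist_le (fun z hz ↦ (hball z (hseg hz)).1) (by positivity) fun z hz ↦ ?_
      have h6 : pullMetric ψ z (t • v) (t • v) = t ^ 2 * pullMetric ψ z v v := by
        simp only [map_smul, smul_apply, smul_eq_mul]; ring
      rw [add_sub_cancel_left, mul_pow, Real.sq_sqrt hpos, h6]
      exact mul_le_mul_of_nonneg_left (hball z (hseg hz)).2.le (sq_nonneg t)
    rw [h4, hfF.self_of_nhds, smul_eq_mul, abs_mul, abs_of_pos (inv_pos.2 ht0),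
      inv_mul_le_iff₀ ht0]
    calc |f (ψ (y + t • v)) - f (ψ y)| ≤ (w + ε) * dist (ψ y) (ψ (y + t • v)) := h3
      _ ≤ (w + ε) * (t * √(pullMetric ψ y v v + ε)) := by gcongr
      _ = t * ((w + ε) * √(pullMetric ψ y v v + ε)) := by ring
  have hlim : Filter.Tendsto (fun ε : ℝ ↦ (w + ε) * √(pullMetric ψ y v v + ε)) (𝓝[>] 0)
      (𝓝 (w * √(pullMetric ψ y v v))) := by
    have : Continuous fun ε : ℝ ↦ (w + ε) * √(pullMetric ψ y v v + ε) := by fun_prop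
    have h1 := this.tendsto 0
    simp only [add_zero] at h1
    exact h1.mono_left nhdsWithin_le_nhds
  refine ge_of_tendsto hlim ?_
  filter_upwards [self_mem_nhdsWithin] with ε hε
  exact key ε hε

end Dist

end

/-! ### The divergence theorem in a chart -/

section

open RiemForm Bundle

section Euclidean

variable {n : ℕ}

/-- Integration by parts for a Lipschitz function and a compactly supported vector field; the
derivatives of `F` exist almost everywhere, by Rademacher's theorem. -/
lemma integral_mul_divergence {L : NNReal} {F : EucSp n → ℝ} (hF : LipschitzWith L F)
    {H : Fin n → EucSp n → ℝ} (hH : ∀ k, ContDiff ℝ ∞ (H k)) (hc : ∀ k, HasCompactSupport (H k)) :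
    ∫ y, F y * ∑ k, fderiv ℝ (H k) y (stdB n k)
      = - ∫ y, ∑ k, lineDeriv ℝ F y (stdB n k) * H k y := by
  have h1 : ∀ k, Integrable (fun y ↦ F y * fderiv ℝ (H k) y (stdB n k)) := fun k ↦ by
    refine Continuous.integrable_of_hasCompactSupport ?_ ?_
    · exact hF.continuous.mul (((hH k).continuous_fderiv (by simp)).clm_apply continuous_const)
    · exact ((hc k).fderiv_apply (𝕜 := ℝ) (stdB n k)).mul_left
  have h2 : ∀ k, Integrable (fun y ↦ lineDeriv ℝ F y (stdB n k) * H k y) := fun k ↦ by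
    have := (hF.locallyIntegrable_lineDeriv (μ := volume)
      (stdB n k)).integrable_smul_right_of_hasCompactSupport (hH k).continuous (hc k)
    simpa only [smul_eq_mul] using this
  simp only [Finset.mul_sum]
  rw [integral_finsetSum _ fun k _ ↦ h1 k, integral_finsetSum _ fun k _ ↦ h2 k,
    ← Finset.sum_neg_distrib]
  refine Finset.sum_congr rfl fun k _ ↦ ?_
  obtain ⟨D, hD⟩ := ContDiff.lipschitzWith_of_hasCompactSupport (hc k) (hH k) (by simp)
  rw [hF.integral_lineDeriv_mul_eq hD (hc k), ← integral_neg]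
  refine integral_congr_ae (Filter.Eventually.of_forall fun y ↦ ?_)
  simp only
  rw [(((hH k).differentiable (by simp)) y).lineDeriv_eq_fderiv, map_neg]
  ring

variable {g : EucSp n → Bil (EucSp n)} {O : Set (EucSp n)} {y : EucSp n}

lemma IsMetricOn.sum_flux (h : IsMetricOn g O) (hy : y ∈ O) (a : EucSp n → Alt (EucSp n) 1) :
    ∑ k, flux g a k y • stdB n k = dens (g y) • sharp (g y) (ofOne (a y)) := by
  have h1 := (dualBases_std n).sum_eq (sharp (g y) (ofOne (a y)))
  rw [← h1, Finset.smul_sum]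
  refine Finset.sum_congr rfl fun k _ ↦ ?_
  rw [smul_smul, flux]
  congr 2
  have h2 : g y (frame g (stdC n) y k) = stdC n k := (h.inner y hy).apply_sharp _
  rw [← h2, (h.inner y hy).symm, (h.inner y hy).apply_sharp]

/-- The norm of a `1`-form is the norm of the dual vector field. -/
lemma IsMetricOn.inn_one (h : IsMetricOn g O) (hy : y ∈ O) (a : Alt (EucSp n) 1) :
    inn (frame g (stdC n) y) (stdB n) 1 a a
      = g y (sharp (g y) (ofOne a)) (sharp (g y) (ofOne a)) := by
  have h1 := (dualBases_std n).sum_eq (sharp (g y) (ofOne a))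
  rw [(h.inner y hy).apply_sharp]
  conv_rhs => rw [← h1]
  rw [inn_succ, map_sum, Nat.cast_zero, zero_add, inv_one, one_mul]
  refine Finset.sum_congr rfl fun k _ ↦ ?_
  rw [inn_zero, map_smul, smul_eq_mul, ← ofOne_apply, ← ofOne_apply]
  congr 1
  have h2 : g y (frame g (stdC n) y k) = stdC n k := (h.inner y hy).apply_sharp _
  rw [← h2, (h.inner y hy).symm, (h.inner y hy).apply_sharp]

end Euclidean

section Local

variable {n : ℕ} {X : Type*} [MetricSpace X] [ChartedSpace (EucSp n) X]
  [RiemannianBundle (fun x : X ↦ TangentSpace (𝓡 n) x)] [IsManifold (𝓡 n) ∞ X]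
  [IsContMDiffRiemannianBundle (𝓡 n) ∞ (EucSp n) (fun x : X ↦ TangentSpace (𝓡 n) x)]

/-- The codifferential is local. -/
lemma codiff_congr {p : ℕ} {a b : DForm n X (p + 1)} (ha : a.IsSmooth) (hb : b.IsSmooth) {x : X}
    (h : ∀ᶠ y in 𝓝 x, a y = b y) : a.codiff x = b.codiff x := by
  have hP := isParam_chart (n := n) x
  have hx := mem_extChartAt_target (I := 𝓡 n) x
  have hev : pull (extChartAt (𝓡 n) x).symm a =ᶠ[𝓝 (extChartAt (𝓡 n) x x)]
      pull (extChartAt (𝓡 n) x).symm b := by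
    have h1 := hP.continuousAt hx
    have h2 : Filter.Tendsto (extChartAt (𝓡 n) x).symm (𝓝 (extChartAt (𝓡 n) x x)) (𝓝 x) := by
      have := h1.tendsto
      rwa [extChartAt_to_inv] at this
    filter_upwards [h2.eventually h] with z hz
    rw [pull, pull, formAt, formAt, hz]
  have h3 := hP.ext_pull hx (a := a.codiff) (b := b.codiff) (by
    rw [hP.pull_codiff hx ha, hP.pull_codiff hx hb, codiffOn_congr hev])
  rwa [extChartAt_to_inv] at h3

lemma isSmooth_zero {p : ℕ} : (0 : DForm n X p).IsSmooth := fun _ ↦ contDiffOn_const (c := 0)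

lemma codiff_zero {p : ℕ} : (0 : DForm n X (p + 1)).codiff = 0 := by
  funext x
  have hP := isParam_chart (n := n) x
  have hx := mem_extChartAt_target (I := 𝓡 n) x
  have h3 := hP.ext_pull hx (a := (0 : DForm n X (p + 1)).codiff) (b := 0) (by
    rw [hP.pull_codiff hx isSmooth_zero, pull_zero, codiffOn]
    have h4 : pull (extChartAt (𝓡 n) x).symm (0 : DForm n X (p + 1)) = 0 := rfl
    have h5 : ∀ (g : EucSp n → Bil (EucSp n)) y,
        cov g (0 : EucSp n → Alt (EucSp n) (p + 1)) y = 0 := fun g y ↦ by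
      ext1 u
      rw [cov_apply]
      ext v
      simp [der_apply]
    rw [h4, h5]
    simp)
  rwa [extChartAt_to_inv] at h3

variable [SecondCountableTopology X] [MeasurableSpace X] [BorelSpace X]
  [IsRiemannianManifold (𝓡 n) X]

/-- The divergence theorem for a `1`-form supported in the domain of a chart. The function is read
in the chart and extended, from a neighbourhood of the support, to a Lipschitz function on `ℝⁿ`. -/
lemma abs_integral_mul_codiff_le_of_chart (x : X) {θ : DForm n X 1} (hθ : θ.IsSmooth) {K : Set X}
    (hK : IsCompact K) (hKS : K ⊆ (extChartAt (𝓡 n) x).source) (hθK : ∀ z ∉ K, θ z = 0)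
    {f w : X → ℝ} {L : NNReal} (hf : LipschitzWith L f) (hw : Measurable w) (hw0 : ∀ z, 0 ≤ w z)
    (hfw : ∀ z, SlopeLE f (w z) z) :
    ENNReal.ofReal |∫ z, f z * θ.codiff z ![] ∂(riemVolume n X)|
      ≤ ∫⁻ z, ENNReal.ofReal (w z * θ.pointNorm z) ∂(riemVolume n X) := by
  have hP := isParam_chart (n := n) x
  set T := (extChartAt (𝓡 n) x).target with hT
  set S := (extChartAt (𝓡 n) x).source with hS
  set ψ := (extChartAt (𝓡 n) x).symm with hψ
  have hTo : IsOpen T := isOpen_extChartAt_target x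
  have hSm : MeasurableSet S := (isOpen_extChartAt_source x).measurableSet
  have hδ0 : ∀ z ∉ K, θ.codiff z = 0 := fun z hz ↦ by
    rw [codiff_congr hθ isSmooth_zero (b := 0), codiff_zero]
    · rfl
    · filter_upwards [hK.isClosed.isOpen_compl.mem_nhds hz] with y hy
      exact hθK y hy
  -- the image of the support in the chart, and a compact neighbourhood of it
  set K' := extChartAt (𝓡 n) x '' K with hK'
  have hK'c : IsCompact K' := hK.image_of_continuousOn ((continuousOn_extChartAt x).mono hKS)
  have hK'T : K' ⊆ T := by
    rintro _ ⟨z, hz, rfl⟩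
    exact (extChartAt (𝓡 n) x).map_source (hKS hz)
  have hψK : ∀ y ∈ T, y ∉ K' → ψ y ∉ K := fun y hy h1 h2 ↦
    h1 ⟨ψ y, h2, (extChartAt (𝓡 n) x).right_inv hy⟩
  obtain ⟨K₂, hK₂c, hK₂, hK₂T⟩ := exists_compact_between hK'c hTo hK'T
  obtain ⟨L', hL'⟩ : ∃ L', LipschitzOnWith L' (fun y ↦ f (ψ y)) K₂ := by
    refine LocallyLipschitzOn.exists_lipschitzOnWith_of_compact hK₂c ?_
    intro y hy
    obtain ⟨C, t, ht, hC⟩ := hP.locallyLipschitzOn (hK₂T hy)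
    exact ⟨L * C, t, nhdsWithin_mono _ hK₂T ht, hf.comp_lipschitzOnWith hC⟩
  obtain ⟨F, hF, hFf⟩ := hL'.extend_real
  set a := pull ψ θ with ha
  have ham : ContDiffOn ℝ ∞ a T := hP.contDiffOn_pull hθ
  have hm := hP.isMetricOn
  set g := pullMetric (n := n) ψ with hg
  -- extended by zero, the flux is a smooth vector field of compact support on `ℝⁿ`
  let H : Fin n → EucSp n → ℝ := fun k ↦ T.indicator (flux g a k)
  have ha0 : ∀ y ∈ T, y ∉ K' → a y = 0 := fun y hy h1 ↦ by
    rw [ha, pull, formAt, hθK _ (hψK y hy h1)]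
    rfl
  have hH0 : ∀ k, ∀ y ∉ K', H k y = 0 := fun k y hy ↦ by
    by_cases h1 : y ∈ T
    · change T.indicator _ y = 0
      rw [Set.indicator_of_mem h1, flux, ha0 y h1 hy, map_zero, zero_apply, mul_zero]
    · exact Set.indicator_of_notMem h1 _
  have hHev : ∀ k, ∀ y ∉ K', H k =ᶠ[𝓝 y] fun _ ↦ 0 := fun k y hy ↦ by
    filter_upwards [hK'c.isClosed.isOpen_compl.mem_nhds hy] with z hz
    exact hH0 k z hz
  have hHT : ∀ k, ∀ y ∈ T, H k =ᶠ[𝓝 y] flux g a k := fun k y hy ↦ by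
    filter_upwards [hTo.mem_nhds hy] with z hz
    exact Set.indicator_of_mem hz _
  have hHs : ∀ k, ContDiff ℝ ∞ (H k) := fun k ↦ by
    rw [contDiff_iff_contDiffAt]
    intro y
    by_cases hy : y ∈ T
    · exact ((hm.contDiffOn_flux ham k).contDiffAt (hTo.mem_nhds hy)).congr_of_eventuallyEq
        (hHT k y hy)
    · exact contDiffAt_const.congr_of_eventuallyEq (hHev k y fun h ↦ hy (hK'T h))
  have hHc : ∀ k, HasCompactSupport (H k) := fun k ↦ HasCompactSupport.intro hK'c (hH0 k)
  have hint : ∫ z, f z * θ.codiff z ![] ∂(riemVolume n X)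
      = - ∫ y, F y * ∑ k, fderiv ℝ (H k) y (stdB n k) := by
    have hcont : Continuous fun z ↦ f z * θ.codiff z ![] :=
      hf.continuous.mul (continuous_apply_zero (isSmooth_codiff hθ))
    have hout : ∀ z, z ∉ S → f z * θ.codiff z ![] = 0 := fun z hz ↦ by
      rw [hδ0 z fun h ↦ hz (hKS h)]
      exact mul_zero _
    rw [← setIntegral_eq_integral_of_forall_compl_eq_zero hout, riemVolume_restrict,
      integral_chartVolume x hcont, ← integral_indicator hTo.measurableSet,
      ← integral_neg]
    refine integral_congr_ae (Filter.Eventually.of_forall fun y ↦ ?_)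
    simp only
    by_cases hy : y ∈ T
    · rw [Set.indicator_of_mem hy]
      have h1 : dens (g y) * codiffOn g (stdB n) (stdC n) a y ![]
          = - ∑ k, fderiv ℝ (H k) y (stdB n k) := by
        rw [hm.dens_mul_codiffOn hy (hP.differentiableAt_pull hy hθ)]
        exact congrArg _ (Finset.sum_congr rfl fun k _ ↦ by rw [(hHT k y hy).fderiv_eq])
      have h2 : θ.codiff (ψ y) ![] = codiffOn g (stdB n) (stdC n) a y ![] := by
        rw [← hP.pull_codiff hy hθ, pull, pb_apply]
        exact congrArg _ (Subsingleton.elim _ _)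
      rw [h2]
      change dens (g y) * (f (ψ y) * _) = _
      by_cases hy2 : y ∈ K₂
      · have h3 : f (ψ y) = F y := hFf hy2
        rw [h3]
        linear_combination F y * h1
      · have h3 : ∑ k, fderiv ℝ (H k) y (stdB n k) = 0 := by
          refine Finset.sum_eq_zero fun k _ ↦ ?_
          rw [(hHev k y fun h ↦ hy2 (interior_subset (hK₂ h))).fderiv_eq]
          simp
        rw [h3] at h1 ⊢
        linear_combination f (ψ y) * h1
    · rw [Set.indicator_of_notMem hy, Finset.sum_eq_zero, mul_zero, neg_zero]
      intro k _
      rw [(hHev k y fun h ↦ hy (hK'T h)).fderiv_eq]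
      simp
  rw [hint, integral_mul_divergence hF hHs hHc, neg_neg]
  have hwm : Measurable fun z ↦ ENNReal.ofReal (w z * θ.pointNorm z) :=
    (hw.mul (continuous_pointNorm hθ).measurable).ennreal_ofReal
  calc ENNReal.ofReal |∫ y, ∑ k, lineDeriv ℝ F y (stdB n k) * H k y|
      ≤ ∫⁻ y, ‖∑ k, lineDeriv ℝ F y (stdB n k) * H k y‖ₑ := by
        rw [← Real.enorm_eq_ofReal_abs]
        exact enorm_integral_le_lintegral_enorm _
    _ ≤ ∫⁻ y, T.indicator (fun y ↦ ENNReal.ofReal (dens (chartMetric x y)) *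
          ENNReal.ofReal (w (ψ y) * θ.pointNorm (ψ y))) y := by
        refine lintegral_mono_ae ?_
        filter_upwards [hF.ae_differentiableAt] with y hy
        by_cases hyK : y ∈ K'
        · have hyT := hK'T hyK
          rw [Set.indicator_of_mem hyT,
            ← ENNReal.ofReal_mul (show 0 ≤ dens (chartMetric x y) from Real.sqrt_nonneg _),
            Real.enorm_eq_ofReal_abs]
          refine ENNReal.ofReal_le_ofReal ?_
          have h1 : ∑ k, lineDeriv ℝ F y (stdB n k) * H k y
              = fderiv ℝ F y (dens (g y) • sharp (g y) (ofOne (a y))) := by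
            rw [← hm.sum_flux hyT a, map_sum]
            refine Finset.sum_congr rfl fun k _ ↦ ?_
            rw [hy.lineDeriv_eq_fderiv, map_smul, smul_eq_mul, mul_comm, (hHT k y hyT).eq_of_nhds]
          have h2 := hP.abs_fderiv_le hyT (hw0 _) (hfw _) hy (F := F) (by
            filter_upwards [mem_interior_iff_mem_nhds.1 (hK₂ hyK)] with z hz
            exact (hFf hz).symm) (sharp (g y) (ofOne (a y)))
          have h3 : θ.pointNorm (ψ y)
              = √(g y (sharp (g y) (ofOne (a y))) (sharp (g y) (ofOne (a y)))) := by
            rw [DForm.pointNorm, hP.pointInner_eq hyT, hm.inn_one hyT]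
          have h4 : (0 : ℝ) ≤ dens (g y) := Real.sqrt_nonneg _
          rw [h1, map_smul, smul_eq_mul, abs_mul, abs_of_nonneg h4, h3]
          exact mul_le_mul_of_nonneg_left h2 h4
        · rw [Finset.sum_eq_zero fun k _ ↦ by rw [hH0 k y hyK, mul_zero], enorm_zero]
          exact zero_le
    _ = ∫⁻ z in S, ENNReal.ofReal (w z * θ.pointNorm z) ∂(riemVolume n X) := by
        rw [lintegral_indicator hTo.measurableSet, riemVolume_restrict,
          lintegral_chartVolume x hwm]
    _ ≤ _ := setLIntegral_le_lintegral _ _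

end Local

end

/-! ### The Hopf–Rinow theorem; finiteness and positivity of the volume -/

section

open RiemForm Bundle

section HopfRinow

variable (n : ℕ) {X : Type*} [MetricSpace X] [ChartedSpace (EucSp n) X]
  [RiemannianBundle (fun x : X ↦ TangentSpace (𝓡 n) x)] [IsRiemannianManifold (𝓡 n) X]

include n in
/-- If `ρ(x, y) < r + s`, then the balls of radii `r` about `x` and `s` about `y` meet, on a curve
which almost realizes the distance. -/
lemma exists_dist_lt_dist_lt (x y : X) {r s : ℝ} (hr : 0 < r) (hs : 0 < s)
    (h : dist x y < r + s) : ∃ z, dist x z < r ∧ dist z y < s := by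
  rcases lt_or_ge (dist x y) r with h1 | h1
  · exact ⟨y, h1, by simpa using hs⟩
  have h2 : Manifold.riemannianEDist (𝓡 n) x y < ENNReal.ofReal (r + s) := by
    rw [← IsRiemannianManifold.out (I := 𝓡 n) x y, edist_dist]
    exact (ENNReal.ofReal_lt_ofReal_iff (by positivity)).2 h
  obtain ⟨γ, rfl, rfl, hγ, hlen⟩ := Manifold.exists_lt_of_riemannianEDist_lt h2
  have hfin : Manifold.pathELength (𝓡 n) γ 0 1 ≠ ⊤ := (hlen.trans_le le_top).ne
  set l := (Manifold.pathELength (𝓡 n) γ 0 1).toReal with hl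
  have hl1 : l < r + s := by
    rw [hl, ← ENNReal.ofReal_lt_ofReal_iff (by positivity), ENNReal.ofReal_toReal hfin]
    exact hlen
  obtain ⟨t', ht1, ht2⟩ := exists_between (max_lt hr (show l - s < r by linarith))
  have ht0 := (le_max_left _ _).trans_lt ht1
  have hts := (le_max_right _ _).trans_lt ht1
  have hcont : ContinuousOn (fun t ↦ dist (γ 0) (γ t)) (Set.Icc 0 1) :=
    (continuous_const.dist continuous_id).comp_continuousOn hγ.continuousOn
  obtain ⟨t, ht, hdt⟩ := intermediate_value_Icc zero_le_one hcont
    (show t' ∈ Set.Icc (dist (γ 0) (γ 0)) (dist (γ 0) (γ 1)) from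
      ⟨by rw [dist_self]; exact ht0.le, ht2.le.trans h1⟩)
  have hA : edist (γ 0) (γ t) + edist (γ t) (γ 1) ≤ Manifold.pathELength (𝓡 n) γ 0 1 := by
    rw [← Manifold.pathELength_add ht.1 ht.2, IsRiemannianManifold.out (I := 𝓡 n) (γ 0) (γ t),
      IsRiemannianManifold.out (I := 𝓡 n) (γ t) (γ 1)]
    exact add_le_add
      (Manifold.riemannianEDist_le_pathELength (hγ.mono (Set.Icc_subset_Icc le_rfl ht.2)) rfl rfl ht.1)
      (Manifold.riemannianEDist_le_pathELength (hγ.mono (Set.Icc_subset_Icc ht.1 le_rfl)) rfl rfl ht.2)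
  have hB : dist (γ 0) (γ t) + dist (γ t) (γ 1) ≤ l := by
    rw [edist_dist, edist_dist, ← ENNReal.ofReal_add dist_nonneg dist_nonneg] at hA
    exact (ENNReal.ofReal_le_iff_le_toReal hfin).1 hA
  have hdt' : dist (γ 0) (γ t) = t' := hdt
  exact ⟨γ t, by rw [hdt']; exact ht2, by linarith⟩

variable (X) in
include n in
/-- The Hopf–Rinow theorem: closed balls of a complete Riemannian manifold are compact. The supremum
of the radii of compact balls about a point, if finite, is attained by completeness and total
boundedness, and then it can be increased by local compactness. -/
lemma properSpace_of_complete [CompleteSpace X] : ProperSpace X := by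
  have : LocallyCompactSpace X := ChartedSpace.locallyCompactSpace (EucSp n) X
  refine ⟨fun x r₀ ↦ ?_⟩
  by_contra hr₀
  set S : Set ℝ := {r | IsCompact (Metric.closedBall x r)} with hS
  have hmono : ∀ r ∈ S, ∀ s ≤ r, s ∈ S := fun r hr s hs ↦
    IsCompact.of_isClosed_subset hr Metric.isClosed_closedBall (Metric.closedBall_subset_closedBall hs)
  have h0 : (0 : ℝ) ∈ S := by
    change IsCompact (Metric.closedBall x 0)
    rw [Metric.closedBall_zero]
    exact isCompact_singleton
  have hbdd : BddAbove S := ⟨r₀, fun r hr ↦ by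
    by_contra h
    exact hr₀ (hmono r hr r₀ (not_le.1 h).le)⟩
  set R := sSup S with hR
  have hR0 : 0 ≤ R := le_csSup hbdd h0
  have hlt : ∀ r < R, r ∈ S := fun r hr ↦ by
    obtain ⟨s, hs, hrs⟩ := exists_lt_of_lt_csSup ⟨0, h0⟩ hr
    exact hmono s hs r hrs.le
  -- every point of the ball of radius `R` is within `ε / 2` of a slightly smaller ball
  have hRS : R ∈ S := by
    rcases hR0.eq_or_lt with h | hpos
    · rw [← h]; exact h0
    refine isCompact_iff_totallyBounded_isComplete.2
      ⟨Metric.totallyBounded_iff.2 fun ε hε ↦ ?_, Metric.isClosed_closedBall.isComplete⟩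
    have hr1 : R - min (ε / 4) (R / 2) < R := by
      have : 0 < min (ε / 4) (R / 2) := by positivity
      linarith
    have hr2 : 0 < R - min (ε / 4) (R / 2) := by
      have := min_le_right (ε / 4) (R / 2)
      linarith
    have hr3 : R < R - min (ε / 4) (R / 2) + ε / 2 := by
      have := min_le_left (ε / 4) (R / 2)
      linarith
    have hK : IsCompact (Metric.closedBall x (R - min (ε / 4) (R / 2))) := hlt _ hr1
    obtain ⟨t, ht, htc⟩ := Metric.totallyBounded_iff.1 hK.totallyBounded (ε / 2) (by positivity)
    refine ⟨t, ht, fun y hy ↦ ?_⟩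
    rw [Metric.mem_closedBall, dist_comm] at hy
    obtain ⟨z, hz1, hz2⟩ := exists_dist_lt_dist_lt n x y hr2 (half_pos hε) (hy.trans_lt hr3)
    have hz3 := htc (Metric.mem_closedBall'.2 hz1.le)
    rw [Set.mem_iUnion₂] at hz3 ⊢
    obtain ⟨c, hc, hzc⟩ := hz3
    refine ⟨c, hc, ?_⟩
    rw [Metric.mem_ball] at hzc ⊢
    have := dist_triangle y z c
    rw [dist_comm y z] at this
    linarith
  obtain ⟨K, hK, hKi⟩ := exists_compact_superset (show IsCompact (Metric.closedBall x R) from hRS)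
  obtain ⟨δ, hδ, hδK⟩ := IsCompact.exists_thickening_subset_open
    (show IsCompact (Metric.closedBall x R) from hRS) isOpen_interior hKi
  -- a compact neighbourhood of the ball of radius `R` contains a larger ball
  have hnew : R + δ / 2 ∈ S := by
    refine IsCompact.of_isClosed_subset hK Metric.isClosed_closedBall fun y hy ↦
      interior_subset (hδK ?_)
    rw [Metric.mem_closedBall, dist_comm] at hy
    rw [Metric.mem_thickening_iff]
    rcases hR0.eq_or_lt with h | hpos
    · refine ⟨x, Metric.mem_closedBall_self hR0, ?_⟩
      rw [dist_comm]
      linarith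
    · obtain ⟨z, hz1, hz2⟩ := exists_dist_lt_dist_lt n x y hpos hδ (by linarith)
      exact ⟨z, Metric.mem_closedBall'.2 hz1.le, by rwa [dist_comm]⟩
  have := le_csSup hbdd hnew
  linarith

end HopfRinow

section Measure

variable {n : ℕ} {X : Type*} [TopologicalSpace X] [ChartedSpace (EucSp n) X]
  [RiemannianBundle (fun x : X ↦ TangentSpace (𝓡 n) x)] [IsManifold (𝓡 n) ∞ X]
  [IsContMDiffRiemannianBundle (𝓡 n) ∞ (EucSp n) (fun x : X ↦ TangentSpace (𝓡 n) x)]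
  [MeasurableSpace X] [BorelSpace X]

instance instIsLocallyFiniteMeasureRiemVolume : IsLocallyFiniteMeasure (riemVolume n X) := by
  refine ⟨fun x ↦ ?_⟩
  have hx := mem_extChartAt_target (I := 𝓡 n) x
  obtain ⟨r, hr, hball⟩ := Metric.nhds_basis_closedBall.mem_iff.1
    ((isOpen_extChartAt_target (I := 𝓡 n) x).mem_nhds hx)
  set S := (extChartAt (𝓡 n) x).source with hS
  set B := Metric.ball (extChartAt (𝓡 n) x x) r with hB
  have hUo : IsOpen (S ∩ extChartAt (𝓡 n) x ⁻¹' B) :=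
    (continuousOn_extChartAt x).isOpen_inter_preimage (isOpen_extChartAt_source x)
      Metric.isOpen_ball
  refine ⟨S ∩ extChartAt (𝓡 n) x ⁻¹' B, hUo.mem_nhds ⟨mem_extChartAt_source x,
    Metric.mem_ball_self hr⟩, ?_⟩
  have h1 : riemVolume n X (S ∩ extChartAt (𝓡 n) x ⁻¹' B)
      = chartVolume (n := n) x (S ∩ extChartAt (𝓡 n) x ⁻¹' B) := by
    rw [← riemVolume_restrict, Measure.restrict_apply hUo.measurableSet,
      Set.inter_eq_self_of_subset_left Set.inter_subset_left]
  rw [h1, ← lintegral_indicator_one hUo.measurableSet,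
    lintegral_chartVolume x (measurable_one.indicator hUo.measurableSet)]
  have h2 : IntegrableOn (fun y ↦ dens (chartMetric (n := n) x y))
      (Metric.closedBall (extChartAt (𝓡 n) x x) r) := by
    refine ContinuousOn.integrableOn_compact (isCompact_closedBall _ _) ?_
    exact ((isParam_chart x).isMetricOn.contDiffOn_dens.continuousOn).mono hball
  refine lt_of_le_of_lt ?_ h2.lintegral_lt_top
  rw [← lintegral_indicator (isOpen_extChartAt_target x).measurableSet,
    ← lintegral_indicator Metric.isClosed_closedBall.measurableSet]
  refine lintegral_mono fun y ↦ ?_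
  by_cases hy : y ∈ (extChartAt (𝓡 n) x).target
  · rw [Set.indicator_of_mem hy]
    by_cases hy2 : (extChartAt (𝓡 n) x).symm y ∈ S ∩ extChartAt (𝓡 n) x ⁻¹' B
    · have h3 : y ∈ B := by
        have := hy2.2
        rwa [Set.mem_preimage, (extChartAt (𝓡 n) x).right_inv hy] at this
      rw [Set.indicator_of_mem hy2, Set.indicator_of_mem (Metric.ball_subset_closedBall h3)]
      simp
    · rw [Set.indicator_of_notMem hy2, mul_zero]
      exact zero_le
  · rw [Set.indicator_of_notMem hy]
    exact zero_le

instance instIsOpenPosMeasureRiemVolume : (riemVolume n X).IsOpenPosMeasure := by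
  refine ⟨fun U hU ⟨x, hx⟩ h0 ↦ ?_⟩
  have hV : IsOpen ((extChartAt (𝓡 n) x).target ∩ (extChartAt (𝓡 n) x).symm ⁻¹' U) :=
    (continuousOn_extChartAt_symm x).isOpen_inter_preimage (isOpen_extChartAt_target x) hU
  have hVne : ((extChartAt (𝓡 n) x).target ∩ (extChartAt (𝓡 n) x).symm ⁻¹' U).Nonempty :=
    ⟨extChartAt (𝓡 n) x x, mem_extChartAt_target x, by
      rw [Set.mem_preimage, extChartAt_to_inv]; exact hx⟩
  have h1 : chartVolume (n := n) x U = 0 := by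
    rw [← riemVolume_restrict]
    exact le_antisymm ((Measure.restrict_apply_le _ _).trans h0.le) zero_le
  rw [← lintegral_indicator_one hU.measurableSet,
    lintegral_chartVolume x (measurable_one.indicator hU.measurableSet)] at h1
  have h2 : AEMeasurable (fun y ↦ ENNReal.ofReal (dens (chartMetric (n := n) x y)) *
      U.indicator 1 ((extChartAt (𝓡 n) x).symm y)) (volume.restrict (extChartAt (𝓡 n) x).target) :=
    (aemeasurable_dens x).mul ((measurable_one.indicator hU.measurableSet).comp_aemeasurable
      (aemeasurable_chart x))
  rw [lintegral_eq_zero_iff' h2, Filter.EventuallyEq,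
    ae_restrict_iff' (isOpen_extChartAt_target x).measurableSet] at h1
  refine (hV.measure_pos volume hVne).ne' ?_
  refine measure_mono_null (fun y hy ↦ ?_) h1
  intro h3
  have h4 := h3 hy.1
  rw [Set.indicator_of_mem (show (extChartAt (𝓡 n) x).symm y ∈ U from hy.2)] at h4
  have h5 : 0 < dens (chartMetric (n := n) x y) :=
    ((isParam_chart x).isMetricOn.inner y hy.1).dens_pos
  simp only [Pi.one_apply, mul_one, Pi.zero_apply, ENNReal.ofReal_eq_zero] at h4
  exact absurd h5 (not_lt.2 h4)

end Measure

end

/-! ### The divergence theorem for compactly supported Lipschitz functions -/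

section

open RiemForm Bundle

section Linear

variable {n : ℕ} {X : Type*} [TopologicalSpace X] [ChartedSpace (EucSp n) X]
  {p : ℕ}

/-- The product of a function and a differential form. -/
def fmul (ρ : X → ℝ) (a : DForm n X p) : DForm n X p := fun x ↦ ρ x • a x

variable [RiemannianBundle (fun x : X ↦ TangentSpace (𝓡 n) x)]

lemma pointNorm_eq (a : DForm n X p) (x : X) : a.pointNorm x = nrm (onb (n := n) x) (formAt a x) := by
  rw [DForm.pointNorm, pointInner_eq, nrm]

lemma pointNorm_nonneg (a : DForm n X p) (x : X) : 0 ≤ a.pointNorm x := Real.sqrt_nonneg _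

lemma pointNorm_fmul (ρ : X → ℝ) (a : DForm n X p) (x : X) :
    (fmul ρ a).pointNorm x = |ρ x| * a.pointNorm x := by
  rw [pointNorm_eq, pointNorm_eq, ← nrm_smul]
  rfl

lemma pointNorm_sub_le (a b : DForm n X p) (x : X) :
    (a - b).pointNorm x ≤ a.pointNorm x + b.pointNorm x := by
  rw [pointNorm_eq, pointNorm_eq, pointNorm_eq]
  have h1 : formAt (a - b) x = formAt a x + (-1 : ℝ) • formAt b x := by
    rw [neg_one_smul, ← sub_eq_add_neg]
    rfl
  rw [h1]
  refine (nrm_add_le _ _ _).trans ?_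
  rw [nrm_smul]
  simp

variable [IsManifold (𝓡 n) ∞ X]
  [IsContMDiffRiemannianBundle (𝓡 n) ∞ (EucSp n) (fun x : X ↦ TangentSpace (𝓡 n) x)]

lemma isSmooth_fmul {ρ : X → ℝ} (hρ : ContMDiff (𝓡 n) 𝓘(ℝ, ℝ) ∞ ρ) {a : DForm n X p}
    (ha : a.IsSmooth) : (fmul ρ a).IsSmooth :=
  isSmooth_of_pull fun ψ O h ↦ by
    have h1 : ContDiffOn ℝ ∞ (fun z ↦ ρ (ψ z)) O :=
      contMDiffOn_iff_contDiffOn.1 (hρ.comp_contMDiffOn h.smooth)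
    refine ContDiffOn.congr (h1.smul (h.contDiffOn_pull ha)) fun z hz ↦ ?_
    exact pb_smul _ _ _

lemma isSmooth_sub {a b : DForm n X p} (ha : a.IsSmooth) (hb : b.IsSmooth) : (a - b).IsSmooth :=
  fun x ↦ ((ha x).sub (hb x)).congr fun _ _ ↦ rfl

lemma pull_sum {ι : Type*} (s : Finset ι) (a : ι → DForm n X p) (ψ : EucSp n → X) (z : EucSp n) :
    pull ψ (fun x ↦ ∑ i ∈ s, a i x) z = ∑ i ∈ s, pull ψ (a i) z :=
  pb_sum _ (fun i ↦ formAt (a i) (ψ z)) _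

lemma isSmooth_sum {ι : Type*} (s : Finset ι) {a : ι → DForm n X p} (ha : ∀ i, (a i).IsSmooth) :
    DForm.IsSmooth fun x ↦ ∑ i ∈ s, a i x :=
  isSmooth_of_pull fun ψ O h ↦ by
    rw [funext (pull_sum s a ψ)]
    exact ContDiffOn.sum fun i _ ↦ h.contDiffOn_pull (ha i)

lemma codiff_sum {ι : Type*} (s : Finset ι) {a : ι → DForm n X (p + 1)} (ha : ∀ i, (a i).IsSmooth)
    (x : X) : DForm.codiff (fun x ↦ ∑ i ∈ s, a i x) x = ∑ i ∈ s, (a i).codiff x := by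
  have := dform_ext_normal (a := DForm.codiff (fun x ↦ ∑ i ∈ s, a i x))
    (b := fun x ↦ ∑ i ∈ s, (a i).codiff x) fun ψ O h h0 hN ↦ by
      rw [h.pull_codiff h0 (isSmooth_sum s ha), pull_sum, hN.codiffOn_eq, funext (pull_sum s a ψ),
        Finset.sum_congr rfl fun i _ ↦ (h.pull_codiff h0 (ha i)).trans (hN.codiffOn_eq _),
        fderiv_fun_sum fun i _ ↦ h.differentiableAt_pull h0 (ha i), Finset.sum_neg_distrib,
        Finset.sum_comm]
      simp only [sum_apply, map_sum]
  exact congrFun this x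

lemma codiff_sub {a b : DForm n X (p + 1)} (ha : a.IsSmooth) (hb : b.IsSmooth) :
    (a - b).codiff = a.codiff - b.codiff :=
  dform_ext_normal fun ψ O h h0 hN ↦ by
    have h1 : ∀ {q : ℕ} (a b : DForm n X q), pull ψ (a - b) = pull ψ a - pull ψ b := fun a b ↦ rfl
    rw [h.pull_codiff h0 (isSmooth_sub ha hb), h1, h1, Pi.sub_apply, h.pull_codiff h0 ha,
      h.pull_codiff h0 hb, hN.codiffOn_eq, hN.codiffOn_eq, hN.codiffOn_eq,
      fderiv_sub (h.differentiableAt_pull h0 ha) (h.differentiableAt_pull h0 hb)]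
    simp only [sub_apply, map_sub, Finset.sum_sub_distrib]
    abel

end Linear

section Global

variable {n : ℕ} {X : Type*} [MetricSpace X] [ChartedSpace (EucSp n) X]
  [RiemannianBundle (fun x : X ↦ TangentSpace (𝓡 n) x)] [IsManifold (𝓡 n) ∞ X]
  [IsContMDiffRiemannianBundle (𝓡 n) ∞ (EucSp n) (fun x : X ↦ TangentSpace (𝓡 n) x)]
  [SecondCountableTopology X] [MeasurableSpace X] [BorelSpace X]
  [IsRiemannianManifold (𝓡 n) X]

/-- The divergence theorem, as an inequality: `|∫ f d*θ| ≤ ∫ |∇f| |θ|` for a Lipschitz function `f`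
of compact support whose slope is at most `w`. The `1`-form is cut into pieces supported in charts
by a partition of unity; this costs nothing on the right-hand side, since the pieces add up to at
most `|θ|`. -/
lemma abs_integral_mul_codiff_le {θ : DForm n X 1} (hθ : θ.IsSmooth)
    {f w : X → ℝ} {L : NNReal} (hf : LipschitzWith L f) (hfc : HasCompactSupport f)
    (hw : Measurable w) (hw0 : ∀ z, 0 ≤ w z) (hfw : ∀ z, SlopeLE f (w z) z) :
    ENNReal.ofReal |∫ z, f z * θ.codiff z ![] ∂(riemVolume n X)|
      ≤ ∫⁻ z, ENNReal.ofReal (w z * θ.pointNorm z) ∂(riemVolume n X) := by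
  have : LocallyCompactSpace X := ChartedSpace.locallyCompactSpace (EucSp n) X
  -- the partition of unity is `1` on a neighbourhood `K₂` of the support of `f`, and it is
  -- supported in `K₃`, so that all pieces have compact support
  obtain ⟨K₂, hK₂, hKK₂⟩ := exists_compact_superset hfc.isCompact
  obtain ⟨K₃, hK₃, hKK₃⟩ := exists_compact_superset hK₂
  let U : X → Set X := fun x ↦ (extChartAt (𝓡 n) x).source ∩ interior K₃
  have hUo : ∀ x, IsOpen (U x) := fun x ↦ (isOpen_extChartAt_source x).inter isOpen_interior
  obtain ⟨t, ht⟩ := hK₂.elim_finite_subcover U hUo fun x hx ↦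
    Set.mem_iUnion.2 ⟨x, mem_extChartAt_source x, hKK₃ hx⟩
  obtain ⟨ρ, hρ⟩ := SmoothPartitionOfUnity.exists_isSubordinate (𝓡 n) hK₂.isClosed
    (fun i : t ↦ U i) (fun i ↦ hUo i) (by simpa [Set.iUnion_subtype] using ht)
  let θ' : t → DForm n X 1 := fun i ↦ fmul (ρ i) θ
  have hθ' : ∀ i, (θ' i).IsSmooth := fun i ↦ isSmooth_fmul (ρ i).contMDiff hθ
  have hc : ∀ i, IsCompact (tsupport (ρ i)) := fun i ↦
    hK₃.of_isClosed_subset (isClosed_tsupport _) ((hρ i).trans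
      (Set.inter_subset_right.trans interior_subset))
  have hsum : ∀ z, f z * θ.codiff z ![] = ∑ i, f z * (θ' i).codiff z ![] := fun z ↦ by
    by_cases hz : z ∈ tsupport f
    · have h1 : θ.codiff z = DForm.codiff (fun x ↦ ∑ i, θ' i x) z := by
        refine codiff_congr hθ (isSmooth_sum _ hθ') ?_
        filter_upwards [mem_interior_iff_mem_nhds.1 (hKK₂ hz)] with y hy
        have h2 := ρ.sum_eq_one hy
        rw [finsum_eq_sum_of_fintype] at h2
        change θ y = ∑ i, ρ i y • θ y
        rw [← Finset.sum_smul, h2, one_smul]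
      rw [h1, codiff_sum _ hθ', ContinuousAlternatingMap.sum_apply, Finset.mul_sum]
    · rw [image_eq_zero_of_notMem_tsupport hz]
      simp
  have hint : ∀ i, Integrable (fun z ↦ f z * (θ' i).codiff z ![]) (riemVolume n X) := fun i ↦
    Continuous.integrable_of_hasCompactSupport
      (hf.continuous.mul (continuous_apply_zero (isSmooth_codiff (hθ' i)))) hfc.mul_right
  have hwm : ∀ i, Measurable fun z ↦ ENNReal.ofReal (w z * (θ' i).pointNorm z) := fun i ↦
    (hw.mul (continuous_pointNorm (hθ' i)).measurable).ennreal_ofReal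
  rw [integral_congr_ae (Filter.Eventually.of_forall hsum), integral_finsetSum _ fun i _ ↦ hint i]
  calc ENNReal.ofReal |∑ i, ∫ z, f z * (θ' i).codiff z ![] ∂(riemVolume n X)|
      ≤ ENNReal.ofReal (∑ i, |∫ z, f z * (θ' i).codiff z ![] ∂(riemVolume n X)|) :=
        ENNReal.ofReal_le_ofReal (Finset.abs_sum_le_sum_abs _ _)
    _ = ∑ i, ENNReal.ofReal |∫ z, f z * (θ' i).codiff z ![] ∂(riemVolume n X)| :=
        ENNReal.ofReal_sum_of_nonneg fun _ _ ↦ abs_nonneg _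
    _ ≤ ∑ i, ∫⁻ z, ENNReal.ofReal (w z * (θ' i).pointNorm z) ∂(riemVolume n X) := by
        refine Finset.sum_le_sum fun i _ ↦ ?_
        refine abs_integral_mul_codiff_le_of_chart (i : X) (hθ' i) (hc i)
          ((hρ i).trans Set.inter_subset_left) (fun z hz ↦ ?_) hf hw hw0 hfw
        change ρ i z • θ z = 0
        rw [image_eq_zero_of_notMem_tsupport hz, zero_smul]
    _ = ∫⁻ z, ∑ i, ENNReal.ofReal (w z * (θ' i).pointNorm z) ∂(riemVolume n X) :=
        (lintegral_finsetSum _ fun i _ ↦ hwm i).symm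
    _ ≤ _ := by
        refine lintegral_mono fun z ↦ ?_
        rw [← ENNReal.ofReal_sum_of_nonneg fun i _ ↦ mul_nonneg (hw0 z) (pointNorm_nonneg _ _)]
        refine ENNReal.ofReal_le_ofReal ?_
        have h2 := ρ.sum_le_one z
        rw [finsum_eq_sum_of_fintype] at h2
        calc ∑ i, w z * (θ' i).pointNorm z = (∑ i, ρ i z) * (w z * θ.pointNorm z) := by
              rw [Finset.sum_mul]
              refine Finset.sum_congr rfl fun i _ ↦ ?_
              rw [pointNorm_fmul, abs_of_nonneg (ρ.nonneg i z)]
              ring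
          _ ≤ _ := mul_le_of_le_one_left (mul_nonneg (hw0 z) (pointNorm_nonneg _ _)) h2

end Global

end

/-! ### Cutoff functions and two vanishing theorems -/

section

open RiemForm Bundle

section Cutoff

variable {X : Type*} [MetricSpace X]

/-- A cutoff function: equal to `1` on the ball of radius `R` about `x₀`, and to `0` outside the
ball of radius `2 R`. -/
def cutoff (x₀ : X) (R : ℝ) (x : X) : ℝ := max 0 (min 1 (2 - dist x₀ x / R))

variable (x₀ : X) {R : ℝ}

lemma cutoff_nonneg (x : X) : 0 ≤ cutoff x₀ R x := le_max_left _ _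

lemma cutoff_le_one (x : X) : cutoff x₀ R x ≤ 1 := max_le zero_le_one (min_le_left _ _)

variable (hR : 0 < R)

include hR

lemma cutoff_eq_one {x : X} (h : dist x₀ x ≤ R) : cutoff x₀ R x = 1 := by
  have : dist x₀ x / R ≤ 1 := (div_le_one hR).2 h
  rw [cutoff, min_eq_left (by linarith), max_eq_right zero_le_one]

lemma cutoff_eq_zero {x : X} (h : 2 * R ≤ dist x₀ x) : cutoff x₀ R x = 0 := by
  have : 2 ≤ dist x₀ x / R := (le_div_iff₀ hR).2 h
  exact max_eq_left ((min_le_right _ _).trans (by linarith))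

lemma abs_cutoff_sub_le (x y : X) : |cutoff x₀ R y - cutoff x₀ R x| ≤ R⁻¹ * dist x y := by
  have h1 : |dist x₀ x - dist x₀ y| ≤ dist x y := by
    rw [dist_comm x₀ x, dist_comm x₀ y]
    exact abs_dist_sub_le x y x₀
  calc |cutoff x₀ R y - cutoff x₀ R x|
      ≤ |min 1 (2 - dist x₀ y / R) - min 1 (2 - dist x₀ x / R)| := abs_max_sub_max_le_abs _ _ _ |>.trans_eq' (by rw [cutoff, cutoff, max_comm 0, max_comm 0])
    _ ≤ |(2 - dist x₀ y / R) - (2 - dist x₀ x / R)| := by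
        refine (abs_min_sub_min_le_max _ _ _ _).trans ?_
        simp
    _ = R⁻¹ * |dist x₀ x - dist x₀ y| := by
        rw [show (2 - dist x₀ y / R) - (2 - dist x₀ x / R) = R⁻¹ * (dist x₀ x - dist x₀ y) by ring,
          abs_mul, abs_of_pos (inv_pos.2 hR)]
    _ ≤ _ := by gcongr

lemma lipschitzWith_cutoff : LipschitzWith (Real.toNNReal R⁻¹) (cutoff x₀ R) :=
  LipschitzWith.of_dist_le_mul fun x y ↦ by
    rw [Real.coe_toNNReal _ (inv_pos.2 hR).le, Real.dist_eq, abs_sub_comm]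
    exact abs_cutoff_sub_le x₀ hR x y

lemma hasCompactSupport_cutoff [ProperSpace X] : HasCompactSupport (cutoff x₀ R) :=
  HasCompactSupport.intro (isCompact_closedBall x₀ (2 * R)) fun x hx ↦
    cutoff_eq_zero x₀ hR (by
      rw [Metric.mem_closedBall', not_le] at hx
      exact hx.le)

/-- The slope of the cutoff function vanishes outside the shell `R ≤ ρ ≤ 2 R`, and is at most `1 /
R` on it. -/
lemma slopeLE_cutoff (x : X) : SlopeLE (cutoff x₀ R)
    ((dist x₀ ⁻¹' Set.Icc R (2 * R)).indicator (fun _ ↦ R⁻¹) x) x := by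
  intro ε hε
  have h0 : ∀ᶠ y in 𝓝 x, cutoff x₀ R y = cutoff x₀ R x → |cutoff x₀ R y - cutoff x₀ R x|
      ≤ (0 + ε) * dist x y := Filter.Eventually.of_forall fun y h ↦ by
    rw [h, sub_self, abs_zero]
    positivity
  have hc : Continuous (dist x₀) := continuous_const.dist continuous_id
  by_cases hx : x ∈ dist x₀ ⁻¹' Set.Icc R (2 * R)
  · rw [Set.indicator_of_mem hx]
    refine Filter.Eventually.of_forall fun y ↦ (abs_cutoff_sub_le x₀ hR x y).trans ?_
    gcongr
    linarith
  · rw [Set.indicator_of_notMem hx]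
    rcases lt_or_ge (dist x₀ x) R with h1 | h1
    · filter_upwards [h0, hc.continuousAt.eventually_lt continuousAt_const h1] with y hy h2
      exact hy (by rw [cutoff_eq_one x₀ hR h2.le, cutoff_eq_one x₀ hR h1.le])
    · have h1' : 2 * R < dist x₀ x := not_le.1 fun h ↦ hx ⟨h1, h⟩
      filter_upwards [h0, continuousAt_const.eventually_lt hc.continuousAt h1'] with y hy h2
      exact hy (by rw [cutoff_eq_zero x₀ hR h2.le, cutoff_eq_zero x₀ hR h1'.le])

lemma slopeLE_cutoff_sq (x : X) : SlopeLE (fun y ↦ cutoff x₀ R y ^ 2)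
    (2 * R⁻¹ * cutoff x₀ R x) x := by
  intro ε hε
  have h1 : ∀ᶠ y in 𝓝 x, cutoff x₀ R y < cutoff x₀ R x + R * ε :=
    (lipschitzWith_cutoff x₀ hR).continuous.continuousAt.eventually_lt continuousAt_const
      (lt_add_of_pos_right _ (by positivity))
  filter_upwards [h1] with y hy
  have h2 := cutoff_nonneg x₀ (R := R) x
  have h3 := cutoff_nonneg x₀ (R := R) y
  rw [sq_sub_sq, abs_mul, abs_of_nonneg (add_nonneg h3 h2)]
  calc (cutoff x₀ R y + cutoff x₀ R x) * |cutoff x₀ R y - cutoff x₀ R x|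
      ≤ (2 * cutoff x₀ R x + R * ε) * (R⁻¹ * dist x y) :=
        mul_le_mul (by linarith) (abs_cutoff_sub_le x₀ hR x y) (abs_nonneg _) (by positivity)
    _ = _ := by field_simp

lemma lipschitzWith_cutoff_sq : LipschitzWith (Real.toNNReal (2 * R⁻¹))
    fun y ↦ cutoff x₀ R y ^ 2 :=
  LipschitzWith.of_dist_le_mul fun x y ↦ by
    rw [Real.coe_toNNReal _ (by positivity), Real.dist_eq, sq_sub_sq, abs_mul]
    have h2 := cutoff_nonneg x₀ (R := R) x
    have h3 := cutoff_nonneg x₀ (R := R) y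
    have h4 := cutoff_le_one x₀ (R := R) x
    have h5 := cutoff_le_one x₀ (R := R) y
    rw [abs_of_nonneg (add_nonneg h2 h3), abs_sub_comm]
    have := abs_cutoff_sub_le x₀ hR x y
    calc (cutoff x₀ R x + cutoff x₀ R y) * |cutoff x₀ R y - cutoff x₀ R x|
        ≤ 2 * (R⁻¹ * dist x y) := mul_le_mul (by linarith) this (abs_nonneg _) (by positivity)
      _ = _ := by ring

end Cutoff

section Vanishing

variable {n : ℕ} {X : Type*} [MetricSpace X] [ChartedSpace (EucSp n) X]
  [RiemannianBundle (fun x : X ↦ TangentSpace (𝓡 n) x)] [IsManifold (𝓡 n) ∞ X]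
  [IsContMDiffRiemannianBundle (𝓡 n) ∞ (EucSp n) (fun x : X ↦ TangentSpace (𝓡 n) x)]
  [MeasurableSpace X] [BorelSpace X]

/-- A nonnegative continuous function with vanishing integral over a ball vanishes at the centre. -/
lemma eq_zero_of_setLIntegral_ball {Q : X → ℝ} (hQ : Continuous Q) (hQ0 : ∀ z, 0 ≤ Q z) {x : X}
    {r : ℝ} (hr : 0 < r) (h : ∫⁻ z in Metric.ball x r, ENNReal.ofReal (Q z) ∂(riemVolume n X) = 0) :
    Q x = 0 := by
  rw [lintegral_eq_zero_iff hQ.measurable.ennreal_ofReal, Filter.EventuallyEq,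
    ae_restrict_iff' Metric.isOpen_ball.measurableSet] at h
  by_contra hx
  have hx' : 0 < Q x := lt_of_le_of_ne (hQ0 x) (Ne.symm hx)
  have hV : IsOpen (Metric.ball x r ∩ Q ⁻¹' Set.Ioi 0) :=
    Metric.isOpen_ball.inter (isOpen_Ioi.preimage hQ)
  refine (hV.measure_pos (riemVolume n X) ⟨x, Metric.mem_ball_self hr, hx'⟩).ne'
    (measure_mono_null ?_ h)
  intro z hz h1
  have h2 := h1 hz.1
  simp only [Pi.zero_apply, ENNReal.ofReal_eq_zero] at h2
  exact absurd hz.2 (not_lt.2 h2)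

variable [SecondCountableTopology X] [IsRiemannianManifold (𝓡 n) X]

/-- The divergence theorem for `- d* θ = Q ≥ 0`. -/
lemma lintegral_mul_le {θ : DForm n X 1} (hθ : θ.IsSmooth) {Q : X → ℝ}
    (hQ0 : ∀ z, 0 ≤ Q z) (hQθ : ∀ z, θ.codiff z ![] = - Q z)
    {f w : X → ℝ} {L : NNReal} (hf : LipschitzWith L f) (hf0 : ∀ z, 0 ≤ f z)
    (hfc : HasCompactSupport f)
    (hw : Measurable w) (hw0 : ∀ z, 0 ≤ w z) (hfw : ∀ z, SlopeLE f (w z) z) :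
    ∫⁻ z, ENNReal.ofReal (f z * Q z) ∂(riemVolume n X)
      ≤ ∫⁻ z, ENNReal.ofReal (w z * θ.pointNorm z) ∂(riemVolume n X) := by
  have : LocallyCompactSpace X := ChartedSpace.locallyCompactSpace (EucSp n) X
  have hQ : Continuous Q := (continuous_apply_zero (isSmooth_codiff hθ)).neg.congr fun z ↦ by
    rw [Pi.neg_apply, hQθ, neg_neg]
  have hint : Integrable (fun z ↦ f z * Q z) (riemVolume n X) :=
    Continuous.integrable_of_hasCompactSupport (hf.continuous.mul hQ) hfc.mul_right
  refine le_trans (le_of_eq ?_) (abs_integral_mul_codiff_le hθ hf hfc hw hw0 hfw)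
  rw [← ofReal_integral_eq_lintegral_ofReal hint
    (Filter.Eventually.of_forall fun z ↦ mul_nonneg (hf0 z) (hQ0 z))]
  congr 1
  simp only [hQθ, mul_neg, integral_neg, abs_neg]
  rw [abs_of_nonneg (integral_nonneg fun z ↦ mul_nonneg (hf0 z) (hQ0 z))]

variable [ProperSpace X]

/-- Caccioppoli's inequality on balls of growing radius: if `- d*θ = Q ≥ 0` and `|θ| ≤ C u √Q` with
`u` square-integrable, then `Q = 0`. Testing with the square of a cutoff function `χ` gives `∫ χ² Q
≤ (2 C / R) ∫ χ u √Q`, and half of the left-hand side absorbs `√Q`; no integrability of `Q` is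
assumed. -/
lemma eq_zero_of_pointNorm_le_mul_sqrt {θ : DForm n X 1} (hθ : θ.IsSmooth) {Q u : X → ℝ}
    (hQ0 : ∀ z, 0 ≤ Q z) (hQθ : ∀ z, θ.codiff z ![] = - Q z) {C : ℝ} (hu : Continuous u)
    (hui : ∫⁻ z, ENNReal.ofReal (u z ^ 2) ∂(riemVolume n X) < ⊤)
    (hθu : ∀ z, θ.pointNorm z ≤ C * u z * √(Q z)) (x : X) : Q x = 0 := by
  have hQ : Continuous Q := (continuous_apply_zero (isSmooth_codiff hθ)).neg.congr fun z ↦ by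
    rw [Pi.neg_apply, hQθ, neg_neg]
  set I := ∫⁻ z, ENNReal.ofReal (u z ^ 2) ∂(riemVolume n X) with hI
  have key : ∀ R : ℝ, 1 ≤ R → ∫⁻ z in Metric.ball x 1, ENNReal.ofReal (Q z) ∂(riemVolume n X)
      ≤ ENNReal.ofReal (4 * C ^ 2 * (R⁻¹) ^ 2) * I := by
    intro R hR
    have hR0 : 0 < R := zero_lt_one.trans_le hR
    have hLip := lipschitzWith_cutoff x hR0
    have hcont : Continuous (cutoff x R) := hLip.continuous
    have hsupp : HasCompactSupport fun z ↦ cutoff x R z ^ 2 := by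
      have h0 := (hasCompactSupport_cutoff x hR0).mul_right (f' := cutoff x R)
      rwa [← sq] at h0
    have h1 := lintegral_mul_le hθ hQ0 hQθ (lipschitzWith_cutoff_sq x hR0) (fun z ↦ sq_nonneg _)
      hsupp (w := fun z ↦ 2 * R⁻¹ * cutoff x R z) (by fun_prop)
      (fun z ↦ mul_nonneg (by positivity) (cutoff_nonneg x z)) (slopeLE_cutoff_sq x hR0)
    set A := ∫⁻ z, ENNReal.ofReal (cutoff x R z ^ 2 * Q z) ∂(riemVolume n X) with hA
    have hAfin : A ≠ ⊤ := by
      have : Integrable (fun z ↦ cutoff x R z ^ 2 * Q z) (riemVolume n X) :=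
        Continuous.integrable_of_hasCompactSupport ((hcont.pow 2).mul hQ) hsupp.mul_right
      exact this.lintegral_lt_top.ne
    -- absorb half of the left-hand side by the inequality between means
    have h2 : ∀ z, 2 * R⁻¹ * cutoff x R z * θ.pointNorm z
        ≤ 2⁻¹ * (cutoff x R z ^ 2 * Q z) + 2 * C ^ 2 * (R⁻¹) ^ 2 * u z ^ 2 := fun z ↦ by
      have h3 := cutoff_nonneg x (R := R) z
      have h4 := Real.sq_sqrt (hQ0 z)
      calc 2 * R⁻¹ * cutoff x R z * θ.pointNorm z
          ≤ 2 * R⁻¹ * cutoff x R z * (C * u z * √(Q z)) :=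
            mul_le_mul_of_nonneg_left (hθu z) (by positivity)
        _ ≤ 2⁻¹ * (cutoff x R z * √(Q z)) ^ 2 + 2 * (C * R⁻¹ * u z) ^ 2 := by
            nlinarith [sq_nonneg (cutoff x R z * √(Q z) - 2 * (C * R⁻¹ * u z))]
        _ = _ := by rw [mul_pow, h4]; ring
    have h5 : A ≤ ENNReal.ofReal 2⁻¹ * A + ENNReal.ofReal (2 * C ^ 2 * (R⁻¹) ^ 2) * I := by
      refine h1.trans ?_
      rw [hA, hI, ← lintegral_const_mul _ (by fun_prop), ← lintegral_const_mul _ (by fun_prop),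
        ← lintegral_add_left (by fun_prop)]
      refine lintegral_mono fun z ↦ ?_
      rw [← ENNReal.ofReal_mul (by positivity), ← ENNReal.ofReal_mul (by positivity),
        ← ENNReal.ofReal_add (mul_nonneg (by positivity) (mul_nonneg (sq_nonneg _) (hQ0 z)))
          (by positivity)]
      exact ENNReal.ofReal_le_ofReal (h2 z)
    have h6 : A ≤ ENNReal.ofReal (4 * C ^ 2 * (R⁻¹) ^ 2) * I := by
      rw [← ENNReal.ofReal_toReal hAfin, ← ENNReal.ofReal_toReal hui.ne,
        ← ENNReal.ofReal_mul (by positivity)] at h5 ⊢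
      rw [← ENNReal.ofReal_mul (by positivity), ← ENNReal.ofReal_add (by positivity) (by positivity),
        ENNReal.ofReal_le_ofReal_iff (by positivity)] at h5
      refine ENNReal.ofReal_le_ofReal ?_
      linarith
    refine le_trans ?_ h6
    rw [← lintegral_indicator Metric.isOpen_ball.measurableSet]
    refine lintegral_mono fun z ↦ ?_
    by_cases hz : z ∈ Metric.ball x 1
    · rw [Set.indicator_of_mem hz, cutoff_eq_one x hR0
        ((Metric.mem_ball'.1 hz).le.trans hR), one_pow, one_mul]
    · rw [Set.indicator_of_notMem hz]
      exact zero_le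
  refine eq_zero_of_setLIntegral_ball (n := n) hQ hQ0 one_pos (le_antisymm ?_ zero_le)
  have hlim : Filter.Tendsto (fun R : ℝ ↦ ENNReal.ofReal (4 * C ^ 2 * (R⁻¹) ^ 2) * I)
      Filter.atTop (𝓝 0) := by
    have h1 : Filter.Tendsto (fun R : ℝ ↦ 4 * C ^ 2 * (R⁻¹) ^ 2) Filter.atTop (𝓝 0) := by
      have h2 := ((tendsto_inv_atTop_zero (𝕜 := ℝ)).pow 2).const_mul (4 * C ^ 2)
      rwa [zero_pow two_ne_zero, mul_zero] at h2
    simpa using ENNReal.Tendsto.mul_const (ENNReal.tendsto_ofReal h1) (Or.inr hui.ne)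
  refine ge_of_tendsto hlim ?_
  filter_upwards [Filter.eventually_ge_atTop 1] with R hR
  exact key R hR

/-- The vanishing theorem that uses linear growth: if `- d*θ = Q ≥ 0` and `|θ|` is at most `C (1 +
ρ(x₀, ·)) u` with `u` integrable, then `Q = 0`. The factor `1 + ρ`, at most `3 R` on the shell where
the cutoff function varies, is compensated by the slope `1 / R`, and the integral of `u` over the
shell tends to `0`. -/
lemma eq_zero_of_pointNorm_le_linear {θ : DForm n X 1} (hθ : θ.IsSmooth) {Q u : X → ℝ}
    (hQ0 : ∀ z, 0 ≤ Q z) (hQθ : ∀ z, θ.codiff z ![] = - Q z) {C : ℝ} (hC : 0 ≤ C)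
    (hu : Continuous u) (hu0 : ∀ z, 0 ≤ u z)
    (hui : ∫⁻ z, ENNReal.ofReal (u z) ∂(riemVolume n X) < ⊤) (x₀ : X)
    (hθu : ∀ z, θ.pointNorm z ≤ C * (1 + dist x₀ z) * u z) (x : X) : Q x = 0 := by
  have hQ : Continuous Q := (continuous_apply_zero (isSmooth_codiff hθ)).neg.congr fun z ↦ by
    rw [Pi.neg_apply, hQθ, neg_neg]
  have hdist : Continuous (dist x₀) := continuous_const.dist continuous_id
  have hmeas : ∀ R : ℝ, MeasurableSet (dist x₀ ⁻¹' Set.Ici R) := fun R ↦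
    (isClosed_Ici.preimage hdist).measurableSet
  have key : ∀ R : ℝ, 1 + dist x₀ x ≤ R →
      ∫⁻ z in Metric.ball x 1, ENNReal.ofReal (Q z) ∂(riemVolume n X)
      ≤ ENNReal.ofReal (3 * C) * ∫⁻ z, (dist x₀ ⁻¹' Set.Ici R).indicator
        (fun z ↦ ENNReal.ofReal (u z)) z ∂(riemVolume n X) := by
    intro R hR
    have hR1 : 1 ≤ R := by linarith [dist_nonneg (x := x₀) (y := x)]
    have hR0 : 0 < R := zero_lt_one.trans_le hR1
    have hm : Measurable ((dist x₀ ⁻¹' Set.Icc R (2 * R)).indicator fun _ : X ↦ R⁻¹) :=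
      measurable_const.indicator (isClosed_Icc.preimage hdist).measurableSet
    have h1 := lintegral_mul_le hθ hQ0 hQθ (lipschitzWith_cutoff x₀ hR0) (cutoff_nonneg x₀)
      (hasCompactSupport_cutoff x₀ hR0) hm
      (fun z ↦ Set.indicator_nonneg (fun _ _ ↦ (inv_pos.2 hR0).le) z) (slopeLE_cutoff x₀ hR0)
    calc ∫⁻ z in Metric.ball x 1, ENNReal.ofReal (Q z) ∂(riemVolume n X)
        ≤ ∫⁻ z, ENNReal.ofReal (cutoff x₀ R z * Q z) ∂(riemVolume n X) := by
          rw [← lintegral_indicator Metric.isOpen_ball.measurableSet]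
          refine lintegral_mono fun z ↦ ?_
          by_cases hz : z ∈ Metric.ball x 1
          · have h2 : dist x₀ z ≤ R := by
              have := dist_triangle x₀ x z
              have := Metric.mem_ball'.1 hz
              linarith
            rw [Set.indicator_of_mem hz, cutoff_eq_one x₀ hR0 h2, one_mul]
          · rw [Set.indicator_of_notMem hz]
            exact zero_le
      _ ≤ _ := h1
      _ ≤ ∫⁻ z, ENNReal.ofReal (3 * C) * (dist x₀ ⁻¹' Set.Ici R).indicator
            (fun z ↦ ENNReal.ofReal (u z)) z ∂(riemVolume n X) := by
          refine lintegral_mono fun z ↦ ?_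
          by_cases hz : z ∈ dist x₀ ⁻¹' Set.Icc R (2 * R)
          · rw [Set.indicator_of_mem hz, Set.indicator_of_mem
              (show z ∈ dist x₀ ⁻¹' Set.Ici R from hz.1), ← ENNReal.ofReal_mul (by positivity)]
            refine ENNReal.ofReal_le_ofReal ?_
            rw [inv_mul_le_iff₀ hR0]
            refine (hθu z).trans ?_
            have h2 : 1 + dist x₀ z ≤ 3 * R := by linarith [hz.2]
            have h3 := hu0 z
            calc C * (1 + dist x₀ z) * u z ≤ C * (3 * R) * u z := by gcongr
              _ = R * (3 * C * u z) := by ring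
          · rw [Set.indicator_of_notMem hz, zero_mul, ENNReal.ofReal_zero]
            exact zero_le
      _ = _ := lintegral_const_mul _ (hu.measurable.ennreal_ofReal.indicator (hmeas R))
  refine eq_zero_of_setLIntegral_ball (n := n) hQ hQ0 one_pos (le_antisymm ?_ zero_le)
  have hlim : Filter.Tendsto (fun k : ℕ ↦ ENNReal.ofReal (3 * C) *
      ∫⁻ z, (dist x₀ ⁻¹' Set.Ici (k : ℝ)).indicator
        (fun z ↦ ENNReal.ofReal (u z)) z ∂(riemVolume n X)) Filter.atTop (𝓝 0) := by
    have h1 := tendsto_lintegral_of_dominated_convergence (μ := riemVolume n X)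
      (F := fun (k : ℕ) z ↦ (dist x₀ ⁻¹' Set.Ici (k : ℝ)).indicator
        (fun z ↦ ENNReal.ofReal (u z)) z) (f := fun _ ↦ 0) (fun z ↦ ENNReal.ofReal (u z))
      (fun k ↦ hu.measurable.ennreal_ofReal.indicator (hmeas k))
      (fun k ↦ Filter.Eventually.of_forall fun z ↦ Set.indicator_le_self _ _ z) hui.ne
      (Filter.Eventually.of_forall fun z ↦ by
        refine tendsto_const_nhds.congr' ?_
        obtain ⟨N, hN⟩ := exists_nat_gt (dist x₀ z)
        filter_upwards [Filter.eventually_ge_atTop N] with k hk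
        rw [Set.indicator_of_notMem]
        intro h
        have h2 : (k : ℝ) ≤ dist x₀ z := h
        have h3 : (N : ℝ) ≤ k := by exact_mod_cast hk
        linarith)
    have h2 := ENNReal.Tendsto.const_mul (a := ENNReal.ofReal (3 * C)) h1
      (Or.inr ENNReal.ofReal_ne_top)
    rwa [lintegral_zero, mul_zero] at h2
  refine ge_of_tendsto hlim ?_
  obtain ⟨N, hN⟩ := exists_nat_ge (1 + dist x₀ x)
  filter_upwards [Filter.eventually_ge_atTop N] with k hk
  exact key k (hN.trans (by exact_mod_cast hk))

end Vanishing

end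

/-! ### Square-integrable harmonic forms -/

section

open RiemForm Bundle

section Pointwise

variable {V : Type*} [NormedAddCommGroup V] [NormedSpace ℝ V] {ι : Type*} [Fintype ι] [DecidableEq ι]

lemma nrm_pairing_le (e : ι → V) {p : ℕ} (a : Alt V p) (c : Alt V (p + 1)) :
    nrm e (pairing e e a c) ≤ √(p + 1) * nrm e a * nrm e c := by
  have h1 : ∀ t : ℝ, nrm e (t • ContinuousAlternatingMap.constOfIsEmpty ℝ V (Fin 0) 1) = |t| :=
    fun t ↦ by
      rw [nrm_smul, nrm, inn_zero]
      simp
  have h2 := sum_nrm_ins_sq e (pairing e e a c)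
  simp only [ins_pairing, h1, sq_abs, Nat.cast_zero, zero_add, one_mul] at h2
  refine le_of_sq_le_sq ?_ (mul_nonneg (mul_nonneg (Real.sqrt_nonneg _) (nrm_nonneg e a))
    (nrm_nonneg e c))
  calc nrm e (pairing e e a c) ^ 2 = ∑ i, (inn e e p a (ins p (e i) c)) ^ 2 := h2.symm
    _ ≤ ∑ i, nrm e a ^ 2 * nrm e (ins p (e i) c) ^ 2 := Finset.sum_le_sum fun i _ ↦ by
        rw [← mul_pow, ← sq_abs]
        exact pow_le_pow_left₀ (abs_nonneg _) (abs_inn_le _ _ _) 2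
    _ = _ := by
        rw [← Finset.mul_sum, sum_nrm_ins_sq, mul_pow, mul_pow, Real.sq_sqrt (by positivity)]
        ring

end Pointwise

section Forms

variable {n : ℕ} {X : Type*} [TopologicalSpace X] [ChartedSpace (EucSp n) X]
  [RiemannianBundle (fun x : X ↦ TangentSpace (𝓡 n) x)] {p q : ℕ}

/-- The bound `|⟨a, ι c⟩| ≤ √(p + 1) |a| |c|`. -/
lemma pointNorm_pairForm_le (a : DForm n X p) (c : DForm n X (p + 1)) (x : X) :
    (pairForm a c).pointNorm x ≤ √(p + 1) * a.pointNorm x * c.pointNorm x := by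
  rw [pointNorm_eq, pointNorm_eq, pointNorm_eq]
  exact nrm_pairing_le _ _ _

variable (n X p q) in
lemma exists_pointNorm_contrForm_le : ∃ K : ℝ, 0 ≤ K ∧ ∀ (b : DForm n X q) (a : DForm n X (p + q))
    (x : X), (contrForm b a).pointNorm x ≤ K * b.pointNorm x * a.pointNorm x := by
  obtain ⟨K, hK, h⟩ := exists_nrm_contr_le (V := EucSp n) (Fin (Module.finrank ℝ (EucSp n))) p q
  refine ⟨K, hK, fun b a x ↦ ?_⟩
  rw [pointNorm_eq, pointNorm_eq, pointNorm_eq]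
  exact h _ _ _

variable (n X p q) in
lemma exists_pointNorm_wedgeForm_le : ∃ K : ℝ, 0 ≤ K ∧ ∀ (b : DForm n X q) (a : DForm n X p)
    (x : X), (wedgeForm b a).pointNorm x ≤ K * b.pointNorm x * a.pointNorm x := by
  obtain ⟨K, hK, h⟩ := exists_nrm_wedge_le (V := EucSp n) (Fin (Module.finrank ℝ (EucSp n))) p q
  refine ⟨K, hK, fun b a x ↦ ?_⟩
  rw [pointNorm_eq, pointNorm_eq, pointNorm_eq]
  exact h _ _ _

lemma pointInner_self_nonneg (a : DForm n X p) (x : X) : 0 ≤ a.pointInner a x := by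
  rw [FormAlg.pointInner_eq]
  exact inn_self_nonneg _ _

lemma pointInner_comm (a b : DForm n X p) (x : X) : a.pointInner b x = b.pointInner a x := by
  rw [FormAlg.pointInner_eq, FormAlg.pointInner_eq, inn_comm]

lemma pointInner_add_right (a b c : DForm n X p) (x : X) :
    a.pointInner (b + c) x = a.pointInner b x + a.pointInner c x := by
  rw [FormAlg.pointInner_eq, FormAlg.pointInner_eq, FormAlg.pointInner_eq, ← map_add]
  rfl

lemma pointInner_sub_right (a b c : DForm n X p) (x : X) :
    a.pointInner (b - c) x = a.pointInner b x - a.pointInner c x := by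
  rw [FormAlg.pointInner_eq, FormAlg.pointInner_eq, FormAlg.pointInner_eq, ← map_sub]
  rfl

lemma pointInner_zero_right (a : DForm n X p) (x : X) : a.pointInner 0 x = 0 := by
  rw [FormAlg.pointInner_eq, ← map_zero (inn (V := EucSp n) (onb x) (onb x) p (formAt a x))]
  rfl

omit [RiemannianBundle (fun x : X ↦ TangentSpace (𝓡 n) x)] in
lemma extd_zero : (0 : DForm n X p).extd = 0 := by
  funext x
  have h1 : (0 : DForm n X p).inChart x = 0 := rfl
  have h2 : extDeriv (0 : EucSp n → Alt (EucSp n) p) (extChartAt (𝓡 n) x x) = 0 := by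
    rw [extDeriv, fderiv_zero]
    exact map_zero (alternatizeUncurryFinCLM ℝ (EucSp n) ℝ)
  rw [DForm.extd, h1, h2]
  rfl

lemma span_range_onb (x : X) :
    Submodule.span ℝ (Set.range (onb (n := n) x)) = (⊤ : Submodule ℝ (EucSp n)) := by
  rw [eq_top_iff]
  intro v _
  rw [← sum_metricAt_onb x v]
  exact Submodule.sum_mem _ fun i _ ↦ Submodule.smul_mem _ _ (Submodule.subset_span ⟨i, rfl⟩)

lemma eq_zero_of_pointInner_self {a : DForm n X p} {x : X} (h : a.pointInner a x = 0) : a x = 0 := by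
  rw [FormAlg.pointInner_eq] at h
  exact eq_zero_of_inn_self (span_range_onb x) h

variable [MeasurableSpace X]

/-- A form is square-integrable. -/
def IsL2 (a : DForm n X p) : Prop :=
  ∫⁻ x, ENNReal.ofReal (a.pointNorm x ^ 2) ∂(riemVolume n X) < ⊤

lemma IsL2.of_le {a : DForm n X p} {b : DForm n X q} (ha : IsL2 a) {C : ℝ}
    (h : ∀ x, b.pointNorm x ≤ C * a.pointNorm x) : IsL2 b := by
  have h1 : ∫⁻ x, ENNReal.ofReal (C ^ 2) * ENNReal.ofReal (a.pointNorm x ^ 2) ∂(riemVolume n X)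
      < ⊤ := by
    rw [lintegral_const_mul' _ _ ENNReal.ofReal_ne_top]
    exact ENNReal.mul_lt_top ENNReal.ofReal_lt_top ha
  refine lt_of_le_of_lt (lintegral_mono fun x ↦ ?_) h1
  rw [← ENNReal.ofReal_mul (sq_nonneg C), ← mul_pow]
  exact ENNReal.ofReal_le_ofReal (pow_le_pow_left₀ (pointNorm_nonneg b x) (h x) 2)

end Forms

section Harmonic

variable {n : ℕ} {X : Type*} [MetricSpace X] [ChartedSpace (EucSp n) X]
  [RiemannianBundle (fun x : X ↦ TangentSpace (𝓡 n) x)] [IsManifold (𝓡 n) ∞ X]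
  [IsContMDiffRiemannianBundle (𝓡 n) ∞ (EucSp n) (fun x : X ↦ TangentSpace (𝓡 n) x)]
  [MeasurableSpace X] [BorelSpace X] [SecondCountableTopology X] [IsRiemannianManifold (𝓡 n) X]
  [ProperSpace X] {p : ℕ}

/-- A square-integrable harmonic form on a complete manifold is closed and coclosed: up to sign,
`|da|² + |d*a|²` is the divergence of the `1`-form `⟨a, ι da⟩ - ⟨d*a, ι a⟩`. -/
lemma extd_eq_zero_and_isCoclosed {a : DForm n X p} (ha : a.IsSmooth) (hL : IsL2 a)
    (hΔ : a.laplacian = 0) : a.extd = 0 ∧ IsCoclosed a := by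
  have hd := isSmooth_extd ha
  have hun : Continuous a.pointNorm := continuous_pointNorm ha
  cases p with
  | zero =>
    refine ⟨?_, trivial⟩
    have hΔ' : a.extd.codiff = 0 := hΔ
    funext x
    refine eq_zero_of_pointInner_self (eq_zero_of_pointNorm_le_mul_sqrt
      (isSmooth_pairForm ha hd) (Q := a.extd.pointInner a.extd) (pointInner_self_nonneg _)
      (C := √((0 : ℕ) + 1)) (fun z ↦ ?_) hun hL (fun z ↦ ?_) x)
    · rw [codiff_pairForm ha hd, hΔ', pointInner_zero_right, zero_sub]
    · exact pointNorm_pairForm_le a a.extd z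
  | succ p =>
    have hδ := isSmooth_codiff ha
    have hΔ' : a.codiff.extd + a.extd.codiff = 0 := hΔ
    have hQ0 : ∀ z, 0 ≤ a.extd.pointInner a.extd z + a.codiff.pointInner a.codiff z := fun z ↦
      add_nonneg (pointInner_self_nonneg _ z) (pointInner_self_nonneg _ z)
    have key : ∀ x, a.extd.pointInner a.extd x + a.codiff.pointInner a.codiff x = 0 := by
      refine eq_zero_of_pointNorm_le_mul_sqrt
        (isSmooth_sub (isSmooth_pairForm ha hd) (isSmooth_pairForm hδ ha)) hQ0 (fun z ↦ ?_)
        (C := √((p + 1 : ℕ) + 1) + √(p + 1)) hun hL (fun z ↦ ?_)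
      · rw [codiff_sub (isSmooth_pairForm ha hd) (isSmooth_pairForm hδ ha)]
        change (pairForm a a.extd).codiff z ![] - (pairForm a.codiff a).codiff z ![] = _
        rw [codiff_pairForm ha hd, codiff_pairForm hδ ha]
        have h1 := pointInner_add_right a a.codiff.extd a.extd.codiff z
        rw [hΔ', pointInner_zero_right, pointInner_comm a a.codiff.extd] at h1
        linarith
      · set Q := a.extd.pointInner a.extd z + a.codiff.pointInner a.codiff z with hQ
        have h1 : a.extd.pointNorm z ≤ √Q := Real.sqrt_le_sqrt (by
          linarith [pointInner_self_nonneg a.codiff z])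
        have h2 : a.codiff.pointNorm z ≤ √Q := Real.sqrt_le_sqrt (by
          linarith [pointInner_self_nonneg a.extd z])
        have h0 := pointNorm_nonneg a z
        calc (pairForm a a.extd - pairForm a.codiff a).pointNorm z
            ≤ √((p + 1 : ℕ) + 1) * a.pointNorm z * a.extd.pointNorm z
              + √(p + 1) * a.codiff.pointNorm z * a.pointNorm z :=
              (pointNorm_sub_le _ _ z).trans
                (add_le_add (pointNorm_pairForm_le _ _ z) (pointNorm_pairForm_le _ _ z))
          _ ≤ √((p + 1 : ℕ) + 1) * a.pointNorm z * √Q + √(p + 1) * √Q * a.pointNorm z := by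
              gcongr
          _ = _ := by ring
    constructor <;> funext x <;> refine eq_zero_of_pointInner_self ?_ <;>
      linarith [key x, pointInner_self_nonneg a.extd x, pointInner_self_nonneg a.codiff x]

variable {φ : DForm n X 3}

/-- If `φ = dβ` with `β` of linear growth, `a` is closed, `b` is coclosed and `⟨a, C_φ b⟩ ≥ 0`, then
`⟨a, C_φ b⟩ = 0`. Indeed the `1`-form `⟨a, ι C_β b⟩`, where `C_β` is the contraction with `β`, has
codifferential `- ⟨a, C_φ b⟩`, and it is bounded by the integrable function `|a| |b|` times a
function of linear growth. The integrable majorant of `|a| |b|` is `C u²`. -/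
lemma pointInner_contrForm_eq_zero (hlin : φ.IsDLinear) {a : DForm n X p} {b : DForm n X (p + 3)}
    (ha : a.IsSmooth) (hb : b.IsSmooth) (hda : a.extd = 0) (hδb : DForm.codiff (p := p + 2) b = 0)
    (h0 : ∀ x, 0 ≤ a.pointInner (contrForm φ b) x) {u : X → ℝ} (hu : Continuous u)
    (hui : ∫⁻ z, ENNReal.ofReal (u z ^ 2) ∂(riemVolume n X) < ⊤) {C : ℝ} (hC : 0 ≤ C)
    (hab : ∀ x, a.pointNorm x * b.pointNorm x ≤ C * u x ^ 2) (x : X) :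
    a.pointInner (contrForm φ b) x = 0 := by
  obtain ⟨β, x₀, c, hβ, hc, hφβ, hbd⟩ := hlin
  obtain ⟨K, hK, hKle⟩ := exists_pointNorm_contrForm_le n X (p + 1) 2
  have hsm : (contrForm (p := p + 1) β b).IsSmooth := isSmooth_contrForm hβ hb
  refine eq_zero_of_pointNorm_le_linear (isSmooth_pairForm ha hsm) h0 (fun z ↦ ?_)
    (show 0 ≤ √(p + 1) * K * c * C by positivity) (hu.pow 2) (fun z ↦ sq_nonneg _) hui x₀
    (fun z ↦ ?_) x
  · rw [codiff_pairForm ha hsm, codiff_contrForm_two hβ hb, hδb, hda, pointInner_sub_right,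
      pointInner_comm 0, pointInner_zero_right, sub_zero, ← hφβ]
    have h1 : contrForm β (0 : DForm n X (p + 2)) = 0 := by
      funext x
      exact map_zero (contr (V := EucSp n) (onb x) (onb x) p 2 (formAt β x))
    rw [h1, pointInner_zero_right, zero_sub]
  · have h1 := pointNorm_nonneg a z
    have h2 := pointNorm_nonneg b z
    calc (pairForm a (contrForm (p := p + 1) β b)).pointNorm z
        ≤ √(p + 1) * a.pointNorm z * (K * β.pointNorm z * b.pointNorm z) := by
          refine (pointNorm_pairForm_le _ _ z).trans ?_
          gcongr
          exact hKle β b z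
      _ ≤ √(p + 1) * a.pointNorm z * (K * (c * (1 + dist x₀ z)) * b.pointNorm z) := by
          gcongr
          exact (hbd z).2
      _ = √(p + 1) * K * c * (1 + dist x₀ z) * (a.pointNorm z * b.pointNorm z) := by ring
      _ ≤ √(p + 1) * K * c * (1 + dist x₀ z) * (C * u z ^ 2) := by
          have := dist_nonneg (x := x₀) (y := z)
          exact mul_le_mul_of_nonneg_left (hab z) (by positivity)
      _ = _ := by rw [Pi.pow_apply]; ring

omit [IsManifold (𝓡 n) ∞ X] [ProperSpace X] [SecondCountableTopology X] [MeasurableSpace X]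
  [IsContMDiffRiemannianBundle (𝓡 n) ∞ (EucSp n) (fun x : X ↦ TangentSpace (𝓡 n) x)]
  [BorelSpace X] [IsRiemannianManifold (𝓡 n) X] in
lemma laplacian_succ (a : DForm n X (p + 1)) : a.laplacian = a.codiff.extd + a.extd.codiff := rfl

variable (hφ : φ.IsSmooth) (hpar : φ.IsParallel) (hlin : φ.IsDLinear)

include hφ hpar hlin

/-- If `φ` is parallel and `d`(linear), then the wedge product of `φ` with a square-integrable
harmonic form `a` vanishes: `φ ∧ a` is harmonic and square-integrable, hence coclosed, and
`pointInner_contrForm_eq_zero` applies to `a` and `φ ∧ a`, since `⟨a, C_φ (φ ∧ a)⟩ = |φ ∧ a|²`. -/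
lemma wedgeForm_eq_zero {a : DForm n X p} (ha : a.IsSmooth) (hL : IsL2 a) (hΔ : a.laplacian = 0) :
    wedgeForm φ a = 0 := by
  obtain ⟨hd, hδ⟩ := extd_eq_zero_and_isCoclosed ha hL hΔ
  obtain ⟨_, _, c, _, hc, _, hbd⟩ := id hlin
  obtain ⟨K, hK, hKle⟩ := exists_pointNorm_wedgeForm_le n X p 3
  have hsm := isSmooth_wedgeForm hφ ha
  have hle : ∀ x, (wedgeForm φ a).pointNorm x ≤ K * c * a.pointNorm x := fun x ↦
    le_trans (hKle φ a x) (mul_le_mul_of_nonneg_right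
      (mul_le_mul_of_nonneg_left (hbd x).1 hK) (pointNorm_nonneg a x))
  have hΔ' : (wedgeForm φ a).laplacian = 0 := by
    rw [laplacian_succ (p := p + 2), extd_codiff_wedgeForm hφ hpar ha hd hδ, extd_wedgeForm hφ hpar ha hd, codiff_zero, zero_add]
  have hcc := (extd_eq_zero_and_isCoclosed hsm (hL.of_le hle) hΔ').2
  have hδ' : DForm.codiff (p := p + 2) (wedgeForm (p := p) (q := 3) φ a) = 0 := hcc
  have h1 : ∀ x, a.pointInner (contrForm φ (wedgeForm φ a)) x
      = (wedgeForm φ a).pointInner (wedgeForm φ a) x := fun x ↦ (pointInner_wedgeForm _ _ _ x).symm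
  have h2 : ∀ x, a.pointNorm x * (wedgeForm φ a).pointNorm x ≤ K * c * a.pointNorm x ^ 2 :=
    fun x ↦ by
      calc a.pointNorm x * (wedgeForm φ a).pointNorm x
          ≤ a.pointNorm x * (K * c * a.pointNorm x) :=
            mul_le_mul_of_nonneg_left (hle x) (pointNorm_nonneg a x)
        _ = _ := by ring
  have h3 : ∀ x, 0 ≤ a.pointInner (contrForm φ (wedgeForm φ a)) x := fun x ↦
    (pointInner_self_nonneg (wedgeForm φ a) x).trans_eq (h1 x).symm
  have h4 := pointInner_contrForm_eq_zero hlin ha hsm hd hδ' h3 (continuous_pointNorm ha) hL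
    (show 0 ≤ K * c by positivity) h2
  exact funext fun x ↦ eq_zero_of_pointInner_self (a := wedgeForm φ a) ((h1 x).symm.trans (h4 x))

/-- If `φ` is parallel and `d`(linear), then the contraction `C_φ a` of a square-integrable harmonic
form `a` vanishes: it is harmonic and square-integrable, hence closed, and
`pointInner_contrForm_eq_zero` applies to `C_φ a` and `a`. -/
lemma contrForm_eq_zero {a : DForm n X (p + 3)} (ha : a.IsSmooth) (hL : IsL2 a)
    (hΔ : a.laplacian = 0) : contrForm φ a = 0 := by
  obtain ⟨hd, hδ⟩ := extd_eq_zero_and_isCoclosed ha hL hΔ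
  obtain ⟨_, _, c, _, hc, _, hbd⟩ := id hlin
  obtain ⟨K, hK, hKle⟩ := exists_pointNorm_contrForm_le n X p 3
  have hsm := isSmooth_contrForm hφ ha
  have hle : ∀ x, (contrForm φ a).pointNorm x ≤ K * c * a.pointNorm x := fun x ↦ by
    refine (hKle φ a x).trans ?_
    have := pointNorm_nonneg a x
    gcongr
    exact (hbd x).1
  have hδ0 : DForm.codiff (p := p + 2) a = 0 := hδ
  have hdδ := codiff_extd_contrForm hφ hpar ha hd hδ0
  have hΔ' : (contrForm φ a).laplacian = 0 := by
    cases p with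
    | zero => exact hdδ
    | succ p =>
      change (contrForm φ a).codiff.extd + (contrForm φ a).extd.codiff = 0
      rw [hdδ, codiff_contrForm hφ hpar ha hδ0, add_zero]
      exact extd_zero
  have hd' := (extd_eq_zero_and_isCoclosed hsm (hL.of_le hle) hΔ').1
  funext x
  refine eq_zero_of_pointInner_self (pointInner_contrForm_eq_zero hlin hsm ha hd' hδ0
    (pointInner_self_nonneg _) (continuous_pointNorm ha) hL
    (show 0 ≤ K * c by positivity) (fun x ↦ ?_) x)
  calc (contrForm φ a).pointNorm x * a.pointNorm x
      ≤ K * c * a.pointNorm x * a.pointNorm x :=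
        mul_le_mul_of_nonneg_right (hle x) (pointNorm_nonneg a x)
    _ = _ := by ring

end Harmonic

end

/-! ### Alternating forms on `ℝⁿ` in the standard basis -/

section

open RiemForm Bundle

section StandardBasis

variable {n p : ℕ}

lemma continuous_alternatingMap (f : (EucSp n) [⋀^Fin p]→ₗ[ℝ] ℝ) : Continuous f := by
  have h : ∀ v, f v = ∑ s : Fin p → Fin n, (∏ i, stdC n (s i) (v i)) * f fun i ↦ stdB n (s i) := by
    intro v
    have h1 : v = fun i ↦ ∑ j, stdC n j (v i) • stdB n j := by
      funext i
      exact ((dualBases_std n).sum_eq (v i)).symm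
    conv_lhs => rw [h1]
    refine (f.toMultilinearMap.map_sum _).trans (Finset.sum_congr rfl fun s _ ↦ ?_)
    exact f.toMultilinearMap.map_smul_univ _ _
  rw [funext h]
  fun_prop

variable (n p) in
/-- Alternating forms on `ℝⁿ` are continuous. -/
def altEquiv : Alt (EucSp n) p ≃ₗ[ℝ] (EucSp n) [⋀^Fin p]→ₗ[ℝ] ℝ :=
  LinearEquiv.ofBijective (ContinuousAlternatingMap.toAlternatingMapLinear (R := ℝ))
    ⟨ContinuousAlternatingMap.toAlternatingMap_injective, fun f ↦
      ⟨{ f with cont := continuous_alternatingMap f }, rfl⟩⟩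

instance : FiniteDimensional ℝ (Alt (EucSp n) p) :=
  Module.Finite.equiv ((altEquiv n p).trans exteriorPower.alternatingMapLinearEquiv).symm

lemma finrank_alt : Module.finrank ℝ (Alt (EucSp n) p) = n.choose p := by
  rw [((altEquiv n p).trans exteriorPower.alternatingMapLinearEquiv).finrank_eq]
  refine (Subspace.dual_finrank_eq (K := ℝ) (V := ⋀[ℝ]^p (EucSp n))).trans ?_
  rw [exteriorPower.finrank_eq, finrank_euclideanSpace_fin]

/-- An alternating form vanishes if it does so on one ordering of each set of `p` vectors of the
standard basis. -/
lemma eq_zero_of_forall_image {a : Alt (EucSp n) p} (h : ∀ S : Finset (Fin n), S.card = p →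
    ∃ t : Fin p → Fin n, Finset.univ.image t = S ∧ a (fun j ↦ stdB n (t j)) = 0) : a = 0 := by
  have key : a.toAlternatingMap = 0 := by
    refine Module.Basis.ext_alternating (EuclideanSpace.basisFun (Fin n) ℝ).toBasis fun s hs ↦ ?_
    have hcard : (Finset.univ.image s).card = p := by
      rw [Finset.card_image_of_injective _ hs, Finset.card_univ, Fintype.card_fin]
    obtain ⟨t, ht, hat⟩ := h _ hcard
    have hmem : ∀ j, ∃ i, t i = s j := fun j ↦ by
      have : s j ∈ Finset.univ.image t := by
        rw [ht]
        exact Finset.mem_image_of_mem _ (Finset.mem_univ j)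
      simpa using this
    choose σ hσ using hmem
    have hσi : Function.Injective σ := fun i j hij ↦ hs (by rw [← hσ i, ← hσ j, hij])
    have h1 := a.toAlternatingMap.map_perm (fun j ↦ stdB n (t j))
      (Equiv.ofBijective σ (Finite.injective_iff_bijective.1 hσi))
    have h2 : a.toAlternatingMap (fun j ↦ stdB n (t j)) = 0 := hat
    rw [h2, smul_zero] at h1
    have h3 : (fun i ↦ (EuclideanSpace.basisFun (Fin n) ℝ).toBasis (s i))
        = (fun j ↦ stdB n (t j)) ∘ (Equiv.ofBijective σ (Finite.injective_iff_bijective.1 hσi)) := by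
      funext i
      simp [stdB, hσ]
    rw [h3, h1]
    rfl
  exact ContinuousAlternatingMap.toAlternatingMap_injective key

/-- The contraction with a `3`-form, in components. -/
lemma contr_three_apply {V ι : Type*} [NormedAddCommGroup V] [NormedSpace ℝ V] [Fintype ι]
    (e : ι → V) (b : Alt V 3) (a : Alt V (p + 3)) (w : Fin p → V) :
    contr e e p 3 b a w = 6⁻¹ * ∑ i, ∑ j, ∑ k, b ![e i, e j, e k] *
      a (Matrix.vecCons (e i) (Matrix.vecCons (e j) (Matrix.vecCons (e k) w))) := by
  have h1 : ∀ i j k, ins 0 (e k) (ins 1 (e j) (ins 2 (e i) b)) ![] = b ![e i, e j, e k] :=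
    fun _ _ _ ↦ rfl
  have h2 : ∀ i j k, ins p (e k) (ins (p + 1) (e j) (ins (p + 2) (e i) a)) w
      = a (Matrix.vecCons (e i) (Matrix.vecCons (e j) (Matrix.vecCons (e k) w))) := fun _ _ _ ↦ rfl
  simp only [contr_succ, contr_zero, ContinuousAlternatingMap.smul_apply,
    ContinuousAlternatingMap.sum_apply, smul_eq_mul, Finset.mul_sum, h1]
  refine Finset.sum_congr rfl fun i _ ↦ Finset.sum_congr rfl fun j _ ↦
    Finset.sum_congr rfl fun k _ ↦ ?_
  rw [← h2]
  change _ = 6⁻¹ * (_ * ins (p + 0) (e k) (ins (p + 1) (e j) (ins (p + 2) (e i) a)) w)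
  push_cast
  ring

/-- The contraction of `e^a ∧ e^b ∧ e^c` with an alternating tensor `G`. -/
lemma sum_triple {G : Fin 7 → Fin 7 → Fin 7 → ℝ} (h₁ : ∀ i j k, G i j k = - G j i k)
    (h₂ : ∀ i j k, G i j k = - G i k j) (a b c : Fin 7) :
    ∑ i, ∑ j, ∑ k, triple a b c ![stdB 7 i, stdB 7 j, stdB 7 k] * G i j k = 6 * G a b c := by
  have hδ : ∀ i j, stdB 7 i j = if i = j then (1 : ℝ) else 0 := fun i j ↦ by
    simp [stdB, eq_comm]
  have key : ∀ a b c, ∑ i, ∑ j, ∑ k, stdB 7 i a * stdB 7 j b * stdB 7 k c * G i j k = G a b c := by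
    intro a b c
    simp [hδ]
  have h3 : ∀ i j k, triple a b c ![stdB 7 i, stdB 7 j, stdB 7 k] * G i j k
      = stdB 7 i a * stdB 7 j b * stdB 7 k c * G i j k
        - stdB 7 i a * stdB 7 j c * stdB 7 k b * G i j k
        - stdB 7 i b * stdB 7 j a * stdB 7 k c * G i j k
        + stdB 7 i b * stdB 7 j c * stdB 7 k a * G i j k
        + stdB 7 i c * stdB 7 j a * stdB 7 k b * G i j k
        - stdB 7 i c * stdB 7 j b * stdB 7 k a * G i j k := fun i j k ↦ by
    simp only [triple, Matrix.det_fin_three, Matrix.of_apply, Matrix.cons_val_zero,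
      Matrix.cons_val_one, Matrix.cons_val]
    ring
  simp only [h3, Finset.sum_add_distrib, Finset.sum_sub_distrib, key]
  linarith [h₂ a c b, h₁ b a c, h₁ b c a, h₂ c b a, h₁ c a b, h₂ a c b]

end StandardBasis

end

/-! ### Contraction of `5`-forms on `ℝ⁷` with the standard `G₂`-form -/

section

open RiemForm Bundle

section StandardG2

/-- The components of a `5`-form in the standard basis of `ℝ⁷`. -/
def comp5 (a : Alt (EucSp 7) 5) (i j k l m : Fin 7) : ℝ :=
  a fun t ↦ stdB 7 (![i, j, k, l, m] t)

variable (a : Alt (EucSp 7) 5)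

lemma comp5_perm (s : Fin 5 → Fin 7) (σ : Equiv.Perm (Fin 5)) :
    a (fun t ↦ stdB 7 (s (σ t))) = (Equiv.Perm.sign σ : ℤ) • a (fun t ↦ stdB 7 (s t)) :=
  a.toAlternatingMap.map_perm (fun t ↦ stdB 7 (s t)) σ

lemma comp5_eq_zero (s : Fin 5 → Fin 7) {i j : Fin 5} (hij : i ≠ j) (h : s i = s j) :
    a (fun t ↦ stdB 7 (s t)) = 0 :=
  a.map_eq_zero_of_eq _ (by rw [h]) hij

lemma comp5_swap₁ (i j k l m : Fin 7) : comp5 a i j k l m = - comp5 a j i k l m := by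
  have := comp5_perm a ![j, i, k, l, m] (Equiv.swap 0 1)
  rw [Equiv.Perm.sign_swap (by decide)] at this
  simp only [Units.val_neg, Units.val_one, neg_smul, one_smul] at this
  rw [comp5, comp5, ← this]
  congr 1
  funext t
  fin_cases t <;> rfl

lemma comp5_swap₂ (i j k l m : Fin 7) : comp5 a i j k l m = - comp5 a i k j l m := by
  have := comp5_perm a ![i, k, j, l, m] (Equiv.swap 1 2)
  rw [Equiv.Perm.sign_swap (by decide)] at this
  simp only [Units.val_neg, Units.val_one, neg_smul, one_smul] at this
  rw [comp5, comp5, ← this]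
  congr 1
  funext t
  fin_cases t <;> rfl

lemma comp5_swap₃ (i j k l m : Fin 7) : comp5 a i j k l m = - comp5 a i j l k m := by
  have := comp5_perm a ![i, j, l, k, m] (Equiv.swap 2 3)
  rw [Equiv.Perm.sign_swap (by decide)] at this
  simp only [Units.val_neg, Units.val_one, neg_smul, one_smul] at this
  rw [comp5, comp5, ← this]
  congr 1
  funext t
  fin_cases t <;> rfl

lemma comp5_swap₄ (i j k l m : Fin 7) : comp5 a i j k l m = - comp5 a i j k m l := by
  have := comp5_perm a ![i, j, k, m, l] (Equiv.swap 3 4)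
  rw [Equiv.Perm.sign_swap (by decide)] at this
  simp only [Units.val_neg, Units.val_one, neg_smul, one_smul] at this
  rw [comp5, comp5, ← this]
  congr 1
  funext t
  fin_cases t <;> rfl

lemma comp5_rotate (i j k l m : Fin 7) : comp5 a i j k l m = comp5 a j k i l m := by
  rw [comp5_swap₁, comp5_swap₂, neg_neg]

/-- Exchanging the last two pairs of indices is an even permutation. -/
lemma comp5_exchange (i j k l m : Fin 7) : comp5 a i j k l m = comp5 a i l m j k := by
  rw [comp5_swap₃ a i j k l m, comp5_swap₂ a i j l k m, comp5_swap₄ a i l j k m,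
    comp5_swap₃ a i l j m k]
  ring

@[simp] lemma comp5_self₁₄ (i j k m : Fin 7) : comp5 a i j k i m = 0 :=
  comp5_eq_zero a ![i, j, k, i, m] (i := 0) (j := 3) (by decide) rfl

@[simp] lemma comp5_self₁₅ (i j k m : Fin 7) : comp5 a i j k m i = 0 :=
  comp5_eq_zero a ![i, j, k, m, i] (i := 0) (j := 4) (by decide) rfl

@[simp] lemma comp5_self₂₄ (i j k m : Fin 7) : comp5 a j i k i m = 0 :=
  comp5_eq_zero a ![j, i, k, i, m] (i := 1) (j := 3) (by decide) rfl

@[simp] lemma comp5_self₂₅ (i j k m : Fin 7) : comp5 a j i k m i = 0 :=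
  comp5_eq_zero a ![j, i, k, m, i] (i := 1) (j := 4) (by decide) rfl

@[simp] lemma comp5_self₃₄ (i j k m : Fin 7) : comp5 a j k i i m = 0 :=
  comp5_eq_zero a ![j, k, i, i, m] (i := 2) (j := 3) (by decide) rfl

@[simp] lemma comp5_self₃₅ (i j k m : Fin 7) : comp5 a j k i m i = 0 :=
  comp5_eq_zero a ![j, k, i, m, i] (i := 2) (j := 4) (by decide) rfl

/-- The block of equations at a point `k` of the Fano plane. The lines `{k, b, c}`, `{k, d, e}` and
`{k, f, g}` through `k` give, on evaluation at `(b, c)`, `(d, e)` and `(f, g)`, the equations `x + y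
= x + z = y + z = 0` for the three components of `a` on the unions of two of these lines. The terms
`R` of the four other lines vanish there, since each of these lines meets the lines through `k`. -/
lemma comp5_block {k b c d e f g : Fin 7} {R : Fin 7 → Fin 7 → ℝ} (h : ∀ l m, comp5 a k b c l m
    + comp5 a k d e l m + comp5 a k f g l m + R l m = 0) (h₁ : R b c = 0) (h₂ : R d e = 0)
    (h₃ : R f g = 0) :
    comp5 a k b c d e = 0 ∧ comp5 a k b c f g = 0 ∧ comp5 a k d e f g = 0 := by
  have e₁ := h b c
  have e₂ := h d e
  have e₃ := h f g
  rw [h₁, comp5_self₂₄, comp5_exchange a k d e, comp5_exchange a k f g b c] at e₁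
  rw [h₂, comp5_self₂₄, comp5_exchange a k f g d e] at e₂
  rw [h₃, comp5_self₂₄] at e₃
  refine ⟨?_, ?_, ?_⟩ <;> linarith

/-- Every set of five points of the Fano plane is the union of two lines through a point `k`: the
two remaining points span the third line through `k`. The entries of the list are the components of
`comp5_block`, for each of the seven points in turn. -/
lemma exists_lines (S : Finset (Fin 7)) (hS : S.card = 5) : ∃ t ∈ ([![0, 1, 2, 3, 4],
    ![0, 1, 2, 5, 6], ![0, 3, 4, 5, 6], ![1, 2, 0, 3, 5], ![1, 2, 0, 6, 4], ![1, 3, 5, 6, 4],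
    ![2, 0, 1, 6, 3], ![2, 0, 1, 5, 4], ![2, 6, 3, 5, 4], ![3, 4, 0, 5, 1], ![3, 4, 0, 2, 6],
    ![3, 5, 1, 2, 6], ![4, 0, 3, 1, 6], ![4, 0, 3, 2, 5], ![4, 1, 6, 2, 5], ![5, 6, 0, 1, 3],
    ![5, 6, 0, 4, 2], ![5, 1, 3, 4, 2], ![6, 0, 5, 4, 1], ![6, 0, 5, 3, 2], ![6, 4, 1, 3, 2]] :
    List (Fin 5 → Fin 7)), Finset.univ.image t = S := by
  revert S
  decide +kernel

/-- The contraction of a `5`-form with the standard `G₂`-form `e¹²³ + e¹⁴⁵ + e¹⁶⁷ + e²⁴⁶ - e²⁵⁷ -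
e³⁴⁷ - e³⁵⁶` is injective. Its seven terms are the lines of the Fano plane, and its components split
the `21` components of the `5`-form into seven blocks of three. The indices are shifted to `0, …, 6`
here. -/
lemma eq_zero_of_contr_standardG2 {b : Alt (EucSp 7) 3} (hb : ∀ v, b v = standardG2 v)
    {a : Alt (EucSp 7) 5} (h : contr (stdB 7) (stdB 7) 2 3 b a = 0) : a = 0 := by
  have hE : ∀ l m, comp5 a 0 1 2 l m + comp5 a 0 3 4 l m + comp5 a 0 5 6 l m + comp5 a 1 3 5 l m
      + comp5 a 1 6 4 l m + comp5 a 2 6 3 l m + comp5 a 2 5 4 l m = 0 := fun l m ↦ by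
    have h1 : contr (stdB 7) (stdB 7) 2 3 b a ![stdB 7 l, stdB 7 m] = 0 := by rw [h]; rfl
    rw [contr_three_apply] at h1
    have h2 : ∀ i j k, a (Matrix.vecCons (stdB 7 i) (Matrix.vecCons (stdB 7 j)
        (Matrix.vecCons (stdB 7 k) ![stdB 7 l, stdB 7 m]))) = comp5 a i j k l m := fun i j k ↦ by
      rw [comp5]
      congr 1
      funext t
      fin_cases t <;> rfl
    simp only [h2, hb, standardG2, add_mul, sub_mul, Finset.sum_add_distrib,
      Finset.sum_sub_distrib, sum_triple (fun i j k ↦ comp5_swap₁ a i j k l m)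
        (fun i j k ↦ comp5_swap₂ a i j k l m)] at h1
    -- reversing the orientation of the three lines with coefficient `-1` makes all signs positive
    rw [comp5_swap₂ a 1 6 4, comp5_swap₂ a 2 6 3, comp5_swap₂ a 2 5 4]
    linarith
  -- the lines through each point, rotated so that this point comes first
  have r := comp5_rotate a
  obtain ⟨x0, y0, z0⟩ := comp5_block a (k := 0) (b := 1) (c := 2) (d := 3) (e := 4) (f := 5) (g := 6)
    (R := fun l m ↦ comp5 a 1 3 5 l m + comp5 a 1 6 4 l m + comp5 a 2 6 3 l m + comp5 a 2 5 4 l m)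
    (fun l m ↦ by linarith [hE l m]) (by simp) (by simp) (by simp)
  obtain ⟨x1, y1, z1⟩ := comp5_block a (k := 1) (b := 2) (c := 0) (d := 3) (e := 5) (f := 6) (g := 4)
    (R := fun l m ↦ comp5 a 0 3 4 l m + comp5 a 0 5 6 l m + comp5 a 2 6 3 l m + comp5 a 2 5 4 l m)
    (fun l m ↦ by linarith [hE l m, r 0 1 2 l m]) (by simp) (by simp) (by simp)
  obtain ⟨x2, y2, z2⟩ := comp5_block a (k := 2) (b := 0) (c := 1) (d := 6) (e := 3) (f := 5) (g := 4)
    (R := fun l m ↦ comp5 a 0 3 4 l m + comp5 a 0 5 6 l m + comp5 a 1 3 5 l m + comp5 a 1 6 4 l m)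
    (fun l m ↦ by linarith [hE l m, r 2 0 1 l m]) (by simp) (by simp) (by simp)
  obtain ⟨x3, y3, z3⟩ := comp5_block a (k := 3) (b := 4) (c := 0) (d := 5) (e := 1) (f := 2) (g := 6)
    (R := fun l m ↦ comp5 a 0 1 2 l m + comp5 a 0 5 6 l m + comp5 a 1 6 4 l m + comp5 a 2 5 4 l m)
    (fun l m ↦ by linarith [hE l m, r 0 3 4 l m, r 1 3 5 l m, r 3 2 6 l m]) (by simp) (by simp) (by simp)
  obtain ⟨x4, y4, z4⟩ := comp5_block a (k := 4) (b := 0) (c := 3) (d := 1) (e := 6) (f := 2) (g := 5)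
    (R := fun l m ↦ comp5 a 0 1 2 l m + comp5 a 0 5 6 l m + comp5 a 1 3 5 l m + comp5 a 2 6 3 l m)
    (fun l m ↦ by linarith [hE l m, r 4 0 3 l m, r 4 1 6 l m, r 4 2 5 l m]) (by simp) (by simp) (by simp)
  obtain ⟨x5, y5, z5⟩ := comp5_block a (k := 5) (b := 6) (c := 0) (d := 1) (e := 3) (f := 4) (g := 2)
    (R := fun l m ↦ comp5 a 0 1 2 l m + comp5 a 0 3 4 l m + comp5 a 1 6 4 l m + comp5 a 2 6 3 l m)
    (fun l m ↦ by linarith [hE l m, r 0 5 6 l m, r 5 1 3 l m, r 2 5 4 l m]) (by simp) (by simp) (by simp)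
  obtain ⟨x6, y6, z6⟩ := comp5_block a (k := 6) (b := 0) (c := 5) (d := 4) (e := 1) (f := 3) (g := 2)
    (R := fun l m ↦ comp5 a 0 1 2 l m + comp5 a 0 3 4 l m + comp5 a 1 3 5 l m + comp5 a 2 5 4 l m)
    (fun l m ↦ by linarith [hE l m, r 6 0 5 l m, r 1 6 4 l m, r 2 6 3 l m]) (by simp) (by simp) (by simp)
  refine eq_zero_of_forall_image fun S hS ↦ ?_
  obtain ⟨t, ht, hS⟩ := exists_lines S hS
  refine ⟨t, hS, ?_⟩
  simp only [List.mem_cons, List.not_mem_nil, or_false] at ht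
  rcases ht with rfl | rfl | rfl | rfl | rfl | rfl | rfl | rfl | rfl | rfl | rfl | rfl | rfl | rfl | rfl | rfl | rfl | rfl | rfl | rfl | rfl
  exacts [x0, y0, z0, x1, y1, z1, x2, y2, z2, x3, y3, z3, x4, y4, z4, x5, y5, z5, x6, y6, z6]

end StandardG2

end

/-! ### Algebra of a `G₂`-structure -/

section

open RiemForm Bundle

section Algebra

variable {b : Alt (EucSp 7) 3} (hb : ∀ v, b v = standardG2 v)

include hb

/-- Injectivity in degree `5` implies it in higher degrees, since interior multiplication
anticommutes with the contraction. -/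
lemma eq_zero_of_contr_standardG2_of_five_le {p : ℕ} {a : Alt (EucSp 7) (p + 2 + 3)}
    (h : contr (stdB 7) (stdB 7) (p + 2) 3 b a = 0) : a = 0 := by
  induction p with
  | zero => exact eq_zero_of_contr_standardG2 hb h
  | succ p ih =>
    have h1 : ∀ v, ins (p + 2 + 3) v a = 0 := fun v ↦ ih (by
      have h2 := ins_contr_three (p := p + 2) (stdB 7) v b a
      rw [h, map_zero] at h2
      exact neg_eq_zero.1 h2.symm)
    ext v
    rw [← Matrix.cons_head_tail v]
    exact congrArg (fun t : Alt (EucSp 7) (p + 2 + 3) ↦ t (Matrix.vecTail v)) (h1 (v 0))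

/-- On `2`-forms the wedge product with `b` is injective: its adjoint, the contraction of `5`-forms
with `b`, is injective and hence surjective, as `2`-forms and `5`-forms on `ℝ⁷` have the same
dimension. -/
lemma eq_zero_of_wedge_standardG2_two {a : Alt (EucSp 7) 2} (h : wedge 2 3 b a = 0) : a = 0 := by
  let T : Alt (EucSp 7) 5 →ₗ[ℝ] Alt (EucSp 7) 2 := (contr (stdB 7) (stdB 7) 2 3 b).toLinearMap
  have hT : Function.Injective T := (injective_iff_map_eq_zero T).2 fun c hc ↦
    eq_zero_of_contr_standardG2 hb hc
  have hdim : Module.finrank ℝ (Alt (EucSp 7) 5) = Module.finrank ℝ (Alt (EucSp 7) 2) := by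
    rw [finrank_alt, finrank_alt]
    rfl
  obtain ⟨c, hc⟩ := (LinearMap.injective_iff_surjective_of_finrank_eq_finrank hdim).1 hT a
  have hc' : contr (stdB 7) (stdB 7) 2 3 b c = a := hc
  have hspan : Submodule.span ℝ (Set.range (stdB 7)) = ⊤ := by
    rw [eq_top_iff]
    intro v _
    rw [← (dualBases_std 7).sum_eq v]
    exact Submodule.sum_mem _ fun i _ ↦ Submodule.smul_mem _ _ (Submodule.subset_span ⟨i, rfl⟩)
  refine eq_zero_of_inn_self hspan ?_
  have h1 := inn_wedge (stdB 7) (stdB 7) b a c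
  rw [h, hc', map_zero] at h1
  exact h1.symm

/-- Injectivity on `2`-forms implies it on `1`-forms, since exterior multiplication by covectors
anticommutes with the wedge product with `b`. -/
lemma eq_zero_of_wedge_standardG2_one {a : Alt (EucSp 7) 1} (h : wedge 1 3 b a = 0) : a = 0 := by
  have h1 : ∀ θ, ext 1 θ a = 0 := fun θ ↦ eq_zero_of_wedge_standardG2_two hb (by
    have h2 := (dualBases_std 7).ext_wedge_three θ b a
    rw [h, map_zero] at h2
    exact neg_eq_zero.1 h2.symm)
  refine eq_zero_of_forall_image fun S hS ↦ ?_
  obtain ⟨i, rfl⟩ := Finset.card_eq_one.1 hS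
  refine ⟨fun _ ↦ i, by simp, ?_⟩
  obtain ⟨j, hj⟩ := exists_ne i
  -- evaluate `e^j ∧ a` on `e_j` and `e_i`
  have h2 := ext_apply (stdC 7 j) a ![stdB 7 j, stdB 7 i]
  rw [h1, Fin.sum_univ_two] at h2
  have h3 : stdC 7 j (stdB 7 j) = 1 := by rw [(dualBases_std 7).dual, if_pos rfl]
  have h4 : stdC 7 j (stdB 7 i) = 0 := by rw [(dualBases_std 7).dual, if_neg hj]
  simp only [Fin.val_zero, pow_zero, Matrix.cons_val_zero, h3, Matrix.cons_val_one, h4, zero_mul,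
    mul_zero, add_zero, one_mul] at h2
  refine Eq.trans ?_ h2.symm
  congr 1
  funext t
  fin_cases t
  rfl

lemma eq_zero_of_wedge_standardG2_zero {a : Alt (EucSp 7) 0} (h : wedge 0 3 b a = 0) : a = 0 := by
  have h1 : ext 0 (stdC 7 0) a = 0 := eq_zero_of_wedge_standardG2_one hb (by
    have h2 := (dualBases_std 7).ext_wedge_three (stdC 7 0) b a
    rw [h, map_zero] at h2
    exact neg_eq_zero.1 h2.symm)
  have h2 := ins_ext_zero (stdC 7 0) (stdB 7 0) a
  rw [h1, map_zero, (dualBases_std 7).dual, if_pos rfl, one_smul] at h2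
  exact h2.symm

end Algebra

section Transfer

/-- The tensor `∑ eᵢ ⊗ eᵢ` is the same for all orthonormal bases. -/
lemma sameTensor_of_orthonormalBasis {V ι κ : Type*} [NormedAddCommGroup V] [InnerProductSpace ℝ V]
    [Fintype ι] [Fintype κ] (e : OrthonormalBasis ι ℝ V) (f : OrthonormalBasis κ ℝ V) :
    SameTensor e e f f := by
  intro B
  have h1 : ∀ i, B (e i) (e i) = ∑ j, inner ℝ (f j) (e i) * B (e i) (f j) := fun i ↦ by
    have h3 := congrArg (B (e i)) (f.sum_repr (e i))
    simp only [map_sum, map_smul, smul_eq_mul, f.repr_apply_apply] at h3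
    exact h3.symm
  have h2 : ∀ j, B (f j) (f j) = ∑ i, inner ℝ (f j) (e i) * B (e i) (f j) := fun j ↦ by
    have h3 := congrArg (fun v ↦ B v (f j)) (e.sum_repr (f j))
    simp only [map_sum, map_smul, LinearMap.sum_apply, LinearMap.smul_apply, smul_eq_mul,
      e.repr_apply_apply] at h3
    rw [← h3]
    exact Finset.sum_congr rfl fun i _ ↦ by rw [real_inner_comm]
  simp only [h1, h2]
  exact Finset.sum_comm

variable {X : Type*} [TopologicalSpace X] [ChartedSpace (EucSp 7) X]
  [RiemannianBundle (fun x : X ↦ TangentSpace (𝓡 7) x)]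

/-- A linear isometry from `ℝ⁷` onto a tangent space that takes the standard `G₂`-form to `φ`; it
intertwines the contractions because it takes orthonormal bases to orthonormal bases. -/
lemma exists_standardG2 {φ : DForm 7 X 3} (hφ : IsG2Structure φ) (x : X) :
    ∃ M : EucSp 7 →L[ℝ] EucSp 7, M.IsInvertible ∧ (∀ v, pb (formAt φ x) M v = standardG2 v) ∧
      ∀ {p : ℕ} (a : Alt (EucSp 7) (p + 3)), contr (stdB 7) (stdB 7) p 3 (pb (formAt φ x) M) (pb a M)
        = pb (contr (onb (n := 7) x) (onb x) p 3 (formAt φ x) a) M := by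
  obtain ⟨L, hL⟩ := hφ.2 x
  let M₀ : EucSp 7 →ₗ[ℝ] EucSp 7 := L.symm.toLinearEquiv.toLinearMap
  let M : EucSp 7 →L[ℝ] EucSp 7 := LinearMap.toContinuousLinearMap M₀
  have hM : ∀ v, L (M v) = v := fun v ↦ L.apply_symm_apply v
  refine ⟨M, isInvertible_of_injective fun u v huv ↦ by rw [← hM u, ← hM v, huv], fun v ↦ ?_,
    fun a ↦ ?_⟩
  · refine (hL fun i ↦ M (v i)).trans ?_
    simp only [hM]
  · let f := (tangentONB (n := 7) x).map L
    have h1 : ∀ i, M (f i) = onb x i := fun i ↦ by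
      have h2 : f i = L (tangentONB x i) := OrthonormalBasis.map_apply _ _ _
      rw [h2]
      exact L.symm_apply_apply _
    have h2 : SameTensor f f (stdB 7) (stdB 7) := by
      have := sameTensor_of_orthonormalBasis f (EuclideanSpace.basisFun (Fin 7) ℝ)
      have h3 : ⇑(EuclideanSpace.basisFun (Fin 7) ℝ) = stdB 7 := by
        funext i
        exact EuclideanSpace.basisFun_apply _ _ _
      rwa [h3] at this
    rw [← h2.contr_eq, contr_pb]
    simp only [h1]

variable {φ : DForm 7 X 3} (hφ : IsG2Structure φ)

include hφ

/-- On a manifold with a `G₂`-structure the contraction with `φ` is injective in degrees at least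
`5`. -/
lemma eq_zero_of_contrForm {p : ℕ} {a : DForm 7 X (p + 2 + 3)} (h : contrForm φ a = 0) : a = 0 := by
  funext x
  obtain ⟨M, hM, hb, hc⟩ := exists_standardG2 hφ x
  refine pb_injective hM (a := formAt a x) (b := 0) ?_
  have h1 := hc (formAt a x)
  have h2 : contr (onb (n := 7) x) (onb x) (p + 2) 3 (formAt φ x) (formAt a x) = 0 := congrFun h x
  rw [h2] at h1
  exact eq_zero_of_contr_standardG2_of_five_le hb h1

/-- On a manifold with a `G₂`-structure the wedge product with `φ` is injective in degrees at most
`2`. -/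
lemma eq_zero_of_wedgeForm {p : ℕ} (hp : p ≤ 2) {a : DForm 7 X p} (h : wedgeForm φ a = 0) :
    a = 0 := by
  funext x
  obtain ⟨M, hM, hb, -⟩ := exists_standardG2 hφ x
  refine pb_injective hM (a := formAt a x) (b := 0) ?_
  have h2 : wedge (V := EucSp 7) p 3 (formAt φ x) (formAt a x) = 0 := congrFun h x
  have h1 := wedge_pb (formAt φ x) (formAt a x) M
  rw [h2] at h1
  change pb _ M = (0 : Alt (EucSp 7) p)
  interval_cases p
  · exact eq_zero_of_wedge_standardG2_zero hb h1.symm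
  · exact eq_zero_of_wedge_standardG2_one hb h1.symm
  · exact eq_zero_of_wedge_standardG2_two hb h1.symm

end Transfer

end

end FormAlg

end

theorem theorem3 {X : Type*} [MetricSpace X] [ConnectedSpace X] [SecondCountableTopology X]
    [MeasurableSpace X] [BorelSpace X]
    [ChartedSpace (EuclideanSpace ℝ (Fin 7)) X] [IsManifold (𝓡 7) ∞ X]
    [Bundle.RiemannianBundle (fun x : X ↦ TangentSpace (𝓡 7) x)]
    [IsContMDiffRiemannianBundle (𝓡 7) ∞ (EuclideanSpace ℝ (Fin 7))
      (fun x : X ↦ TangentSpace (𝓡 7) x)]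
    [IsRiemannianManifold (𝓡 7) X] [CompleteSpace X]
    (φ : RiemForm.DForm 7 X 3) (hφ : RiemForm.IsG2Manifold φ) (hlin : φ.IsDLinear) :
    (∀ p : ℕ, p ≠ 3 → p ≠ 4 → RiemForm.l2Harmonic 7 X p = {0}) ∧
      RiemForm.l2Harmonic 7 X 2 = {0} := by
  have hproper : ProperSpace X := FormAlg.properSpace_of_complete 7 X
  have key : ∀ p : ℕ, p ≠ 3 → p ≠ 4 → RiemForm.l2Harmonic 7 X p = {0} := by
    intro p h3 h4
    refine Set.eq_singleton_iff_unique_mem.2 ⟨⟨FormAlg.isSmooth_zero, ?_, ?_⟩, ?_⟩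
    · have h0 : ∀ x, (0 : RiemForm.DForm 7 X p).pointNorm x = 0 := fun x ↦ by
        rw [RiemForm.DForm.pointNorm, FormAlg.pointInner_zero_right, Real.sqrt_zero]
      simp [h0]
    · cases p with
      | zero =>
        change (0 : RiemForm.DForm 7 X 0).extd.codiff = 0
        rw [FormAlg.extd_zero, FormAlg.codiff_zero]
      | succ p => rw [FormAlg.laplacian_succ, FormAlg.extd_zero, FormAlg.codiff_zero,
          FormAlg.codiff_zero, FormAlg.extd_zero, add_zero]
    · rintro a ⟨ha, hL, hΔ⟩
      rcases le_or_gt p 2 with hp | hp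
      · exact FormAlg.eq_zero_of_wedgeForm hφ.1 hp
          (FormAlg.wedgeForm_eq_zero hφ.1.1 hφ.2 hlin ha hL hΔ)
      · obtain ⟨q, rfl⟩ := Nat.exists_eq_add_of_le' (show 5 ≤ p by omega)
        exact FormAlg.eq_zero_of_contrForm (p := q) hφ.1
          (FormAlg.contrForm_eq_zero (p := q + 2) hφ.1.1 hφ.2 hlin ha hL hΔ)
  exact ⟨key, key 2 (by decide) (by decide)⟩
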